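/- Let $q\in\mathbf{C}$ with $|q|>1$ and let $\sigma_q$ be the operator $f(z)\mapsto f(qz)$, applied to matrices entrywise. Let $\mathcal{M}(\mathbf{C})$, $\mathcal{M}(\mathbf{C}_\infty)$ and $\mathcal{M}(\mathbf{C}^*)$ be the fields of meromorphic functions on $\mathbf{C}$, on $\mathbf{C}_\infty=(\mathbf{C}\cup\{\infty\})\setminus\{0\}$ and on $\mathbf{C}^*=\mathbf{C}\setminus\{0\}$; the first two, and $\mathbf{C}(z)$, are regarded as subfields of $\mathcal{M}(\mathbf{C}^*)$. Below, $n$ ranges over the integers $n\ge 0$, and morphisms are composed by multiplying matrices componentwise. Consider the following three categories. (1) $\mathcal{E}_f$, the category of fuchsian rational $q$-difference equations. An object is a matrix $A\in GL_n(\mathbf{C}(z))$ (representing the equation $\sigma_qX=AX$) that is fuchsian at $0$ and at $\infty$: there are $F\in GL_n(\mathcal{M}(\mathbf{C}))$ and $B\in GL_n(\mathbf{C}(z))$ with $B=(\sigma_qF)^{-1}AF$ and such that $B(0)$ is defined and belongs to $GL_n(\mathbf{C})$; and there are $F'\in GL_n(\mathcal{M}(\mathbf{C}_\infty))$ and $B'\in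 GL_n(\mathbf{C}(z))$ with $B'=(\sigma_qF')^{-1}AF'$ and such that $B'(\infty)$ is defined and belongs to $GL_n(\mathbf{C})$. A morphism from $A$ (of rank $n$) to $B$ (of rank $p$) is a matrix $F\in M_{p,n}(\mathbf{C}(z))$ such that $(\sigma_qF)A=BF$. (2) $\mathcal{S}$, the category of solutions. An object is a quadruple $(A^{(0)},M^{(0)},A^{(\infty)},M^{(\infty)})$ with $A^{(0)},A^{(\infty)}\in GL_n(\mathbf{C})$, $M^{(0)}\in GL_n(\mathcal{M}(\mathbf{C}))$, $M^{(\infty)}\in GL_n(\mathcal{M}(\mathbf{C}_\infty))$ that is connected, i.e. $$(\sigma_qM^{(0)})A^{(0)}(M^{(0)})^{-1}=(\sigma_qM^{(\infty)})A^{(\infty)}(M^{(\infty)})^{-1}.$$ This common value is then a matrix $A\in GL_n(\mathbf{C}(z))$, and $A$ is fuchsian. A morphism from $(A^{(0)},M^{(0)},A^{(\infty)},M^{(\infty)})$ to $(B^{(0)},N^{(0)},B^{(\infty)},N^{(\infty)})$ is a triple $(F,S^{(0)},S^{(\infty)})$ of matrices with coefficients in $\mathbf{C}(z)$, $\mathcal{M}(\mathbf{C})$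 and $\mathcal{M}(\mathbf{C}_\infty)$ respectively, such that $$(\sigma_qS^{(0)})A^{(0)}=B^{(0)}S^{(0)},\quad (\sigma_qS^{(\infty)})A^{(\infty)}=B^{(\infty)}S^{(\infty)},\quad FM^{(0)}=N^{(0)}S^{(0)},\quad FM^{(\infty)}=N^{(\infty)}S^{(\infty)}.$$ Then $F$ is a morphism in $\mathcal{E}_f$ between the associated equations. (3) $\mathcal{C}$, the category of connection triples. An object is a triple $(A^{(0)},M,A^{(\infty)})$ with $A^{(0)},A^{(\infty)}\in GL_n(\mathbf{C})$, $M\in GL_n(\mathcal{M}(\mathbf{C}^*))$ and $(\sigma_qM)A^{(0)}=A^{(\infty)}M$. A morphism from $(A^{(0)},M,A^{(\infty)})$ to $(B^{(0)},N,B^{(\infty)})$ is a pair $(S^{(0)},S^{(\infty)})$ of matrices with coefficients in $\mathcal{M}(\mathbf{C})$ and $\mathcal{M}(\mathbf{C}_\infty)$ respectively, such that $(\sigma_qS^{(0)})A^{(0)}=B^{(0)}S^{(0)}$, $(\sigma_qS^{(\infty)})A^{(\infty)}=B^{(\infty)}S^{(\infty)}$ and $S^{(\infty)}M=NS^{(0)}$.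 These categories are $\mathbf{C}$-linear through the $\mathbf{C}$-vector space structures on spaces of matrices. They are symmetric monoidal categories: the tensor product of objects and of morphisms is the componentwise Kronecker product of matrices, where a pair of indices $(i_1,i_2)$, $1\le i_1\le n_1$, $1\le i_2\le n_2$, is identified with $i_1+n_1(i_2-1)$; the unit object is the one whose matrices are all equal to $1\in GL_1$; the associativity and unit constraints are given by identity matrices; the commutativity constraint is given by the permutation matrices that exchange the two factors. Then the functor $\mathcal{S}\to\mathcal{E}_f$ given by $$(A^{(0)},M^{(0)},A^{(\infty)},M^{(\infty)})\mapsto A=(\sigma_qM^{(0)})A^{(0)}(M^{(0)})^{-1},\qquad (F,S^{(0)},S^{(\infty)})\mapsto F,$$ and the functor $\mathcal{S}\to\mathcal{C}$ given by $$(A^{(0)},M^{(0)},A^{(\infty)},M^{(\infty)})\mapsto (A^{(0)},(M^{(\infty)})^{-1}M^{(0)},A^{(\infty)}),\qquad (F,S^{(0)},S^{(\infty)})\mapsto (S^{(0)},S^{(\infty)}),$$ are both $\mathbf{C}$-linear tensor equivalences: each is an equivalence of categories, is additive and $\mathbf{C}$-linear, and is a symmetric monoidal functor whose structure isomorphisms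 (for tensor products and for the unit object) are given by identity matrices. -/

import Mathlib

open CategoryTheory MonoidalCategory Filter Topology
open scoped Kronecker

namespace QDiff

/-! ### Matrices and their tensor products -/

section Matrices

/-- The bijection `{1..m} × {1..n} → {1..mn}`, `(i, j) ↦ i + m (j - 1)` (written with indices
starting at `0`: `(i, j) ↦ i + m j`). -/
def pairing (m n : ℕ) : Fin m × Fin n ≃ Fin (m * n) :=
  ((Equiv.prodComm (Fin m) (Fin n)).trans finProdFinEquiv).trans (finCongr (Nat.mul_comm n m))

lemma pairing_val (m n : ℕ) (i : Fin m) (j : Fin n) :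
    (pairing m n (i, j) : ℕ) = i + m * j := by
  simp [pairing]

/-- The tensor product of matrices, with the index sets identified through `pairing`. -/
def kron {K : Type} [CommRing K] {p n p' n' : ℕ} (A : Matrix (Fin p) (Fin n) K)
    (B : Matrix (Fin p') (Fin n') K) : Matrix (Fin (p * p')) (Fin (n * n')) K :=
  Matrix.reindex (pairing p p') (pairing n n') (A ⊗ₖ B)

/-- The matrix of the linear map `K^m → K^n` sending the basis vector `j` to the basis
vector `e j`. -/
def permMat (K : Type) [CommRing K] {m n : ℕ} (e : Fin m ≃ Fin n) :
    Matrix (Fin n) (Fin m) K :=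
  (1 : Matrix (Fin n) (Fin n) K).submatrix id e

variable {K : Type} [CommRing K]

lemma kron_apply {p n p' n' : ℕ} (A : Matrix (Fin p) (Fin n) K)
    (B : Matrix (Fin p') (Fin n') K) (i : Fin p) (i' : Fin p') (j : Fin n) (j' : Fin n') :
    kron A B (pairing p p' (i, i')) (pairing n n' (j, j')) = A i j * B i' j' := by
  simp [kron]

lemma kron_mul {p n m p' n' m' : ℕ} (A : Matrix (Fin p) (Fin n) K) (B : Matrix (Fin n) (Fin m) K)
    (A' : Matrix (Fin p') (Fin n') K) (B' : Matrix (Fin n') (Fin m') K) :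
    kron A A' * kron B B' = kron (A * B) (A' * B') := by
  simp [kron, Matrix.mul_kronecker_mul, Matrix.submatrix_mul_equiv]

lemma kron_one (m n : ℕ) :
    kron (1 : Matrix (Fin m) (Fin m) K) (1 : Matrix (Fin n) (Fin n) K) = 1 := by
  simp [kron]

lemma kron_map {L : Type} [CommRing L] (f : K →+* L) {p n p' n' : ℕ}
    (A : Matrix (Fin p) (Fin n) K) (B : Matrix (Fin p') (Fin n') K) :
    (kron A B).map f = kron (A.map f) (B.map f) := by
  ext i j
  simp [kron]

lemma permMat_map {L : Type} [CommRing L] (f : K →+* L) {m n : ℕ} (e : Fin m ≃ Fin n) :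
    (permMat K e).map f = permMat L e := by
  ext i j
  simp [permMat, Matrix.one_apply, apply_ite f]

lemma permMat_mul_permMat {m n p : ℕ} (e : Fin m ≃ Fin n) (f : Fin n ≃ Fin p) :
    permMat K f * permMat K e = permMat K (e.trans f) := by
  ext i j
  simp [permMat, Matrix.mul_apply, Matrix.one_apply]

lemma permMat_refl (m : ℕ) : permMat K (Equiv.refl (Fin m)) = 1 := by
  simp [permMat]

/-- `permMat e * A` and `B * permMat e'` agree as soon as entries correspond. -/
lemma permMat_comm {m n p r : ℕ} (e : Fin m ≃ Fin n) (e' : Fin p ≃ Fin r)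
    (A : Matrix (Fin m) (Fin p) K) (B : Matrix (Fin n) (Fin r) K)
    (h : ∀ i j, B (e i) (e' j) = A i j) : permMat K e * A = B * permMat K e' := by
  ext i j
  obtain ⟨i, rfl⟩ := e.surjective i
  simp [permMat, Matrix.mul_apply, Matrix.one_apply, h]

/-- The bijection induced on products of index sets by two bijections. -/
def pairEquiv {m n m' n' : ℕ} (e : Fin m ≃ Fin n) (e' : Fin m' ≃ Fin n') :
    Fin (m * m') ≃ Fin (n * n') :=
  ((pairing m m').symm.trans (Equiv.prodCongr e e')).trans (pairing n n')

lemma pairEquiv_apply {m n m' n' : ℕ} (e : Fin m ≃ Fin n) (e' : Fin m' ≃ Fin n') (i : Fin m)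
    (j : Fin m') : pairEquiv e e' (pairing m m' (i, j)) = pairing n n' (e i, e' j) := by
  simp [pairEquiv]

lemma kron_permMat {m n m' n' : ℕ} (e : Fin m ≃ Fin n) (e' : Fin m' ≃ Fin n') :
    kron (permMat K e) (permMat K e') = permMat K (pairEquiv e e') := by
  ext i j
  obtain ⟨⟨i, i'⟩, rfl⟩ := (pairing _ _).surjective i
  obtain ⟨⟨j, j'⟩, rfl⟩ := (pairing _ _).surjective j
  rw [kron_apply]
  simp only [permMat, Matrix.submatrix_apply, id, Matrix.one_apply, pairEquiv_apply,
    EmbeddingLike.apply_eq_iff_eq, Prod.mk.injEq]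
  split_ifs <;> simp_all

lemma one_eq_permMat (m : ℕ) : (1 : Matrix (Fin m) (Fin m) K) = permMat K (Equiv.refl (Fin m)) :=
  (permMat_refl m).symm

/-- The identification `K^((a b) c) = K^(a (b c))`. -/
def assocEquiv (a b c : ℕ) : Fin (a * b * c) ≃ Fin (a * (b * c)) := finCongr (Nat.mul_assoc a b c)

/-- The identification `K^(1 a) = K^a`. -/
def leftEquiv (a : ℕ) : Fin (1 * a) ≃ Fin a := finCongr (Nat.one_mul a)

/-- The identification `K^(a 1) = K^a`. -/
def rightEquiv (a : ℕ) : Fin (a * 1) ≃ Fin a := finCongr (Nat.mul_one a)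

/-- The bijection of index sets exchanging the two factors of a tensor product. -/
def swapEquiv (a b : ℕ) : Fin (a * b) ≃ Fin (b * a) :=
  ((pairing a b).symm.trans (Equiv.prodComm _ _)).trans (pairing b a)

lemma assocEquiv_apply (a b c : ℕ) (i : Fin a) (j : Fin b) (k : Fin c) :
    assocEquiv a b c (pairing (a * b) c (pairing a b (i, j), k)) =
      pairing a (b * c) (i, pairing b c (j, k)) := by
  apply Fin.ext
  simp only [assocEquiv, finCongr_apply, Fin.val_cast, pairing_val]
  ring

lemma leftEquiv_apply (a : ℕ) (i : Fin 1) (j : Fin a) : leftEquiv a (pairing 1 a (i, j)) = j := by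
  apply Fin.ext
  simp [leftEquiv, pairing_val]

lemma rightEquiv_apply (a : ℕ) (i : Fin a) (j : Fin 1) :
    rightEquiv a (pairing a 1 (i, j)) = i := by
  apply Fin.ext
  simp [rightEquiv, pairing_val]

lemma swapEquiv_apply (a b : ℕ) (i : Fin a) (j : Fin b) :
    swapEquiv a b (pairing a b (i, j)) = pairing b a (j, i) := by
  simp [swapEquiv]

lemma swapEquiv_symm (a b : ℕ) : (swapEquiv a b).symm = swapEquiv b a := by
  ext i
  simp [swapEquiv]

lemma pentagon_mat (w x y z : ℕ) :
    (kron (1 : Matrix (Fin w) (Fin w) K) (permMat K (assocEquiv x y z)) *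
        permMat K (assocEquiv w (x * y) z)) *
        kron (permMat K (assocEquiv w x y)) (1 : Matrix (Fin z) (Fin z) K) =
      permMat K (assocEquiv w x (y * z)) * permMat K (assocEquiv (w * x) y z) := by
  simp only [one_eq_permMat, kron_permMat, permMat_mul_permMat]
  refine congrArg (permMat K) (Equiv.ext fun i => ?_)
  obtain ⟨⟨i, l⟩, rfl⟩ := (pairing _ _).surjective i
  obtain ⟨⟨i, k⟩, rfl⟩ := (pairing _ _).surjective i
  obtain ⟨⟨i, j⟩, rfl⟩ := (pairing _ _).surjective i
  simp [pairEquiv_apply, assocEquiv_apply]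

lemma hexagon_mat (x y z : ℕ) :
    (permMat K (assocEquiv y z x) * permMat K (swapEquiv x (y * z))) *
        permMat K (assocEquiv x y z) =
      (kron (1 : Matrix (Fin y) (Fin y) K) (permMat K (swapEquiv x z)) *
        permMat K (assocEquiv y x z)) *
        kron (permMat K (swapEquiv x y)) (1 : Matrix (Fin z) (Fin z) K) := by
  simp only [one_eq_permMat, kron_permMat, permMat_mul_permMat]
  refine congrArg (permMat K) (Equiv.ext fun i => ?_)
  obtain ⟨⟨i, l⟩, rfl⟩ := (pairing _ _).surjective i
  obtain ⟨⟨i, k⟩, rfl⟩ := (pairing _ _).surjective i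
  simp [pairEquiv_apply, assocEquiv_apply, swapEquiv_apply]

lemma assocEquiv_symm_apply (a b c : ℕ) (i : Fin a) (j : Fin b) (k : Fin c) :
    (assocEquiv a b c).symm (pairing a (b * c) (i, pairing b c (j, k))) =
      pairing (a * b) c (pairing a b (i, j), k) := by
  rw [Equiv.symm_apply_eq, assocEquiv_apply]

lemma hexagon_mat' (x y z : ℕ) :
    (permMat K (assocEquiv z x y).symm * permMat K (swapEquiv (x * y) z)) *
        permMat K (assocEquiv x y z).symm =
      (kron (permMat K (swapEquiv x z)) (1 : Matrix (Fin y) (Fin y) K) *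
        permMat K (assocEquiv x z y).symm) *
        kron (1 : Matrix (Fin x) (Fin x) K) (permMat K (swapEquiv y z)) := by
  simp only [one_eq_permMat, kron_permMat, permMat_mul_permMat]
  refine congrArg (permMat K) (Equiv.ext fun i => ?_)
  obtain ⟨⟨i, l⟩, rfl⟩ := (pairing _ _).surjective i
  obtain ⟨⟨l, k⟩, rfl⟩ := (pairing _ _).surjective l
  simp [pairEquiv_apply, assocEquiv_symm_apply, swapEquiv_apply]

end Matrices

/-! ### The category of matrices -/

/-- The category of matrices over `K`: the objects are the spaces `K^n`, the morphisms
`K^n → K^p` are the matrices in `M_{p,n}(K)`. -/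
structure MatCat (K : Type) where
  dim : ℕ

namespace MatCat

variable {K : Type} [CommRing K]

instance : Category (MatCat K) where
  Hom X Y := Matrix (Fin Y.dim) (Fin X.dim) K
  id X := (1 : Matrix (Fin X.dim) (Fin X.dim) K)
  comp {X Y Z} (f : Matrix (Fin Y.dim) (Fin X.dim) K) (g : Matrix (Fin Z.dim) (Fin Y.dim) K) :=
    g * f
  id_comp f := Matrix.mul_one f
  comp_id f := Matrix.one_mul f
  assoc f g h := (Matrix.mul_assoc h g f).symm

/-- The isomorphism given by a bijection between bases. -/
def permIso {X Y : MatCat K} (e : Fin X.dim ≃ Fin Y.dim) : X ≅ Y where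
  hom := permMat K e
  inv := permMat K e.symm
  hom_inv_id := (permMat_mul_permMat e e.symm).trans (by rw [Equiv.self_trans_symm, permMat_refl]; rfl)
  inv_hom_id := (permMat_mul_permMat e.symm e).trans (by rw [Equiv.symm_trans_self, permMat_refl]; rfl)

instance : MonoidalCategoryStruct (MatCat K) where
  tensorObj X Y := ⟨X.dim * Y.dim⟩
  whiskerLeft X _ _ f := kron (1 : Matrix (Fin X.dim) (Fin X.dim) K) f
  whiskerRight f Y := kron f (1 : Matrix (Fin Y.dim) (Fin Y.dim) K)
  tensorHom f g := kron f g
  tensorUnit := ⟨1⟩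
  associator X Y Z := permIso (assocEquiv X.dim Y.dim Z.dim)
  leftUnitor X := permIso (leftEquiv X.dim)
  rightUnitor X := permIso (rightEquiv X.dim)

instance : MonoidalCategory (MatCat K) :=
  MonoidalCategory.ofTensorHom
    (id_tensorHom_id := fun X Y => kron_one X.dim Y.dim)
    (id_tensorHom := fun _ _ _ _ => rfl)
    (tensorHom_id := fun _ _ => rfl)
    (tensorHom_comp_tensorHom := fun f₁ f₂ g₁ g₂ => kron_mul g₁ f₁ g₂ f₂)
    (associator_naturality := by
      intro X₁ X₂ X₃ Y₁ Y₂ Y₃ f₁ f₂ f₃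
      refine permMat_comm (K := K) (assocEquiv _ _ _) (assocEquiv _ _ _) _ _ fun i j => ?_
      obtain ⟨⟨i, i₃⟩, rfl⟩ := (pairing _ _).surjective i
      obtain ⟨⟨i₁, i₂⟩, rfl⟩ := (pairing _ _).surjective i
      obtain ⟨⟨j, j₃⟩, rfl⟩ := (pairing _ _).surjective j
      obtain ⟨⟨j₁, j₂⟩, rfl⟩ := (pairing _ _).surjective j
      rw [assocEquiv_apply, assocEquiv_apply]
      exact (((kron_apply (K := K) _ _ _ _ _ _).trans
        (congrArg _ (kron_apply (K := K) _ _ _ _ _ _))).trans (mul_assoc _ _ _).symm).trans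
          ((kron_apply (K := K) _ _ _ _ _ _).trans
            (congrArg (· * _) (kron_apply (K := K) _ _ _ _ _ _))).symm)
    (leftUnitor_naturality := by
      intro X Y f
      refine permMat_comm (K := K) (leftEquiv _) (leftEquiv _) _ _ fun i j => ?_
      obtain ⟨⟨i, i₂⟩, rfl⟩ := (pairing _ _).surjective i
      obtain ⟨⟨j, j₂⟩, rfl⟩ := (pairing _ _).surjective j
      obtain rfl := Subsingleton.elim i j
      rw [leftEquiv_apply, leftEquiv_apply]
      refine ((kron_apply (K := K) _ _ _ _ _ _).trans ?_).symm
      exact (congrArg (· * _) (Matrix.one_apply_eq (α := K) i)).trans (one_mul _))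
    (rightUnitor_naturality := by
      intro X Y f
      refine permMat_comm (K := K) (rightEquiv _) (rightEquiv _) _ _ fun i j => ?_
      obtain ⟨⟨i, i₂⟩, rfl⟩ := (pairing _ _).surjective i
      obtain ⟨⟨j, j₂⟩, rfl⟩ := (pairing _ _).surjective j
      obtain rfl := Subsingleton.elim i₂ j₂
      rw [rightEquiv_apply, rightEquiv_apply]
      refine ((kron_apply (K := K) _ _ _ _ _ _).trans ?_).symm
      exact (congrArg (_ * ·) (Matrix.one_apply_eq (α := K) i₂)).trans (mul_one _))
    (pentagon := fun W X Y Z => pentagon_mat W.dim X.dim Y.dim Z.dim)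
    (triangle := by
      intro X Y
      change kron (1 : Matrix (Fin X.dim) (Fin X.dim) K) (permMat K (leftEquiv _)) *
          permMat K (assocEquiv X.dim 1 Y.dim) =
        kron (permMat K (rightEquiv _)) (1 : Matrix (Fin Y.dim) (Fin Y.dim) K)
      simp only [one_eq_permMat, kron_permMat, permMat_mul_permMat]
      refine congrArg (permMat K) (Equiv.ext fun i => ?_)
      obtain ⟨⟨i, l⟩, rfl⟩ := (pairing _ _).surjective i
      obtain ⟨⟨i, k⟩, rfl⟩ := (pairing _ _).surjective i
      simp [pairEquiv_apply, assocEquiv_apply, leftEquiv_apply, rightEquiv_apply])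

lemma swap_natural {p n p' n' : ℕ} (A : Matrix (Fin p) (Fin n) K)
    (B : Matrix (Fin p') (Fin n') K) :
    permMat K (swapEquiv p p') * kron A B = kron B A * permMat K (swapEquiv n n') := by
  refine permMat_comm _ _ _ _ fun i j => ?_
  obtain ⟨⟨i, i₂⟩, rfl⟩ := (pairing _ _).surjective i
  obtain ⟨⟨j, j₂⟩, rfl⟩ := (pairing _ _).surjective j
  rw [swapEquiv_apply, swapEquiv_apply, kron_apply, kron_apply, mul_comm]

instance : SymmetricCategory (MatCat K) where
  braiding X Y := permIso (swapEquiv X.dim Y.dim)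
  braiding_naturality_right _ _ _ _ := swap_natural _ _
  braiding_naturality_left _ _ := swap_natural _ _
  hexagon_forward X Y Z := hexagon_mat X.dim Y.dim Z.dim
  hexagon_reverse X Y Z := hexagon_mat' X.dim Y.dim Z.dim
  symmetry X Y := by
    refine (permMat_mul_permMat (K := K) (swapEquiv X.dim Y.dim) (swapEquiv Y.dim X.dim)).trans ?_
    rw [← swapEquiv_symm, Equiv.symm_trans_self, permMat_refl]
    rfl

end MatCat

/-! ### Meromorphic functions -/

section Meromorphic

/-- The functions `ℂ → ℂ` that are meromorphic at every point of `ℂ*` (with arbitrary values at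
the poles, and at `0`). -/
def merFun : Subalgebra ℂ (ℂ → ℂ) where
  carrier := {f | MeromorphicOn f {0}ᶜ}
  mul_mem' hf hg := hf.mul hg
  add_mem' hf hg := hf.add hg
  algebraMap_mem' c := MeromorphicOn.const c

/-- The functions that vanish on `ℂ*` up to a closed discrete subset of `ℂ*`. -/
def negligible : Ideal merFun where
  carrier := {f | ∀ x : ℂ, x ≠ 0 → ∀ᶠ z in 𝓝[≠] x, f.1 z = 0}
  add_mem' {f g} hf hg x hx := by
    filter_upwards [hf x hx, hg x hx] with z h₁ h₂
    change f.1 z + g.1 z = 0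
    rw [h₁, h₂, add_zero]
  zero_mem' x _ := Eventually.of_forall fun _ => rfl
  smul_mem' c f hf x hx := by
    filter_upwards [hf x hx] with z h₁
    change c.1 z * f.1 z = 0
    rw [h₁, mul_zero]

/-- The field `M(ℂ*)` of meromorphic functions over `ℂ*`: two functions that agree outside a closed
discrete subset of `ℂ*` represent the same meromorphic function. -/
def MerStar : Type := merFun ⧸ negligible

noncomputable instance : CommRing MerStar := inferInstanceAs (CommRing (merFun ⧸ negligible))

noncomputable instance : Algebra ℂ MerStar := inferInstanceAs (Algebra ℂ (merFun ⧸ negligible))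

/-- The meromorphic function over `ℂ*` represented by a function. -/
noncomputable def MerStar.mk : merFun →ₐ[ℂ] MerStar := Ideal.Quotient.mkₐ ℂ negligible

lemma MerStar.mk_eq_mk {f g : merFun} :
    MerStar.mk f = MerStar.mk g ↔ ∀ x : ℂ, x ≠ 0 → ∀ᶠ z in 𝓝[≠] x, f.1 z = g.1 z := by
  change Ideal.Quotient.mk negligible f = Ideal.Quotient.mk negligible g ↔ _
  rw [Ideal.Quotient.eq]
  refine forall₂_congr fun x _ => eventually_congr (Eventually.of_forall fun z => ?_)
  exact sub_eq_zero

/-- The field `M(ℂ)` of meromorphic functions over `ℂ`, as a subfield of `M(ℂ*)`. -/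
noncomputable def merZero : Subalgebra ℂ MerStar :=
  Subalgebra.map MerStar.mk
    { carrier := {f : merFun | MeromorphicAt f.1 0}
      mul_mem' := fun hf hg => MeromorphicAt.mul hf hg
      add_mem' := fun hf hg => MeromorphicAt.add hf hg
      algebraMap_mem' := fun c => MeromorphicAt.const c 0 }

/-- The field `M(ℂ_∞)` of meromorphic functions over `ℂ_∞`, the Riemann sphere without `0`, as a
subfield of `M(ℂ*)`. -/
noncomputable def merInfty : Subalgebra ℂ MerStar :=
  Subalgebra.map MerStar.mk
    { carrier := {f : merFun | MeromorphicAt (fun w => f.1 w⁻¹) 0}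
      mul_mem' := fun hf hg => MeromorphicAt.mul hf hg
      add_mem' := fun hf hg => MeromorphicAt.add hf hg
      algebraMap_mem' := fun c => MeromorphicAt.const c 0 }

/-- The substitution `f(z) ↦ f(qz)` on functions. -/
def dilate (q : ℂˣ) : merFun →ₐ[ℂ] merFun where
  toFun f := ⟨fun z => f.1 (q * z), fun x hx =>
    (f.2 (q * x) (mul_ne_zero q.ne_zero hx)).comp_analyticAt (g := fun z => (q : ℂ) * z)
      (by fun_prop)⟩
  map_one' := rfl
  map_mul' _ _ := rfl
  map_zero' := rfl
  map_add' _ _ := rfl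
  commutes' _ := rfl

/-- The operator `σ_q : f(z) ↦ f(qz)` on `M(ℂ*)`. -/
noncomputable def sigma (q : ℂˣ) : MerStar →ₐ[ℂ] MerStar :=
  Ideal.quotientMapₐ negligible (dilate q) (by
    intro f hf x hx
    have h : Tendsto (fun z : ℂ => (q : ℂ) * z) (𝓝[≠] x) (𝓝[≠] ((q : ℂ) * x)) := by
      refine tendsto_nhdsWithin_of_tendsto_nhds_of_eventually_within _ ?_ ?_
      · exact ((continuous_const_mul (q : ℂ)).tendsto x).mono_left nhdsWithin_le_nhds
      · filter_upwards [self_mem_nhdsWithin] with z hz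
        simpa using hz
    exact h.eventually (hf (q * x) (mul_ne_zero q.ne_zero hx)))

lemma sigma_mk (q : ℂˣ) (f : merFun) : sigma q (MerStar.mk f) = MerStar.mk (dilate q f) := rfl

lemma ratFunc_denom_ne_zero (r : RatFunc ℂ) (x : ℂ) :
    ∀ᶠ z in 𝓝[≠] x, r.denom.eval₂ (RingHom.id ℂ) z ≠ 0 := by
  have hfin : {z : ℂ | r.denom.eval₂ (RingHom.id ℂ) z = 0}.Finite := by
    simpa [Polynomial.eval₂_id, Polynomial.IsRoot] using
      Polynomial.finite_setOfPred_isRoot (RatFunc.denom_ne_zero r)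
  have h := hfin.isClosed.isOpen_compl
  by_cases hx : r.denom.eval₂ (RingHom.id ℂ) x = 0
  · have h' : (({z : ℂ | r.denom.eval₂ (RingHom.id ℂ) z = 0} \ {x})ᶜ) ∈ 𝓝 x :=
      ((hfin.subset Set.sdiff_subset).isClosed.isOpen_compl).mem_nhds (by simp)
    filter_upwards [nhdsWithin_le_nhds h', self_mem_nhdsWithin] with z h₁ h₂ h₃
    exact h₁ ⟨h₃, h₂⟩
  · exact nhdsWithin_le_nhds (h.mem_nhds hx)

/-- The inclusion of the field `ℂ(z)` of rational functions in `M(ℂ*)`. -/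
noncomputable def ratToMer : RatFunc ℂ →ₐ[ℂ] MerStar where
  toFun r := MerStar.mk ⟨fun z => r.eval (RingHom.id ℂ) z, fun x _ => by
    simp only [RatFunc.eval, Polynomial.eval₂_id]
    exact (r.num.differentiable.analyticAt x).meromorphicAt.div
      (r.denom.differentiable.analyticAt x).meromorphicAt⟩
  map_one' := MerStar.mk_eq_mk.2 fun x _ => Eventually.of_forall fun z => RatFunc.eval_one ..
  map_zero' := MerStar.mk_eq_mk.2 fun x _ => Eventually.of_forall fun z => RatFunc.eval_zero ..
  map_mul' r s := by
    refine (MerStar.mk_eq_mk.2 fun x _ => ?_).trans (map_mul MerStar.mk _ _)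
    filter_upwards [ratFunc_denom_ne_zero r x, ratFunc_denom_ne_zero s x] with z h₁ h₂
    exact RatFunc.eval_mul _ _ h₁ h₂
  map_add' r s := by
    refine (MerStar.mk_eq_mk.2 fun x _ => ?_).trans (map_add MerStar.mk _ _)
    filter_upwards [ratFunc_denom_ne_zero r x, ratFunc_denom_ne_zero s x] with z h₁ h₂
    exact RatFunc.eval_add _ _ h₁ h₂
  commutes' c := by
    refine (MerStar.mk_eq_mk.2 fun x _ => Eventually.of_forall fun z => ?_).trans
      (MerStar.mk.commutes c)
    change RatFunc.eval _ z (algebraMap ℂ (RatFunc ℂ) c) = c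
    rw [RatFunc.algebraMap_eq_C, RatFunc.eval_C]
    rfl

instance : Nontrivial MerStar := by
  refine ⟨⟨0, 1, fun h => ?_⟩⟩
  have h' := MerStar.mk_eq_mk.1 ((map_zero MerStar.mk).trans (h.trans (map_one MerStar.mk).symm)) 1
    one_ne_zero
  obtain ⟨z, hz⟩ := h'.exists
  exact zero_ne_one hz

lemma ratToMer_injective : Function.Injective ratToMer := (ratToMer : RatFunc ℂ →+* MerStar).injective

lemma exists_polynomial_of_growth (N : ℕ) : ∀ h : ℂ → ℂ, Differentiable ℂ h →
    (∃ C R : ℝ, ∀ z, R ≤ ‖z‖ → ‖h z‖ ≤ C * ‖z‖ ^ N) → ∃ p : Polynomial ℂ, ∀ z, h z = p.eval z := by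
  induction N with
  | zero =>
    rintro h hd ⟨C, R, hC⟩
    have hb : Bornology.IsBounded (Set.range h) := by
      obtain ⟨D, hD⟩ := (isCompact_closedBall (0 : ℂ) R).exists_bound_of_continuousOn
        hd.continuous.continuousOn
      refine isBounded_iff_forall_norm_le.2 ⟨max C D, ?_⟩
      rintro _ ⟨z, rfl⟩
      rcases le_total R ‖z‖ with hz | hz
      · exact le_max_of_le_left (by simpa using hC z hz)
      · exact le_max_of_le_right (hD z (by simpa using hz))
    obtain ⟨c, hc⟩ := hd.exists_const_forall_eq_of_bounded hb
    exact ⟨Polynomial.C c, fun z => by simp [hc]⟩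
  | succ N ih =>
    rintro h hd ⟨C, R, hC⟩
    have hd' : Differentiable ℂ (dslope h 0) := by
      have := (Complex.differentiableOn_dslope (s := Set.univ) (c := 0) univ_mem (f := h)).2
        hd.differentiableOn
      exact differentiableOn_univ.1 this
    obtain ⟨p, hp⟩ := ih (dslope h 0) hd' ⟨C + ‖h 0‖, max R 1, fun z hz => by
      have hR : R ≤ ‖z‖ := (le_max_left _ _).trans hz
      have h1 : 1 ≤ ‖z‖ := (le_max_right _ _).trans hz
      have hz0 : z ≠ 0 := by rintro rfl; norm_num at h1
      rw [dslope_of_ne _ hz0, slope_def_field, sub_zero, norm_div, div_le_iff₀ (by linarith)]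
      calc ‖h z - h 0‖ ≤ ‖h z‖ + ‖h 0‖ := norm_sub_le _ _
        _ ≤ C * ‖z‖ ^ (N + 1) + ‖h 0‖ * ‖z‖ ^ (N + 1) := by
          refine add_le_add (hC z hR) ?_
          exact le_mul_of_one_le_right (norm_nonneg _) (one_le_pow₀ h1)
        _ = (C + ‖h 0‖) * ‖z‖ ^ N * ‖z‖ := by ring⟩
    refine ⟨Polynomial.C (h 0) + Polynomial.X * p, fun z => ?_⟩
    have := sub_smul_dslope h 0 z
    simp only [sub_zero, smul_eq_mul] at this
    simp only [Polynomial.eval_add, Polynomial.eval_C, Polynomial.eval_mul, Polynomial.eval_X]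
    rw [← hp z, this]
    ring

/-- A function that is meromorphic on the whole Riemann sphere is rational. -/
lemma exists_ratToMer_eq {φ : MerStar} (h₀ : φ ∈ merZero) (h₁ : φ ∈ merInfty) :
    ∃ r : RatFunc ℂ, ratToMer r = φ := by
  obtain ⟨f, hf, rfl⟩ := h₀
  obtain ⟨g, hg, hfg⟩ := h₁
  have hfg' := MerStar.mk_eq_mk.1 hfg
  change MeromorphicAt f.1 0 at hf
  change MeromorphicAt (fun w => g.1 w⁻¹) 0 at hg
  have hfm : ∀ x, MeromorphicAt f.1 x := fun x => by
    by_cases hx : x = 0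
    · exact hx ▸ hf
    · exact f.2 x hx
  -- local denominators
  choose n hn using hfm
  have hU : ∀ x : ℂ, ∃ U ∈ 𝓝 x, ∀ y ∈ U, AnalyticAt ℂ (fun z => (z - x) ^ n x • f.1 z) y :=
    fun x => ⟨_, (hn x).eventually_analyticAt, fun y hy => hy⟩
  choose U hU hUa using hU
  -- behaviour at infinity
  obtain ⟨k, hk⟩ := hg
  obtain ⟨δ, hδ, hδ'⟩ := Metric.eventually_nhds_iff.1
    (hk.eventually_analyticAt.and (hk.continuousAt.norm.eventually_le_const (lt_add_one _)))
  set M : ℝ := ‖((0 : ℂ) - 0) ^ k • g.1 (0 : ℂ)⁻¹‖ + 1 with hM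
  obtain ⟨R, hR0, hRδ⟩ : ∃ R : ℝ, 0 < R ∧ R⁻¹ ≤ δ := ⟨δ⁻¹, inv_pos.2 hδ, by simp⟩
  have hlarge : ∀ z : ℂ, R < ‖z‖ → z ≠ 0 ∧ dist z⁻¹ 0 < δ := fun z hz => by
    have hz0 : 0 < ‖z‖ := hR0.trans hz
    refine ⟨norm_pos_iff.1 hz0, ?_⟩
    rw [dist_zero_right, norm_inv]
    exact ((inv_lt_inv₀ hz0 hR0).2 hz).trans_le hRδ
  have hgan : ∀ z : ℂ, R < ‖z‖ → AnalyticAt ℂ g.1 z := fun z hz => by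
    obtain ⟨hz0, hzδ⟩ := hlarge z hz
    have h1 : AnalyticAt ℂ (fun y : ℂ => y ^ k * ((y⁻¹ - 0) ^ k • g.1 (y⁻¹)⁻¹)) z :=
      (analyticAt_id.pow k).mul
        (AnalyticAt.fun_comp (g := fun w => (w - 0) ^ k • g.1 w⁻¹) (f := fun y : ℂ => y⁻¹)
          (hδ' hzδ).1 (analyticAt_inv hz0))
    refine h1.congr ?_
    filter_upwards [isOpen_ne.mem_nhds hz0] with y hy
    have hy' : y ≠ 0 := hy
    simp only [sub_zero, inv_inv, smul_eq_mul, inv_pow]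
    field_simp
  have hgb : ∀ z : ℂ, R < ‖z‖ → ‖g.1 z‖ ≤ M * ‖z‖ ^ k := fun z hz => by
    obtain ⟨hz0, hzδ⟩ := hlarge z hz
    have h1 := (hδ' hzδ).2
    simp only [sub_zero, inv_inv, norm_smul, norm_pow, norm_inv] at h1
    have h2 : 0 < ‖z‖ ^ k := pow_pos (norm_pos_iff.2 hz0) k
    rw [inv_pow, inv_mul_le_iff₀ h2] at h1
    rw [mul_comm]
    exact h1
  -- a common denominator
  obtain ⟨t, -, ht⟩ := (isCompact_closedBall (0 : ℂ) (R + 1)).elim_nhds_subcover U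
    (fun x _ => hU x)
  set P : Polynomial ℂ := ∏ x ∈ t, (Polynomial.X - Polynomial.C x) ^ n x with hP
  have hP0 : P ≠ 0 :=
    Finset.prod_ne_zero_iff.2 fun x _ => pow_ne_zero _ (Polynomial.X_sub_C_ne_zero x)
  have hPan : ∀ (Q : Polynomial ℂ) (z : ℂ), AnalyticAt ℂ (fun y => Q.eval y) z :=
    fun Q z => Q.differentiable.analyticAt z
  have hPf : ∀ y : ℂ, ‖y‖ ≤ R + 1 → AnalyticAt ℂ (fun z => P.eval z * f.1 z) y := fun y hy => by
    have hy' : y ∈ Metric.closedBall (0 : ℂ) (R + 1) := by simpa using hy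
    obtain ⟨x, hxt, hyx⟩ := Set.mem_iUnion₂.1 (ht hy')
    have h1 := (hPan (∏ x ∈ t.erase x, (Polynomial.X - Polynomial.C x) ^ n x) y).mul (hUa x y hyx)
    refine h1.congr (Eventually.of_forall fun z => ?_)
    simp only [hP, ← Finset.mul_prod_erase t _ hxt, Pi.mul_apply, Polynomial.eval_mul,
      Polynomial.eval_pow,
      Polynomial.eval_sub, Polynomial.eval_X, Polynomial.eval_C, smul_eq_mul]
    ring
  have hPg : ∀ y : ℂ, R < ‖y‖ → AnalyticAt ℂ (fun z => P.eval z * g.1 z) y := fun y hy =>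
    (hPan P y).mul (hgan y hy)
  have hagree : ∀ y : ℂ, R < ‖y‖ → ‖y‖ ≤ R + 1 → P.eval y * f.1 y = P.eval y * g.1 y :=
    fun y h1 h2 => by
      have h3 : ∀ᶠ z in 𝓝[≠] y, P.eval z * g.1 z = P.eval z * f.1 z := by
        filter_upwards [hfg' y (hlarge y h1).1] with z hz
        rw [hz]
      exact ((((hPg y h1).frequently_eq_iff_eventually_eq (hPf y h2)).1
        h3.frequently).self_of_nhds).symm
  let h : ℂ → ℂ := fun z => if ‖z‖ ≤ R + 1 then P.eval z * f.1 z else P.eval z * g.1 z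
  have hin : ∀ z, ‖z‖ < R + 1 → h =ᶠ[𝓝 z] fun z => P.eval z * f.1 z := fun z hz => by
    filter_upwards [(isOpen_lt continuous_norm continuous_const).mem_nhds hz] with y hy
    exact if_pos (le_of_lt hy)
  have hout : ∀ z, R < ‖z‖ → h z = P.eval z * g.1 z := fun z hz => by
    by_cases h1 : ‖z‖ ≤ R + 1
    · exact (if_pos h1).trans (hagree z hz h1)
    · exact if_neg h1
  have hout' : ∀ z, R < ‖z‖ → h =ᶠ[𝓝 z] fun z => P.eval z * g.1 z := fun z hz => by
    filter_upwards [(isOpen_lt continuous_const continuous_norm).mem_nhds hz] with y hy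
    exact hout y hy
  have hd : Differentiable ℂ h := fun z => by
    rcases lt_or_ge R ‖z‖ with hz | hz
    · exact ((hPg z hz).congr (hout' z hz).symm).differentiableAt
    · exact ((hPf z (by linarith)).congr (hin z (by linarith)).symm).differentiableAt
  obtain ⟨p, hp⟩ := exists_polynomial_of_growth (P.natDegree + k) h hd
    ⟨(∑ i ∈ Finset.range (P.natDegree + 1), ‖P.coeff i‖) * M, R + 1, fun z hz => by
      have hzR : R < ‖z‖ := by linarith
      have hz1 : 1 ≤ ‖z‖ := by linarith
      rw [hout z hzR, norm_mul, pow_add]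
      have h1 : ‖P.eval z‖ ≤
          (∑ i ∈ Finset.range (P.natDegree + 1), ‖P.coeff i‖) * ‖z‖ ^ P.natDegree := by
        rw [Polynomial.eval_eq_sum_range, Finset.sum_mul]
        refine (norm_sum_le _ _).trans (Finset.sum_le_sum fun i hi => ?_)
        rw [norm_mul, norm_pow]
        exact mul_le_mul_of_nonneg_left
          (pow_le_pow_right₀ hz1 (Nat.lt_succ_iff.1 (Finset.mem_range.1 hi))) (norm_nonneg _)
      calc ‖P.eval z‖ * ‖g.1 z‖
          ≤ ((∑ i ∈ Finset.range (P.natDegree + 1), ‖P.coeff i‖) * ‖z‖ ^ P.natDegree) *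
            (M * ‖z‖ ^ k) := mul_le_mul h1 (hgb z hzR) (norm_nonneg _) (by positivity)
        _ = _ := by ring⟩
  have hpoly : ∀ Q : Polynomial ℂ, ratToMer (algebraMap _ _ Q) =
      MerStar.mk ⟨fun z => Q.eval z, fun x _ => (hPan Q x).meromorphicAt⟩ := fun Q => by
    refine MerStar.mk_eq_mk.2 fun x _ => Eventually.of_forall fun z => ?_
    change RatFunc.eval _ z (algebraMap _ _ Q) = Q.eval z
    rw [RatFunc.eval_algebraMap]
    rfl
  have hP0' : (algebraMap (Polynomial ℂ) (RatFunc ℂ) P) ≠ 0 := by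
    simpa using hP0
  have hunit : IsUnit (ratToMer (algebraMap _ _ P)) := (IsUnit.mk0 _ hP0').map ratToMer
  refine ⟨algebraMap _ _ p / algebraMap _ _ P, hunit.mul_left_cancel ?_⟩
  rw [← map_mul, mul_div_cancel₀ _ hP0', hpoly, hpoly]
  refine (MerStar.mk_eq_mk.2 fun x hx => ?_).trans (map_mul MerStar.mk _ _)
  change ∀ᶠ z in 𝓝[≠] x, p.eval z = P.eval z * f.1 z
  rcases lt_or_ge R ‖x‖ with hxR | hxR
  · filter_upwards [hfg' x hx, nhdsWithin_le_nhds (hout' x hxR)] with z h1 h2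
    rw [← hp z, h2, h1]
  · filter_upwards [nhdsWithin_le_nhds (hin x (by linarith))] with z h2
    rw [← hp z, h2]

lemma sigma_mem_merZero (q : ℂˣ) {φ : MerStar} (h : φ ∈ merZero) : sigma q φ ∈ merZero := by
  obtain ⟨f, hf, rfl⟩ := h
  refine ⟨dilate q f, ?_, rfl⟩
  have hf' : MeromorphicAt f.1 ((q : ℂ) * 0) := by rw [mul_zero]; exact hf
  exact hf'.comp_analyticAt (g := fun z => (q : ℂ) * z) (by fun_prop)

lemma sigma_mem_merInfty (q : ℂˣ) {φ : MerStar} (h : φ ∈ merInfty) : sigma q φ ∈ merInfty := by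
  obtain ⟨f, hf, rfl⟩ := h
  refine ⟨dilate q f, ?_, rfl⟩
  have hf' : MeromorphicAt (fun w => f.1 w⁻¹) ((q : ℂ)⁻¹ * 0) := by rw [mul_zero]; exact hf
  have := hf'.comp_analyticAt (g := fun z => (q : ℂ)⁻¹ * z) (by fun_prop)
  refine this.congr (Eventually.of_forall fun w => ?_)
  change f.1 ((q : ℂ)⁻¹ * w)⁻¹ = f.1 (q * w⁻¹)
  rw [mul_inv, inv_inv]

end Meromorphic

/-! ### Invertible matrices -/

section InvertibleMatrices

open Matrix.GeneralLinearGroup (map)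

variable {K L : Type} [CommRing K] [CommRing L]

/-- The tensor product of two invertible matrices. -/
def kronGL {m n : ℕ} (A : GL (Fin m) K) (B : GL (Fin n) K) : GL (Fin (m * n)) K where
  val := kron A.val B.val
  inv := kron A.inv B.inv
  val_inv := by rw [kron_mul, A.val_inv, B.val_inv, kron_one]
  inv_val := by rw [kron_mul, A.inv_val, B.inv_val, kron_one]

lemma kronGL_mul {m n : ℕ} (A A' : GL (Fin m) K) (B B' : GL (Fin n) K) :
    kronGL (A * A') (B * B') = kronGL A B * kronGL A' B' :=
  Units.ext (kron_mul A.val A'.val B.val B'.val).symm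

lemma kronGL_inv {m n : ℕ} (A : GL (Fin m) K) (B : GL (Fin n) K) :
    kronGL A⁻¹ B⁻¹ = (kronGL A B)⁻¹ := rfl

lemma kronGL_map (f : K →+* L) {m n : ℕ} (A : GL (Fin m) K) (B : GL (Fin n) K) :
    map f (kronGL A B) = kronGL (map f A) (map f B) :=
  Units.ext (kron_map f A.val B.val)

/-- Extension of scalars of a matrix to the field `M(ℂ*)`. -/
noncomputable abbrev up [Algebra ℂ K] (ι : K →ₐ[ℂ] MerStar) {m n : ℕ} (A : Matrix (Fin m) (Fin n) K) :
    Matrix (Fin m) (Fin n) MerStar :=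
  A.map ι

/-- Extension of scalars of an invertible matrix to the field `M(ℂ*)`. -/
noncomputable abbrev upGL [Algebra ℂ K] (ι : K →ₐ[ℂ] MerStar) {n : ℕ} :
    GL (Fin n) K →* GL (Fin n) MerStar :=
  map ι.toRingHom

/-- A matrix with complex coefficients, seen over the field `M(ℂ*)`. -/
noncomputable abbrev cst {n : ℕ} (A : GL (Fin n) ℂ) : GL (Fin n) MerStar :=
  upGL (Algebra.ofId ℂ MerStar) A

/-- The operator `σ_q` on matrices. -/
noncomputable abbrev shift (q : ℂˣ) {m n : ℕ} (A : Matrix (Fin m) (Fin n) MerStar) :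
    Matrix (Fin m) (Fin n) MerStar :=
  up (sigma q) A

/-- The operator `σ_q` on invertible matrices. -/
noncomputable abbrev shiftGL (q : ℂˣ) {n : ℕ} (A : GL (Fin n) MerStar) : GL (Fin n) MerStar :=
  upGL (sigma q) A

lemma exists_ratFunc_gl {n : ℕ} (B : GL (Fin n) MerStar)
    (h₀ : ∃ C : GL (Fin n) merZero, upGL merZero.val C = B)
    (h₁ : ∃ C : GL (Fin n) merInfty, upGL merInfty.val C = B) :
    ∃ R : GL (Fin n) (RatFunc ℂ), upGL ratToMer R = B := by
  have key : ∀ B : GL (Fin n) MerStar,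
      (∃ C : GL (Fin n) merZero, upGL merZero.val C = B) →
      (∃ C : GL (Fin n) merInfty, upGL merInfty.val C = B) →
      ∃ R : Matrix (Fin n) (Fin n) (RatFunc ℂ), up ratToMer R = B.val := by
    rintro _ ⟨C, rfl⟩ ⟨D, hD⟩
    have h : ∀ i j, ∃ r, ratToMer r = (upGL merZero.val C).val i j := fun i j =>
      exists_ratToMer_eq (C.val i j).2 (by rw [← hD]; exact (D.val i j).2)
    choose r hr using h
    exact ⟨Matrix.of r, by ext i j; exact hr i j⟩
  obtain ⟨R, hR⟩ := key B h₀ h₁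
  obtain ⟨R', hR'⟩ := key B⁻¹ (h₀.imp' (·⁻¹) fun C hC => by rw [← hC, map_inv])
    (h₁.imp' (·⁻¹) fun C hC => by rw [← hC, map_inv])
  have hinj : Function.Injective (up ratToMer : Matrix (Fin n) (Fin n) (RatFunc ℂ) → _) :=
    Matrix.map_injective ratToMer_injective
  have h1 : R * R' = 1 := hinj <| by
    rw [up, Matrix.map_mul]
    change up ratToMer R * up ratToMer R' = up ratToMer 1
    rw [hR, hR', up, Matrix.map_one _ (map_zero _) (map_one _)]
    exact B.val_inv
  have h2 : R' * R = 1 := hinj <| by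
    rw [up, Matrix.map_mul]
    change up ratToMer R' * up ratToMer R = up ratToMer 1
    rw [hR, hR', up, Matrix.map_one _ (map_zero _) (map_one _)]
    exact B.inv_val
  exact ⟨⟨R, R', h1, h2⟩, Units.ext hR⟩

lemma upGL_ratToMer_injective {n : ℕ} :
    Function.Injective (upGL ratToMer : GL (Fin n) (RatFunc ℂ) → GL (Fin n) MerStar) :=
  fun _ _ h => Units.ext (Matrix.map_injective ratToMer_injective (congrArg Units.val h))

end InvertibleMatrices

/-! ### Auxiliary facts on commuting squares of matrices -/

section Squares

variable {K : Type} [CommRing K] [Algebra ℂ K]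

lemma up_mul (ι : K →ₐ[ℂ] MerStar) {m n p : ℕ} (A : Matrix (Fin m) (Fin n) K)
    (B : Matrix (Fin n) (Fin p) K) : up ι (A * B) = up ι A * up ι B := Matrix.map_mul

lemma up_one (ι : K →ₐ[ℂ] MerStar) (n : ℕ) : up ι (1 : Matrix (Fin n) (Fin n) K) = 1 :=
  Matrix.map_one _ (map_zero _) (map_one _)

lemma up_add (ι : K →ₐ[ℂ] MerStar) {m n : ℕ} (A B : Matrix (Fin m) (Fin n) K) :
    up ι (A + B) = up ι A + up ι B := Matrix.map_add _ (map_add ι) A B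

lemma up_zero (ι : K →ₐ[ℂ] MerStar) (m n : ℕ) :
    up ι (0 : Matrix (Fin m) (Fin n) K) = 0 := Matrix.map_zero _ (map_zero ι)

lemma up_smul (ι : K →ₐ[ℂ] MerStar) {m n : ℕ} (c : ℂ) (A : Matrix (Fin m) (Fin n) K) :
    up ι (c • A) = c • up ι A := by ext i j; exact map_smul ι c _

lemma up_kron (ι : K →ₐ[ℂ] MerStar) {p n p' n' : ℕ} (A : Matrix (Fin p) (Fin n) K)
    (B : Matrix (Fin p') (Fin n') K) : up ι (kron A B) = kron (up ι A) (up ι B) :=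
  kron_map ι.toRingHom A B

lemma up_permMat (ι : K →ₐ[ℂ] MerStar) {m n : ℕ} (e : Fin m ≃ Fin n) :
    up ι (permMat K e) = permMat MerStar e := permMat_map ι.toRingHom e

/-- `F` and `G` are the vertical sides of a commutative square with horizontal sides `A`, `B`. -/
def Sq {L : Type} [CommRing L] {n n' p p' : ℕ} (A : Matrix (Fin n') (Fin n) L)
    (B : Matrix (Fin p') (Fin p) L)
    (F : Matrix (Fin p') (Fin n') L) (G : Matrix (Fin p) (Fin n) L) : Prop :=
  F * A = B * G

namespace Sq

variable {L : Type} [CommRing L]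

lemma one {n n' : ℕ} (A : Matrix (Fin n') (Fin n) L) : Sq A A 1 1 := by simp [Sq]

variable {n n' p p' m m' : ℕ} {A : Matrix (Fin n') (Fin n) L} {B : Matrix (Fin p') (Fin p) L}
  {C : Matrix (Fin m') (Fin m) L}
  {F F' : Matrix (Fin p') (Fin n') L} {G G' : Matrix (Fin p) (Fin n) L}

lemma comp {F' : Matrix (Fin m') (Fin p') L} {G' : Matrix (Fin m) (Fin p) L}
    (h : Sq A B F G) (h' : Sq B C F' G') : Sq A C (F' * F) (G' * G) := by
  unfold Sq at *
  rw [Matrix.mul_assoc, h, ← Matrix.mul_assoc, h', Matrix.mul_assoc]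

lemma add (h : Sq A B F G) (h' : Sq A B F' G') : Sq A B (F + F') (G + G') := by
  unfold Sq at *
  rw [Matrix.add_mul, Matrix.mul_add, h, h']

lemma zero : Sq A B (0 : Matrix (Fin p') (Fin n') L) (0 : Matrix (Fin p) (Fin n) L) := by
  simp [Sq]

lemma smul [Algebra ℂ L] (c : ℂ) (h : Sq A B F G) : Sq A B (c • F) (c • G) := by
  unfold Sq at *
  rw [Matrix.smul_mul, Matrix.mul_smul, h]

lemma kron {r r' s s' : ℕ} {A₂ : Matrix (Fin r') (Fin r) L} {B₂ : Matrix (Fin s') (Fin s) L}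
    {F₂ : Matrix (Fin s') (Fin r') L} {G₂ : Matrix (Fin s) (Fin r) L}
    (h : Sq A B F G) (h₂ : Sq A₂ B₂ F₂ G₂) :
    Sq (kron A A₂) (kron B B₂) (kron F F₂) (QDiff.kron G G₂) := by
  unfold Sq at *
  rw [kron_mul, kron_mul, h, h₂]

lemma perm_symm {e : Fin n' ≃ Fin p'} {e' : Fin n ≃ Fin p}
    (h : Sq A B (permMat L e) (permMat L e')) :
    Sq B A (permMat L e.symm) (permMat L e'.symm) := by
  unfold Sq at *
  calc permMat L e.symm * B
      = permMat L e.symm * (B * (permMat L e' * permMat L e'.symm)) := by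
        rw [permMat_mul_permMat, Equiv.symm_trans_self, permMat_refl, Matrix.mul_one]
    _ = permMat L e.symm * ((permMat L e * A) * permMat L e'.symm) := by
        rw [h, Matrix.mul_assoc]
    _ = (permMat L e.symm * permMat L e) * (A * permMat L e'.symm) := by
        simp only [Matrix.mul_assoc]
    _ = A * permMat L e'.symm := by
        rw [permMat_mul_permMat, Equiv.self_trans_symm, permMat_refl, Matrix.one_mul]

lemma assoc (A : Matrix (Fin n') (Fin n) L) (B : Matrix (Fin p') (Fin p) L)
    (C : Matrix (Fin m') (Fin m) L) :
    Sq (QDiff.kron (QDiff.kron A B) C) (QDiff.kron A (QDiff.kron B C))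
      (permMat L (assocEquiv n' p' m')) (permMat L (assocEquiv n p m)) :=
  associator_naturality (C := MatCat L) (X₁ := ⟨n⟩) (X₂ := ⟨p⟩) (X₃ := ⟨m⟩) (Y₁ := ⟨n'⟩)
    (Y₂ := ⟨p'⟩) (Y₃ := ⟨m'⟩) A B C

lemma left (A : Matrix (Fin n') (Fin n) L) :
    Sq (QDiff.kron (1 : Matrix (Fin 1) (Fin 1) L) A) A
      (permMat L (leftEquiv n')) (permMat L (leftEquiv n)) :=
  leftUnitor_naturality (C := MatCat L) (X := ⟨n⟩) (Y := ⟨n'⟩) A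

lemma right (A : Matrix (Fin n') (Fin n) L) :
    Sq (QDiff.kron A (1 : Matrix (Fin 1) (Fin 1) L)) A
      (permMat L (rightEquiv n')) (permMat L (rightEquiv n)) :=
  rightUnitor_naturality (C := MatCat L) (X := ⟨n⟩) (Y := ⟨n'⟩) A

lemma swap (A : Matrix (Fin n') (Fin n) L) (B : Matrix (Fin p') (Fin p) L) :
    Sq (QDiff.kron A B) (QDiff.kron B A)
      (permMat L (swapEquiv n' p')) (permMat L (swapEquiv n p)) :=
  MatCat.swap_natural A B

end Sq

/-- The morphisms of matrices used below are given by commutative squares over `M(ℂ*)`: the matrices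
`F` (over `K₁`) and `G` (over `K₂`) satisfy `F A = B G` after extension of scalars to `M(ℂ*)`. -/
def Square {K₁ K₂ : Type} [CommRing K₁] [Algebra ℂ K₁] [CommRing K₂] [Algebra ℂ K₂]
    (ι₁ : K₁ →ₐ[ℂ] MerStar) (ι₂ : K₂ →ₐ[ℂ] MerStar) {n p : ℕ} (A : GL (Fin n) MerStar)
    (B : GL (Fin p) MerStar) (F : Matrix (Fin p) (Fin n) K₁) (G : Matrix (Fin p) (Fin n) K₂) :
    Prop :=
  up ι₁ F * A.val = B.val * up ι₂ G

/-- The matrix `F` satisfies `(σ_q F) A = B F`, over `M(ℂ*)`. -/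
abbrev Intertwines (q : ℂˣ) (ι : K →ₐ[ℂ] MerStar) {n p : ℕ} (A : GL (Fin n) MerStar)
    (B : GL (Fin p) MerStar) (F : Matrix (Fin p) (Fin n) K) : Prop :=
  Square ((sigma q).comp ι) ι A B F F

lemma intertwines_iff {q : ℂˣ} {ι : K →ₐ[ℂ] MerStar} {n p : ℕ} {A : GL (Fin n) MerStar}
    {B : GL (Fin p) MerStar} {F : Matrix (Fin p) (Fin n) K} :
    Intertwines q ι A B F ↔ shift q (up ι F) * A.val = B.val * up ι F := Iff.rfl

namespace Square

variable {K₁ K₂ : Type} [CommRing K₁] [Algebra ℂ K₁] [CommRing K₂] [Algebra ℂ K₂]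
  {ι₁ : K₁ →ₐ[ℂ] MerStar} {ι₂ : K₂ →ₐ[ℂ] MerStar} {n p m n' p' m' : ℕ} {A : GL (Fin n) MerStar}
  {B : GL (Fin p) MerStar} {C : GL (Fin m) MerStar} {A' : GL (Fin n') MerStar}
  {B' : GL (Fin p') MerStar}
  {F F' : Matrix (Fin p) (Fin n) K₁} {G G' : Matrix (Fin p) (Fin n) K₂}

lemma one : Square ι₁ ι₂ A A 1 1 := by
  unfold Square; rw [up_one, up_one]; exact Sq.one _

lemma comp {F₂ : Matrix (Fin m) (Fin p) K₁} {G₂ : Matrix (Fin m) (Fin p) K₂}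
    (h : Square ι₁ ι₂ A B F G) (h₂ : Square ι₁ ι₂ B C F₂ G₂) :
    Square ι₁ ι₂ A C (F₂ * F) (G₂ * G) := by
  unfold Square; rw [up_mul, up_mul]; exact Sq.comp h h₂

lemma add (h : Square ι₁ ι₂ A B F G) (h' : Square ι₁ ι₂ A B F' G') :
    Square ι₁ ι₂ A B (F + F') (G + G') := by
  unfold Square; rw [up_add, up_add]; exact Sq.add h h'

lemma zero : Square ι₁ ι₂ A B 0 0 := by
  unfold Square; rw [up_zero, up_zero]; exact Sq.zero

lemma smul (c : ℂ) (h : Square ι₁ ι₂ A B F G) : Square ι₁ ι₂ A B (c • F) (c • G) := by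
  unfold Square; rw [up_smul, up_smul]; exact Sq.smul c h

lemma kron {F' : Matrix (Fin p') (Fin n') K₁} {G' : Matrix (Fin p') (Fin n') K₂}
    {A₂ : GL (Fin (n * n')) MerStar} {B₂ : GL (Fin (p * p')) MerStar}
    (hA : A₂ = kronGL A A') (hB : B₂ = kronGL B B')
    (h : Square ι₁ ι₂ A B F G) (h' : Square ι₁ ι₂ A' B' F' G') :
    Square ι₁ ι₂ A₂ B₂ (kron F F') (QDiff.kron G G') := by
  subst hA hB; unfold Square; rw [up_kron, up_kron]; exact Sq.kron h h'

lemma perm_symm {e : Fin n ≃ Fin p} (h : Square ι₁ ι₂ A B (permMat K₁ e) (permMat K₂ e)) :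
    Square ι₁ ι₂ B A (permMat K₁ e.symm) (permMat K₂ e.symm) := by
  unfold Square at *; rw [up_permMat, up_permMat] at *; exact Sq.perm_symm h

lemma assoc {A₂ : GL (Fin (n * p * m)) MerStar} {B₂ : GL (Fin (n * (p * m))) MerStar}
    (hA : A₂ = kronGL (kronGL A B) C) (hB : B₂ = kronGL A (kronGL B C)) :
    Square ι₁ ι₂ A₂ B₂ (permMat K₁ (assocEquiv n p m)) (permMat K₂ (assocEquiv n p m)) := by
  subst hA hB; unfold Square; rw [up_permMat, up_permMat]; exact Sq.assoc _ _ _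

lemma left {A₂ : GL (Fin (1 * n)) MerStar} (hA : A₂ = kronGL 1 A) :
    Square ι₁ ι₂ A₂ A (permMat K₁ (leftEquiv n)) (permMat K₂ (leftEquiv n)) := by
  subst hA; unfold Square; rw [up_permMat, up_permMat]; exact Sq.left _

lemma right {A₂ : GL (Fin (n * 1)) MerStar} (hA : A₂ = kronGL A 1) :
    Square ι₁ ι₂ A₂ A (permMat K₁ (rightEquiv n)) (permMat K₂ (rightEquiv n)) := by
  subst hA; unfold Square; rw [up_permMat, up_permMat]; exact Sq.right _

lemma swap {A₂ : GL (Fin (n * p)) MerStar} {B₂ : GL (Fin (p * n)) MerStar}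
    (hA : A₂ = kronGL A B) (hB : B₂ = kronGL B A) :
    Square ι₁ ι₂ A₂ B₂ (permMat K₁ (swapEquiv n p)) (permMat K₂ (swapEquiv n p)) := by
  subst hA hB; unfold Square; rw [up_permMat, up_permMat]; exact Sq.swap _ _

end Square

lemma upGL_kron (ι : K →ₐ[ℂ] MerStar) {m n : ℕ} (A : GL (Fin m) K) (B : GL (Fin n) K) :
    upGL ι (kronGL A B) = kronGL (upGL ι A) (upGL ι B) := kronGL_map _ A B

lemma upGL_kron_one (ι : K →ₐ[ℂ] MerStar) {m : ℕ} (A : GL (Fin m) K) :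
    upGL ι (kronGL A (1 : GL (Fin 1) K)) = kronGL (upGL ι A) 1 := by
  rw [upGL_kron, map_one]

lemma upGL_one_kron (ι : K →ₐ[ℂ] MerStar) {m : ℕ} (A : GL (Fin m) K) :
    upGL ι (kronGL (1 : GL (Fin 1) K) A) = kronGL 1 (upGL ι A) := by
  rw [upGL_kron, map_one]

lemma upGL_kron_left (ι : K →ₐ[ℂ] MerStar) {m n p : ℕ} (A : GL (Fin m) K) (B : GL (Fin n) K)
    (C : GL (Fin p) K) : upGL ι (kronGL (kronGL A B) C) =
      kronGL (kronGL (upGL ι A) (upGL ι B)) (upGL ι C) := by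
  rw [upGL_kron, upGL_kron]

lemma upGL_kron_right (ι : K →ₐ[ℂ] MerStar) {m n p : ℕ} (A : GL (Fin m) K) (B : GL (Fin n) K)
    (C : GL (Fin p) K) : upGL ι (kronGL A (kronGL B C)) =
      kronGL (upGL ι A) (kronGL (upGL ι B) (upGL ι C)) := by
  rw [upGL_kron, upGL_kron]

lemma triangle_mat {L : Type} [CommRing L] (m n : ℕ) :
    kron (1 : Matrix (Fin m) (Fin m) L) (permMat L (leftEquiv n)) *
        permMat L (assocEquiv m 1 n) =
      kron (permMat L (rightEquiv m)) (1 : Matrix (Fin n) (Fin n) L) :=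
  triangle (C := MatCat L) ⟨m⟩ ⟨n⟩

lemma swap_mat {L : Type} [CommRing L] (m n : ℕ) :
    permMat L (swapEquiv n m) * permMat L (swapEquiv m n) = 1 :=
  SymmetricCategory.symmetry (C := MatCat L) ⟨m⟩ ⟨n⟩

lemma permMat_symm_mul {L : Type} [CommRing L] {m n : ℕ} (e : Fin m ≃ Fin n) :
    permMat L e.symm * permMat L e = 1 := by
  rw [permMat_mul_permMat, Equiv.self_trans_symm, permMat_refl]

lemma permMat_mul_symm {L : Type} [CommRing L] {m n : ℕ} (e : Fin m ≃ Fin n) :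
    permMat L e * permMat L e.symm = 1 := by
  rw [permMat_mul_permMat, Equiv.symm_trans_self, permMat_refl]

end Squares

/-! ### The tensor category of rational `q`-difference equations -/

/-- A linear rational `q`-difference equation `σ_q X = A X`, where `A ∈ GL_n(ℂ(z))`. -/
structure Eqn (q : ℂˣ) where
  dim : ℕ
  mat : GL (Fin dim) (RatFunc ℂ)

namespace Eqn

variable {q : ℂˣ}

/-- The morphisms from `σ_q X = A X` to `σ_q X = B X`: the matrices `F` with rational coefficients
such that `(σ_q F) A = B F`. -/
noncomputable def homs (X Y : Eqn q) :
    Submodule ℂ (Matrix (Fin Y.dim) (Fin X.dim) (RatFunc ℂ)) where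
  carrier := {F | Intertwines q ratToMer (upGL ratToMer X.mat) (upGL ratToMer Y.mat) F}
  add_mem' hF hG := Square.add hF hG
  zero_mem' := Square.zero
  smul_mem' c _ hF := Square.smul c hF

/-- The category `ℰ` of rational `q`-difference equations. -/
noncomputable instance : Category (Eqn q) where
  Hom X Y := homs X Y
  id _ := ⟨1, Square.one⟩
  comp f g := ⟨g.1 * f.1, Square.comp f.2 g.2⟩
  id_comp f := Subtype.ext (Matrix.mul_one f.1)
  comp_id f := Subtype.ext (Matrix.one_mul f.1)
  assoc f g h := Subtype.ext (Matrix.mul_assoc h.1 g.1 f.1).symm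

/-- The matrix with rational coefficients underlying a morphism. -/
def toMat {X Y : Eqn q} (f : X ⟶ Y) : Matrix (Fin Y.dim) (Fin X.dim) (RatFunc ℂ) := f.1

noncomputable instance : Preadditive (Eqn q) where
  homGroup X Y := inferInstanceAs (AddCommGroup (homs X Y))
  add_comp _ _ _ f f' g := Subtype.ext (Matrix.mul_add g.1 f.1 f'.1)
  comp_add _ _ _ f g g' := Subtype.ext (Matrix.add_mul g.1 g'.1 f.1)

noncomputable instance : Linear ℂ (Eqn q) where
  homModule X Y := inferInstanceAs (Module ℂ (homs X Y))
  smul_comp _ _ _ r f g := Subtype.ext (Matrix.mul_smul g.1 r f.1)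
  comp_smul _ _ _ f r g := Subtype.ext (Matrix.smul_mul r g.1 f.1)

/-- The isomorphism given by a bijection between bases that is compatible with the equations. -/
noncomputable def permIso {X Y : Eqn q} (e : Fin X.dim ≃ Fin Y.dim)
    (h : Intertwines q ratToMer (upGL ratToMer X.mat) (upGL ratToMer Y.mat) (permMat _ e)) :
    X ≅ Y where
  hom := ⟨permMat _ e, h⟩
  inv := ⟨permMat _ e.symm, Square.perm_symm h⟩
  hom_inv_id := Subtype.ext (permMat_symm_mul e)
  inv_hom_id := Subtype.ext (permMat_mul_symm e)

/-- The equation with matrix `A ⊗ B`. -/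
noncomputable def tensor (X Y : Eqn q) : Eqn q := ⟨X.dim * Y.dim, kronGL X.mat Y.mat⟩

/-- The equation `σ_q f = f`. -/
noncomputable def unit (q : ℂˣ) : Eqn q := ⟨1, 1⟩

/-- The tensor product of morphisms. -/
noncomputable def tensorHoms {X Y X' Y' : Eqn q} (f : homs X Y) (g : homs X' Y') :
    homs (X.tensor X') (Y.tensor Y') :=
  ⟨kron f.1 g.1, Square.kron (upGL_kron _ _ _) (upGL_kron _ _ _) f.2 g.2⟩

/-- The tensor structure; the associativity and unity constraints are given by the identity
matrices. -/
noncomputable instance : MonoidalCategoryStruct (Eqn q) where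
  tensorObj X Y := X.tensor Y
  whiskerLeft X _ _ f := tensorHoms (𝟙 X : X ⟶ X) f
  whiskerRight f Y := tensorHoms f (𝟙 Y : Y ⟶ Y)
  tensorHom f g := tensorHoms f g
  tensorUnit := unit q
  associator X Y Z := permIso (X := (X.tensor Y).tensor Z) (Y := X.tensor (Y.tensor Z))
    (assocEquiv X.dim Y.dim Z.dim)
    (Square.assoc (upGL_kron_left _ _ _ _) (upGL_kron_right _ _ _ _))
  leftUnitor X := permIso (X := (unit q).tensor X) (leftEquiv X.dim)
    (Square.left (upGL_one_kron _ _))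
  rightUnitor X := permIso (X := X.tensor (unit q)) (rightEquiv X.dim)
    (Square.right (upGL_kron_one _ _))

noncomputable instance : MonoidalCategory (Eqn q) :=
  MonoidalCategory.ofTensorHom
    (id_tensorHom_id := fun X Y => Subtype.ext (kron_one (K := RatFunc ℂ) X.dim Y.dim))
    (id_tensorHom := fun _ _ _ _ => rfl)
    (tensorHom_id := fun _ _ => rfl)
    (tensorHom_comp_tensorHom := fun f₁ f₂ g₁ g₂ => Subtype.ext (kron_mul g₁.1 f₁.1 g₂.1 f₂.1))
    (associator_naturality := fun f₁ f₂ f₃ => Subtype.ext (Sq.assoc f₁.1 f₂.1 f₃.1))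
    (leftUnitor_naturality := fun f => Subtype.ext (Sq.left f.1))
    (rightUnitor_naturality := fun f => Subtype.ext (Sq.right f.1))
    (pentagon := fun W X Y Z => Subtype.ext (pentagon_mat W.dim X.dim Y.dim Z.dim))
    (triangle := fun X Y => Subtype.ext (triangle_mat X.dim Y.dim))

/-- The commutativity constraint exchanges the two factors. -/
noncomputable instance : SymmetricCategory (Eqn q) where
  braiding X Y := permIso (X := X.tensor Y) (Y := Y.tensor X) (swapEquiv X.dim Y.dim)
    (Square.swap (upGL_kron _ _ _) (upGL_kron _ _ _))
  braiding_naturality_right _ _ _ f := Subtype.ext (MatCat.swap_natural _ f.1)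
  braiding_naturality_left f _ := Subtype.ext (MatCat.swap_natural f.1 _)
  hexagon_forward X Y Z := Subtype.ext (hexagon_mat X.dim Y.dim Z.dim)
  hexagon_reverse X Y Z := Subtype.ext (hexagon_mat' X.dim Y.dim Z.dim)
  symmetry X Y := Subtype.ext (swap_mat X.dim Y.dim)

end Eqn

/-! ### Fuchsian equations -/

section Fuchsian

/-- The matrix `B ∈ GL_n(ℂ(z))` has a limit in `GL_n(ℂ)` along the filter `l`. With `l = 𝓝[≠] 0`
(resp. `l = Bornology.cobounded ℂ`), this says that `B(0)` (resp. `B(∞)`) is defined and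
invertible. -/
def HasInvertibleValue (l : Filter ℂ) {n : ℕ} (B : GL (Fin n) (RatFunc ℂ)) : Prop :=
  ∃ B₀ : GL (Fin n) ℂ, ∀ i j,
    Tendsto (fun z => (B.val i j).eval (RingHom.id ℂ) z) l (𝓝 (B₀.val i j))

/-- The equation is fuchsian at `0`: a gauge transformation with coefficients in `M(ℂ)` transforms
it into an equation with matrix `B ∈ GL_n(ℂ(z))` such that `B(0) ∈ GL_n(ℂ)`. -/
def Eqn.IsFuchsianAtZero {q : ℂˣ} (X : Eqn q) : Prop :=
  ∃ (B : GL (Fin X.dim) (RatFunc ℂ)) (F : GL (Fin X.dim) merZero),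
    HasInvertibleValue (𝓝[≠] 0) B ∧
    upGL ratToMer B =
      (shiftGL q (upGL merZero.val F))⁻¹ * upGL ratToMer X.mat * upGL merZero.val F

/-- The equation is fuchsian at `∞`: a gauge transformation with coefficients in `M(ℂ_∞)` transforms
it into an equation with matrix `B ∈ GL_n(ℂ(z))` such that `B(∞) ∈ GL_n(ℂ)`. -/
def Eqn.IsFuchsianAtInfty {q : ℂˣ} (X : Eqn q) : Prop :=
  ∃ (B : GL (Fin X.dim) (RatFunc ℂ)) (F : GL (Fin X.dim) merInfty),
    HasInvertibleValue (Bornology.cobounded ℂ) B ∧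
    upGL ratToMer B =
      (shiftGL q (upGL merInfty.val F))⁻¹ * upGL ratToMer X.mat * upGL merInfty.val F

/-- The property of being fuchsian over the Riemann sphere. -/
def isFuchsian (q : ℂˣ) : ObjectProperty (Eqn q) :=
  fun X => X.IsFuchsianAtZero ∧ X.IsFuchsianAtInfty

/-- The category `ℰ_f` of fuchsian `q`-difference equations, a full subcategory of the category of
rational `q`-difference equations (with the induced tensor structure). -/
abbrev FuchsEqn (q : ℂˣ) : Type := (isFuchsian q).FullSubcategory

lemma eventually_cobounded_eval_ne_zero {p : Polynomial ℂ} (hp : p ≠ 0) :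
    ∀ᶠ z in Bornology.cobounded ℂ, p.eval₂ (RingHom.id ℂ) z ≠ 0 := by
  have hfin : {z : ℂ | p.eval₂ (RingHom.id ℂ) z = 0}.Finite := by
    simpa [Polynomial.eval₂_id, Polynomial.IsRoot] using Polynomial.finite_setOfPred_isRoot hp
  exact Bornology.isBounded_def.1 hfin.isBounded

lemma HasInvertibleValue.kronGL {l : Filter ℂ}
    (hl : ∀ r : RatFunc ℂ, ∀ᶠ z in l, r.denom.eval₂ (RingHom.id ℂ) z ≠ 0) {m n : ℕ}
    {B : GL (Fin m) (RatFunc ℂ)} {C : GL (Fin n) (RatFunc ℂ)} (hB : HasInvertibleValue l B)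
    (hC : HasInvertibleValue l C) : HasInvertibleValue l (kronGL B C) := by
  obtain ⟨B₀, hB₀⟩ := hB
  obtain ⟨C₀, hC₀⟩ := hC
  refine ⟨QDiff.kronGL B₀ C₀, fun i j => ?_⟩
  obtain ⟨⟨i, i'⟩, rfl⟩ := (pairing _ _).surjective i
  obtain ⟨⟨j, j'⟩, rfl⟩ := (pairing _ _).surjective j
  change Tendsto (fun z => (kron B.val C.val (pairing m n (i, i')) (pairing m n (j, j'))).eval _ z)
    l (𝓝 (kron B₀.val C₀.val (pairing m n (i, i')) (pairing m n (j, j'))))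
  rw [kron_apply, kron_apply]
  refine ((hB₀ i j).mul (hC₀ i' j')).congr' ?_
  filter_upwards [hl (B.val i j), hl (C.val i' j')] with z h₁ h₂
  exact (RatFunc.eval_mul _ _ h₁ h₂).symm

lemma HasInvertibleValue.const (l : Filter ℂ) {n : ℕ} (B₀ : GL (Fin n) ℂ) :
    HasInvertibleValue l (Matrix.GeneralLinearGroup.map (algebraMap ℂ (RatFunc ℂ)) B₀) :=
  ⟨B₀, fun i j => by
    refine tendsto_const_nhds.congr fun z => ?_
    change _ = RatFunc.eval _ z (algebraMap ℂ (RatFunc ℂ) (B₀.val i j))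
    rw [RatFunc.algebraMap_eq_C, RatFunc.eval_C]
    rfl⟩

lemma upGL_ratToMer_const {n : ℕ} (B₀ : GL (Fin n) ℂ) :
    upGL ratToMer (Matrix.GeneralLinearGroup.map (algebraMap ℂ (RatFunc ℂ)) B₀) = cst B₀ :=
  Units.ext (by ext i j; exact ratToMer.commutes _)

lemma gauge_kron (q : ℂˣ) {K : Type} [CommRing K] [Algebra ℂ K] (ι : K →ₐ[ℂ] MerStar) {n m : ℕ}
    {B A : GL (Fin n) (RatFunc ℂ)} {F : GL (Fin n) K} {C A' : GL (Fin m) (RatFunc ℂ)}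
    {G : GL (Fin m) K}
    (h : upGL ratToMer B = (shiftGL q (upGL ι F))⁻¹ * upGL ratToMer A * upGL ι F)
    (h' : upGL ratToMer C = (shiftGL q (upGL ι G))⁻¹ * upGL ratToMer A' * upGL ι G) :
    upGL ratToMer (kronGL B C) = (shiftGL q (upGL ι (kronGL F G)))⁻¹ *
      upGL ratToMer (kronGL A A') * upGL ι (kronGL F G) := by
  rw [upGL_kron, h, h', kronGL_mul, kronGL_mul, kronGL_inv]
  simp only [shiftGL, upGL_kron]

instance (q : ℂˣ) : (isFuchsian q).IsMonoidal where
  prop_unit := by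
    have h : ∀ l, HasInvertibleValue l (1 : GL (Fin 1) (RatFunc ℂ)) := fun l => by
      simpa using HasInvertibleValue.const l (1 : GL (Fin 1) ℂ)
    constructor
    · refine ⟨(1 : GL (Fin 1) (RatFunc ℂ)), (1 : GL (Fin 1) merZero), h _, ?_⟩
      change upGL ratToMer (1 : GL (Fin 1) (RatFunc ℂ)) =
        (shiftGL q (upGL merZero.val (1 : GL (Fin 1) merZero)))⁻¹ *
          upGL ratToMer (1 : GL (Fin 1) (RatFunc ℂ)) * upGL merZero.val (1 : GL (Fin 1) merZero)
      simp only [map_one, inv_one, mul_one]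
    · refine ⟨(1 : GL (Fin 1) (RatFunc ℂ)), (1 : GL (Fin 1) merInfty), h _, ?_⟩
      change upGL ratToMer (1 : GL (Fin 1) (RatFunc ℂ)) =
        (shiftGL q (upGL merInfty.val (1 : GL (Fin 1) merInfty)))⁻¹ *
          upGL ratToMer (1 : GL (Fin 1) (RatFunc ℂ)) * upGL merInfty.val (1 : GL (Fin 1) merInfty)
      simp only [map_one, inv_one, mul_one]
  prop_tensor := by
    rintro X Y ⟨⟨B, F, hB, hBF⟩, ⟨B', F', hB', hBF'⟩⟩ ⟨⟨C, G, hC, hCG⟩, ⟨C', G', hC', hCG'⟩⟩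
    refine ⟨⟨kronGL B C, kronGL F G, hB.kronGL (fun r => ratFunc_denom_ne_zero r 0) hC, ?_⟩,
      ⟨kronGL B' C', kronGL F' G',
        hB'.kronGL (fun r => eventually_cobounded_eval_ne_zero r.denom_ne_zero) hC', ?_⟩⟩
    · exact gauge_kron q _ hBF hCG
    · exact gauge_kron q _ hBF' hCG'

end Fuchsian

/-! ### The tensor category of connection triples -/

/-- A connection triple `(A⁽⁰⁾, M, A⁽∞⁾)`: `A⁽⁰⁾, A⁽∞⁾ ∈ GL_n(ℂ)`, `M ∈ GL_n(M(ℂ*))` and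
`(σ_q M) A⁽⁰⁾ = A⁽∞⁾ M`. -/
structure ConnTriple (q : ℂˣ) where
  dim : ℕ
  Azero : GL (Fin dim) ℂ
  M : GL (Fin dim) MerStar
  Ainfty : GL (Fin dim) ℂ
  conn : shiftGL q M * cst Azero = cst Ainfty * M

namespace ConnTriple

variable {q : ℂˣ}

/-- The morphisms from `(A⁽⁰⁾, M, A⁽∞⁾)` to `(B⁽⁰⁾, N, B⁽∞⁾)`: the pairs `(S⁽⁰⁾, S⁽∞⁾)` of a matrix
over `M(ℂ)` such that `(σ_q S⁽⁰⁾) A⁽⁰⁾ = B⁽⁰⁾ S⁽⁰⁾` and a matrix over `M(ℂ_∞)` such that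
`(σ_q S⁽∞⁾) A⁽∞⁾ = B⁽∞⁾ S⁽∞⁾`, with `S⁽∞⁾ M = N S⁽⁰⁾`. -/
noncomputable def homs (X Y : ConnTriple q) :
    Submodule ℂ (Matrix (Fin Y.dim) (Fin X.dim) merZero ×
      Matrix (Fin Y.dim) (Fin X.dim) merInfty) where
  carrier := {S |
    Intertwines q merZero.val (cst X.Azero) (cst Y.Azero) S.1 ∧
    Intertwines q merInfty.val (cst X.Ainfty) (cst Y.Ainfty) S.2 ∧
    Square merInfty.val merZero.val X.M Y.M S.2 S.1}
  add_mem' hF hG := ⟨Square.add hF.1 hG.1, Square.add hF.2.1 hG.2.1, hF.2.2.add hG.2.2⟩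
  zero_mem' := ⟨Square.zero, Square.zero, Square.zero⟩
  smul_mem' c _ hF := ⟨Square.smul c hF.1, Square.smul c hF.2.1, hF.2.2.smul c⟩

/-- The category `𝒞` of connection triples. -/
noncomputable instance : Category (ConnTriple q) where
  Hom X Y := homs X Y
  id _ := ⟨(1, 1), Square.one, Square.one, Square.one⟩
  comp f g := ⟨(g.1.1 * f.1.1, g.1.2 * f.1.2),
    Square.comp f.2.1 g.2.1, Square.comp f.2.2.1 g.2.2.1, f.2.2.2.comp g.2.2.2⟩
  id_comp f := Subtype.ext (Prod.ext (Matrix.mul_one f.1.1) (Matrix.mul_one f.1.2))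
  comp_id f := Subtype.ext (Prod.ext (Matrix.one_mul f.1.1) (Matrix.one_mul f.1.2))
  assoc f g h := Subtype.ext (Prod.ext (Matrix.mul_assoc h.1.1 g.1.1 f.1.1).symm
    (Matrix.mul_assoc h.1.2 g.1.2 f.1.2).symm)

/-- The component `S⁽⁰⁾` of a morphism. -/
def Szero {X Y : ConnTriple q} (f : X ⟶ Y) : Matrix (Fin Y.dim) (Fin X.dim) merZero := f.1.1

/-- The component `S⁽∞⁾` of a morphism. -/
def Sinfty {X Y : ConnTriple q} (f : X ⟶ Y) : Matrix (Fin Y.dim) (Fin X.dim) merInfty := f.1.2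

noncomputable instance : Preadditive (ConnTriple q) where
  homGroup X Y := inferInstanceAs (AddCommGroup (homs X Y))
  add_comp _ _ _ f f' g := Subtype.ext (Prod.ext (Matrix.mul_add g.1.1 f.1.1 f'.1.1)
    (Matrix.mul_add g.1.2 f.1.2 f'.1.2))
  comp_add _ _ _ f g g' := Subtype.ext (Prod.ext (Matrix.add_mul g.1.1 g'.1.1 f.1.1)
    (Matrix.add_mul g.1.2 g'.1.2 f.1.2))

noncomputable instance : Linear ℂ (ConnTriple q) where
  homModule X Y := inferInstanceAs (Module ℂ (homs X Y))
  smul_comp _ _ _ r f g := Subtype.ext (Prod.ext (Matrix.mul_smul g.1.1 r f.1.1)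
    (Matrix.mul_smul g.1.2 r f.1.2))
  comp_smul _ _ _ f r g := Subtype.ext (Prod.ext (Matrix.smul_mul r g.1.1 f.1.1)
    (Matrix.smul_mul r g.1.2 f.1.2))

/-- The isomorphism given by a bijection between bases that is compatible with the triples. -/
noncomputable def permIso {X Y : ConnTriple q} (e : Fin X.dim ≃ Fin Y.dim)
    (h : ((permMat _ e, permMat _ e) : _ × _) ∈ homs X Y) : X ≅ Y where
  hom := ⟨(permMat _ e, permMat _ e), h⟩
  inv := ⟨(permMat _ e.symm, permMat _ e.symm),
    Square.perm_symm h.1, Square.perm_symm h.2.1, h.2.2.perm_symm⟩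
  hom_inv_id := Subtype.ext (Prod.ext (permMat_symm_mul e) (permMat_symm_mul e))
  inv_hom_id := Subtype.ext (Prod.ext (permMat_mul_symm e) (permMat_mul_symm e))

/-- The componentwise tensor product of connection triples. -/
noncomputable def tensor (X Y : ConnTriple q) : ConnTriple q where
  dim := X.dim * Y.dim
  Azero := kronGL X.Azero Y.Azero
  M := kronGL X.M Y.M
  Ainfty := kronGL X.Ainfty Y.Ainfty
  conn := by
    rw [shiftGL, cst, cst, upGL_kron, upGL_kron, upGL_kron, ← kronGL_mul, ← kronGL_mul]
    exact congrArg₂ kronGL X.conn Y.conn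

/-- The connection triple `(1, 1, 1)`. -/
noncomputable def unit (q : ℂˣ) : ConnTriple q where
  dim := 1
  Azero := 1
  M := 1
  Ainfty := 1
  conn := by simp only [map_one]

/-- The componentwise tensor product of morphisms. -/
noncomputable def tensorHoms {X Y X' Y' : ConnTriple q} (f : homs X Y) (g : homs X' Y') :
    homs (X.tensor X') (Y.tensor Y') :=
  ⟨(kron f.1.1 g.1.1, kron f.1.2 g.1.2),
    Square.kron (upGL_kron _ _ _) (upGL_kron _ _ _) f.2.1 g.2.1,
    Square.kron (upGL_kron _ _ _) (upGL_kron _ _ _) f.2.2.1 g.2.2.1,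
    Square.kron rfl rfl f.2.2.2 g.2.2.2⟩

noncomputable instance : MonoidalCategoryStruct (ConnTriple q) where
  tensorObj X Y := X.tensor Y
  whiskerLeft X _ _ f := tensorHoms (𝟙 X : X ⟶ X) f
  whiskerRight f Y := tensorHoms f (𝟙 Y : Y ⟶ Y)
  tensorHom f g := tensorHoms f g
  tensorUnit := unit q
  associator X Y Z := permIso (X := (X.tensor Y).tensor Z) (Y := X.tensor (Y.tensor Z))
    (assocEquiv X.dim Y.dim Z.dim)
    ⟨Square.assoc (upGL_kron_left _ _ _ _) (upGL_kron_right _ _ _ _),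
      Square.assoc (upGL_kron_left _ _ _ _) (upGL_kron_right _ _ _ _),
      Square.assoc rfl rfl⟩
  leftUnitor X := permIso (X := (unit q).tensor X) (leftEquiv X.dim)
    ⟨Square.left (upGL_one_kron _ _), Square.left (upGL_one_kron _ _), Square.left rfl⟩
  rightUnitor X := permIso (X := X.tensor (unit q)) (rightEquiv X.dim)
    ⟨Square.right (upGL_kron_one _ _), Square.right (upGL_kron_one _ _), Square.right rfl⟩

noncomputable instance : MonoidalCategory (ConnTriple q) :=
  MonoidalCategory.ofTensorHom
    (id_tensorHom_id := fun X Y => Subtype.ext (Prod.ext (kron_one (K := merZero) X.dim Y.dim)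
      (kron_one (K := merInfty) X.dim Y.dim)))
    (id_tensorHom := fun _ _ _ _ => rfl)
    (tensorHom_id := fun _ _ => rfl)
    (tensorHom_comp_tensorHom := fun f₁ f₂ g₁ g₂ => Subtype.ext (Prod.ext
      (kron_mul g₁.1.1 f₁.1.1 g₂.1.1 f₂.1.1) (kron_mul g₁.1.2 f₁.1.2 g₂.1.2 f₂.1.2)))
    (associator_naturality := fun f₁ f₂ f₃ => Subtype.ext (Prod.ext
      (Sq.assoc f₁.1.1 f₂.1.1 f₃.1.1) (Sq.assoc f₁.1.2 f₂.1.2 f₃.1.2)))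
    (leftUnitor_naturality := fun f => Subtype.ext (Prod.ext (Sq.left f.1.1) (Sq.left f.1.2)))
    (rightUnitor_naturality := fun f => Subtype.ext (Prod.ext (Sq.right f.1.1) (Sq.right f.1.2)))
    (pentagon := fun W X Y Z => Subtype.ext (Prod.ext
      (pentagon_mat W.dim X.dim Y.dim Z.dim) (pentagon_mat W.dim X.dim Y.dim Z.dim)))
    (triangle := fun X Y => Subtype.ext (Prod.ext
      (triangle_mat X.dim Y.dim) (triangle_mat X.dim Y.dim)))

/-- The commutativity constraint exchanges the two factors. -/
noncomputable instance : SymmetricCategory (ConnTriple q) where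
  braiding X Y := permIso (X := X.tensor Y) (Y := Y.tensor X) (swapEquiv X.dim Y.dim)
    ⟨Square.swap (upGL_kron _ _ _) (upGL_kron _ _ _),
      Square.swap (upGL_kron _ _ _) (upGL_kron _ _ _), Square.swap rfl rfl⟩
  braiding_naturality_right _ _ _ f := Subtype.ext (Prod.ext (MatCat.swap_natural _ f.1.1)
    (MatCat.swap_natural _ f.1.2))
  braiding_naturality_left f _ := Subtype.ext (Prod.ext (MatCat.swap_natural f.1.1 _)
    (MatCat.swap_natural f.1.2 _))
  hexagon_forward X Y Z := Subtype.ext (Prod.ext (hexagon_mat X.dim Y.dim Z.dim)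
    (hexagon_mat X.dim Y.dim Z.dim))
  hexagon_reverse X Y Z := Subtype.ext (Prod.ext (hexagon_mat' X.dim Y.dim Z.dim)
    (hexagon_mat' X.dim Y.dim Z.dim))
  symmetry X Y := Subtype.ext (Prod.ext (swap_mat X.dim Y.dim) (swap_mat X.dim Y.dim))

end ConnTriple

/-! ### The tensor category of solutions -/

/-- A quadruple `(A⁽⁰⁾, M⁽⁰⁾, A⁽∞⁾, M⁽∞⁾)` in
`GL_n(ℂ) × GL_n(M(ℂ)) × GL_n(ℂ) × GL_n(M(ℂ_∞))` such that the pairs `(A⁽⁰⁾, M⁽⁰⁾)` and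
`(A⁽∞⁾, M⁽∞⁾)` are connected: `(σ_q M⁽∞⁾) A⁽∞⁾ (M⁽∞⁾)⁻¹ = (σ_q M⁽⁰⁾) A⁽⁰⁾ (M⁽⁰⁾)⁻¹`. -/
structure SolQuad (q : ℂˣ) where
  dim : ℕ
  Azero : GL (Fin dim) ℂ
  Mzero : GL (Fin dim) merZero
  Ainfty : GL (Fin dim) ℂ
  Minfty : GL (Fin dim) merInfty
  connected :
    shiftGL q (upGL merInfty.val Minfty) * cst Ainfty * (upGL merInfty.val Minfty)⁻¹ =
      shiftGL q (upGL merZero.val Mzero) * cst Azero * (upGL merZero.val Mzero)⁻¹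

namespace SolQuad

variable {q : ℂˣ}

/-- The matrix `M⁽⁰⁾`, over `M(ℂ*)`. -/
noncomputable abbrev M₀ (X : SolQuad q) : GL (Fin X.dim) MerStar := upGL merZero.val X.Mzero

/-- The matrix `M⁽∞⁾`, over `M(ℂ*)`. -/
noncomputable abbrev M₁ (X : SolQuad q) : GL (Fin X.dim) MerStar := upGL merInfty.val X.Minfty

/-- The morphisms from `(A⁽⁰⁾, M⁽⁰⁾, A⁽∞⁾, M⁽∞⁾)` to `(B⁽⁰⁾, N⁽⁰⁾, B⁽∞⁾, N⁽∞⁾)`: the triples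
`(F, S⁽⁰⁾, S⁽∞⁾)` of matrices over `ℂ(z)`, `M(ℂ)`, `M(ℂ_∞)` such that
`(σ_q S⁽⁰⁾) A⁽⁰⁾ = B⁽⁰⁾ S⁽⁰⁾`, `(σ_q S⁽∞⁾) A⁽∞⁾ = B⁽∞⁾ S⁽∞⁾`, `F M⁽⁰⁾ = N⁽⁰⁾ S⁽⁰⁾` and
`F M⁽∞⁾ = N⁽∞⁾ S⁽∞⁾`. -/
noncomputable def homs (X Y : SolQuad q) :
    Submodule ℂ (Matrix (Fin Y.dim) (Fin X.dim) (RatFunc ℂ) ×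
      Matrix (Fin Y.dim) (Fin X.dim) merZero × Matrix (Fin Y.dim) (Fin X.dim) merInfty) where
  carrier := {S |
    Intertwines q merZero.val (cst X.Azero) (cst Y.Azero) S.2.1 ∧
    Intertwines q merInfty.val (cst X.Ainfty) (cst Y.Ainfty) S.2.2 ∧
    Square ratToMer merZero.val X.M₀ Y.M₀ S.1 S.2.1 ∧
    Square ratToMer merInfty.val X.M₁ Y.M₁ S.1 S.2.2}
  add_mem' hF hG := ⟨Square.add hF.1 hG.1, Square.add hF.2.1 hG.2.1, hF.2.2.1.add hG.2.2.1,
    hF.2.2.2.add hG.2.2.2⟩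
  zero_mem' := ⟨Square.zero, Square.zero, Square.zero, Square.zero⟩
  smul_mem' c _ hF := ⟨Square.smul c hF.1, Square.smul c hF.2.1, hF.2.2.1.smul c, hF.2.2.2.smul c⟩

/-- The category `𝒮` of solutions. -/
noncomputable instance : Category (SolQuad q) where
  Hom X Y := homs X Y
  id _ := ⟨(1, 1, 1), Square.one, Square.one, Square.one, Square.one⟩
  comp f g := ⟨(g.1.1 * f.1.1, g.1.2.1 * f.1.2.1, g.1.2.2 * f.1.2.2),
    Square.comp f.2.1 g.2.1, Square.comp f.2.2.1 g.2.2.1, f.2.2.2.1.comp g.2.2.2.1,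
    f.2.2.2.2.comp g.2.2.2.2⟩
  id_comp f := Subtype.ext (Prod.ext (Matrix.mul_one f.1.1)
    (Prod.ext (Matrix.mul_one f.1.2.1) (Matrix.mul_one f.1.2.2)))
  comp_id f := Subtype.ext (Prod.ext (Matrix.one_mul f.1.1)
    (Prod.ext (Matrix.one_mul f.1.2.1) (Matrix.one_mul f.1.2.2)))
  assoc f g h := Subtype.ext (Prod.ext (Matrix.mul_assoc h.1.1 g.1.1 f.1.1).symm
    (Prod.ext (Matrix.mul_assoc h.1.2.1 g.1.2.1 f.1.2.1).symm
      (Matrix.mul_assoc h.1.2.2 g.1.2.2 f.1.2.2).symm))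

/-- The component `F` of a morphism. -/
def F {X Y : SolQuad q} (f : X ⟶ Y) : Matrix (Fin Y.dim) (Fin X.dim) (RatFunc ℂ) := f.1.1

/-- The component `S⁽⁰⁾` of a morphism. -/
def Szero {X Y : SolQuad q} (f : X ⟶ Y) : Matrix (Fin Y.dim) (Fin X.dim) merZero := f.1.2.1

/-- The component `S⁽∞⁾` of a morphism. -/
def Sinfty {X Y : SolQuad q} (f : X ⟶ Y) : Matrix (Fin Y.dim) (Fin X.dim) merInfty := f.1.2.2

noncomputable instance : Preadditive (SolQuad q) where
  homGroup X Y := inferInstanceAs (AddCommGroup (homs X Y))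
  add_comp _ _ _ f f' g := Subtype.ext (Prod.ext (Matrix.mul_add g.1.1 f.1.1 f'.1.1)
    (Prod.ext (Matrix.mul_add g.1.2.1 f.1.2.1 f'.1.2.1)
      (Matrix.mul_add g.1.2.2 f.1.2.2 f'.1.2.2)))
  comp_add _ _ _ f g g' := Subtype.ext (Prod.ext (Matrix.add_mul g.1.1 g'.1.1 f.1.1)
    (Prod.ext (Matrix.add_mul g.1.2.1 g'.1.2.1 f.1.2.1)
      (Matrix.add_mul g.1.2.2 g'.1.2.2 f.1.2.2)))

noncomputable instance : Linear ℂ (SolQuad q) where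
  homModule X Y := inferInstanceAs (Module ℂ (homs X Y))
  smul_comp _ _ _ r f g := Subtype.ext (Prod.ext (Matrix.mul_smul g.1.1 r f.1.1)
    (Prod.ext (Matrix.mul_smul g.1.2.1 r f.1.2.1) (Matrix.mul_smul g.1.2.2 r f.1.2.2)))
  comp_smul _ _ _ f r g := Subtype.ext (Prod.ext (Matrix.smul_mul r g.1.1 f.1.1)
    (Prod.ext (Matrix.smul_mul r g.1.2.1 f.1.2.1) (Matrix.smul_mul r g.1.2.2 f.1.2.2)))

/-- The isomorphism given by a bijection between bases that is compatible with the quadruples. -/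
noncomputable def permIso {X Y : SolQuad q} (e : Fin X.dim ≃ Fin Y.dim)
    (h : ((permMat _ e, permMat _ e, permMat _ e) : _ × _ × _) ∈ homs X Y) : X ≅ Y where
  hom := ⟨(permMat _ e, permMat _ e, permMat _ e), h⟩
  inv := ⟨(permMat _ e.symm, permMat _ e.symm, permMat _ e.symm),
    Square.perm_symm h.1, Square.perm_symm h.2.1, h.2.2.1.perm_symm, h.2.2.2.perm_symm⟩
  hom_inv_id := Subtype.ext (Prod.ext (permMat_symm_mul e)
    (Prod.ext (permMat_symm_mul e) (permMat_symm_mul e)))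
  inv_hom_id := Subtype.ext (Prod.ext (permMat_mul_symm e)
    (Prod.ext (permMat_mul_symm e) (permMat_mul_symm e)))

/-- The componentwise tensor product of quadruples. -/
noncomputable def tensor (X Y : SolQuad q) : SolQuad q where
  dim := X.dim * Y.dim
  Azero := kronGL X.Azero Y.Azero
  Mzero := kronGL X.Mzero Y.Mzero
  Ainfty := kronGL X.Ainfty Y.Ainfty
  Minfty := kronGL X.Minfty Y.Minfty
  connected := by
    simp only [shiftGL, cst, upGL_kron, ← kronGL_inv, ← kronGL_mul]
    exact congrArg₂ kronGL X.connected Y.connected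

/-- The quadruple `(1, 1, 1, 1)`. -/
noncomputable def unit (q : ℂˣ) : SolQuad q where
  dim := 1
  Azero := 1
  Mzero := 1
  Ainfty := 1
  Minfty := 1
  connected := by simp only [map_one]

/-- The componentwise tensor product of morphisms. -/
noncomputable def tensorHoms {X Y X' Y' : SolQuad q} (f : homs X Y) (g : homs X' Y') :
    homs (X.tensor X') (Y.tensor Y') :=
  ⟨(kron f.1.1 g.1.1, kron f.1.2.1 g.1.2.1, kron f.1.2.2 g.1.2.2),
    Square.kron (upGL_kron _ _ _) (upGL_kron _ _ _) f.2.1 g.2.1,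
    Square.kron (upGL_kron _ _ _) (upGL_kron _ _ _) f.2.2.1 g.2.2.1,
    Square.kron (upGL_kron _ _ _) (upGL_kron _ _ _) f.2.2.2.1 g.2.2.2.1,
    Square.kron (upGL_kron _ _ _) (upGL_kron _ _ _) f.2.2.2.2 g.2.2.2.2⟩

noncomputable instance : MonoidalCategoryStruct (SolQuad q) where
  tensorObj X Y := X.tensor Y
  whiskerLeft X _ _ f := tensorHoms (𝟙 X : X ⟶ X) f
  whiskerRight f Y := tensorHoms f (𝟙 Y : Y ⟶ Y)
  tensorHom f g := tensorHoms f g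
  tensorUnit := unit q
  associator X Y Z := permIso (X := (X.tensor Y).tensor Z) (Y := X.tensor (Y.tensor Z))
    (assocEquiv X.dim Y.dim Z.dim)
    ⟨Square.assoc (upGL_kron_left _ _ _ _) (upGL_kron_right _ _ _ _),
      Square.assoc (upGL_kron_left _ _ _ _) (upGL_kron_right _ _ _ _),
      Square.assoc (upGL_kron_left _ _ _ _) (upGL_kron_right _ _ _ _),
      Square.assoc (upGL_kron_left _ _ _ _) (upGL_kron_right _ _ _ _)⟩
  leftUnitor X := permIso (X := (unit q).tensor X) (leftEquiv X.dim)
    ⟨Square.left (upGL_one_kron _ _), Square.left (upGL_one_kron _ _),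
      Square.left (upGL_one_kron _ _), Square.left (upGL_one_kron _ _)⟩
  rightUnitor X := permIso (X := X.tensor (unit q)) (rightEquiv X.dim)
    ⟨Square.right (upGL_kron_one _ _), Square.right (upGL_kron_one _ _),
      Square.right (upGL_kron_one _ _), Square.right (upGL_kron_one _ _)⟩

noncomputable instance : MonoidalCategory (SolQuad q) :=
  MonoidalCategory.ofTensorHom
    (id_tensorHom_id := fun X Y => Subtype.ext (Prod.ext (kron_one (K := RatFunc ℂ) X.dim Y.dim)
      (Prod.ext (kron_one (K := merZero) X.dim Y.dim) (kron_one (K := merInfty) X.dim Y.dim))))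
    (id_tensorHom := fun _ _ _ _ => rfl)
    (tensorHom_id := fun _ _ => rfl)
    (tensorHom_comp_tensorHom := fun f₁ f₂ g₁ g₂ => Subtype.ext (Prod.ext
      (kron_mul g₁.1.1 f₁.1.1 g₂.1.1 f₂.1.1)
      (Prod.ext (kron_mul g₁.1.2.1 f₁.1.2.1 g₂.1.2.1 f₂.1.2.1)
        (kron_mul g₁.1.2.2 f₁.1.2.2 g₂.1.2.2 f₂.1.2.2))))
    (associator_naturality := fun f₁ f₂ f₃ => Subtype.ext (Prod.ext
      (Sq.assoc f₁.1.1 f₂.1.1 f₃.1.1) (Prod.ext (Sq.assoc f₁.1.2.1 f₂.1.2.1 f₃.1.2.1)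
        (Sq.assoc f₁.1.2.2 f₂.1.2.2 f₃.1.2.2))))
    (leftUnitor_naturality := fun f => Subtype.ext (Prod.ext (Sq.left f.1.1)
      (Prod.ext (Sq.left f.1.2.1) (Sq.left f.1.2.2))))
    (rightUnitor_naturality := fun f => Subtype.ext (Prod.ext (Sq.right f.1.1)
      (Prod.ext (Sq.right f.1.2.1) (Sq.right f.1.2.2))))
    (pentagon := fun W X Y Z => Subtype.ext (Prod.ext (pentagon_mat W.dim X.dim Y.dim Z.dim)
      (Prod.ext (pentagon_mat W.dim X.dim Y.dim Z.dim) (pentagon_mat W.dim X.dim Y.dim Z.dim))))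
    (triangle := fun X Y => Subtype.ext (Prod.ext (triangle_mat X.dim Y.dim)
      (Prod.ext (triangle_mat X.dim Y.dim) (triangle_mat X.dim Y.dim))))

/-- The commutativity constraint exchanges the two factors. -/
noncomputable instance : SymmetricCategory (SolQuad q) where
  braiding X Y := permIso (X := X.tensor Y) (Y := Y.tensor X) (swapEquiv X.dim Y.dim)
    ⟨Square.swap (upGL_kron _ _ _) (upGL_kron _ _ _),
      Square.swap (upGL_kron _ _ _) (upGL_kron _ _ _),
      Square.swap (upGL_kron _ _ _) (upGL_kron _ _ _),
      Square.swap (upGL_kron _ _ _) (upGL_kron _ _ _)⟩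
  braiding_naturality_right _ _ _ f := Subtype.ext (Prod.ext (MatCat.swap_natural _ f.1.1)
    (Prod.ext (MatCat.swap_natural _ f.1.2.1) (MatCat.swap_natural _ f.1.2.2)))
  braiding_naturality_left f _ := Subtype.ext (Prod.ext (MatCat.swap_natural f.1.1 _)
    (Prod.ext (MatCat.swap_natural f.1.2.1 _) (MatCat.swap_natural f.1.2.2 _)))
  hexagon_forward X Y Z := Subtype.ext (Prod.ext (hexagon_mat X.dim Y.dim Z.dim)
    (Prod.ext (hexagon_mat X.dim Y.dim Z.dim) (hexagon_mat X.dim Y.dim Z.dim)))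
  hexagon_reverse X Y Z := Subtype.ext (Prod.ext (hexagon_mat' X.dim Y.dim Z.dim)
    (Prod.ext (hexagon_mat' X.dim Y.dim Z.dim) (hexagon_mat' X.dim Y.dim Z.dim)))
  symmetry X Y := Subtype.ext (Prod.ext (swap_mat X.dim Y.dim)
    (Prod.ext (swap_mat X.dim Y.dim) (swap_mat X.dim Y.dim)))

/-! ### The two functors -/

/-- The operator `σ_q` on `M(ℂ)`. -/
noncomputable def sigmaZero (q : ℂˣ) : merZero →ₐ[ℂ] merZero :=
  ((sigma q).comp merZero.val).codRestrict merZero fun φ => sigma_mem_merZero q φ.2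

/-- The operator `σ_q` on `M(ℂ_∞)`. -/
noncomputable def sigmaInfty (q : ℂˣ) : merInfty →ₐ[ℂ] merInfty :=
  ((sigma q).comp merInfty.val).codRestrict merInfty fun φ => sigma_mem_merInfty q φ.2

lemma exists_mat (X : SolQuad q) : ∃ A : GL (Fin X.dim) (RatFunc ℂ),
    upGL ratToMer A = shiftGL q X.M₀ * cst X.Azero * X.M₀⁻¹ := by
  refine exists_ratFunc_gl _
    ⟨Matrix.GeneralLinearGroup.map (sigmaZero q).toRingHom X.Mzero *
      Matrix.GeneralLinearGroup.map (algebraMap ℂ merZero) X.Azero * X.Mzero⁻¹, ?_⟩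
    ⟨Matrix.GeneralLinearGroup.map (sigmaInfty q).toRingHom X.Minfty *
      Matrix.GeneralLinearGroup.map (algebraMap ℂ merInfty) X.Ainfty * X.Minfty⁻¹, ?_⟩
  · rw [map_mul, map_mul, map_inv]
    rfl
  · rw [← X.connected, map_mul, map_mul, map_inv]
    rfl

/-- The matrix `A ∈ GL_n(ℂ(z))` equal to `(σ_q M⁽⁰⁾) A⁽⁰⁾ (M⁽⁰⁾)⁻¹` and to
`(σ_q M⁽∞⁾) A⁽∞⁾ (M⁽∞⁾)⁻¹`; it is unique because `ℂ(z)` embeds in `M(ℂ*)`. -/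
noncomputable def mat (X : SolQuad q) : GL (Fin X.dim) (RatFunc ℂ) := X.exists_mat.choose

lemma mat_eq_zero (X : SolQuad q) :
    upGL ratToMer X.mat = shiftGL q X.M₀ * cst X.Azero * X.M₀⁻¹ := X.exists_mat.choose_spec

lemma mat_eq_infty (X : SolQuad q) :
    upGL ratToMer X.mat = shiftGL q X.M₁ * cst X.Ainfty * X.M₁⁻¹ :=
  X.mat_eq_zero.trans X.connected.symm

/-- The equation `σ_q X = A X` attached to a quadruple. -/
noncomputable def eqn (X : SolQuad q) : Eqn q := ⟨X.dim, X.mat⟩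

lemma isFuchsian_eqn (X : SolQuad q) : isFuchsian q X.eqn := by
  refine ⟨⟨_, X.Mzero, HasInvertibleValue.const _ X.Azero, ?_⟩,
    ⟨_, X.Minfty, HasInvertibleValue.const _ X.Ainfty, ?_⟩⟩
  · refine (upGL_ratToMer_const X.Azero).trans ?_
    change _ = (shiftGL q X.M₀)⁻¹ * upGL ratToMer X.mat * X.M₀
    rw [mat_eq_zero]
    group
  · refine (upGL_ratToMer_const X.Ainfty).trans ?_
    change _ = (shiftGL q X.M₁)⁻¹ * upGL ratToMer X.mat * X.M₁
    rw [mat_eq_infty]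
    group

lemma F_mem_homs {X Y : SolQuad q} (f : X ⟶ Y) : F f ∈ Eqn.homs X.eqn Y.eqn := by
  change shift q (up ratToMer f.1.1) * (upGL ratToMer X.mat).val =
    (upGL ratToMer Y.mat).val * up ratToMer f.1.1
  have h₁ : up ratToMer f.1.1 * X.M₀.val = Y.M₀.val * up merZero.val f.1.2.1 := f.2.2.2.1
  have h₂ : shift q (up merZero.val f.1.2.1) * (cst X.Azero).val =
    (cst Y.Azero).val * up merZero.val f.1.2.1 := f.2.1
  have h₃ : shift q (up ratToMer f.1.1) * (shiftGL q X.M₀).val =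
      (shiftGL q Y.M₀).val * shift q (up merZero.val f.1.2.1) := by
    have := congrArg (shift q) h₁
    rw [shift, up_mul, shift, up_mul] at this
    exact this
  have h₄ : up ratToMer f.1.1 = Y.M₀.val * up merZero.val f.1.2.1 * (X.M₀⁻¹).val := by
    rw [← h₁, Matrix.mul_assoc, ← Units.val_mul, mul_inv_cancel, Units.val_one, Matrix.mul_one]
  have h₅ : (Y.M₀⁻¹).val * up ratToMer f.1.1 = up merZero.val f.1.2.1 * (X.M₀⁻¹).val := by
    rw [h₄, ← Matrix.mul_assoc, ← Matrix.mul_assoc, ← Units.val_mul, inv_mul_cancel,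
      Units.val_one, Matrix.one_mul]
  rw [mat_eq_zero, mat_eq_zero, Units.val_mul, Units.val_mul, Units.val_mul, Units.val_mul,
    Matrix.mul_assoc _ (Y.M₀⁻¹).val, h₅, ← Matrix.mul_assoc, ← Matrix.mul_assoc, h₃,
    Matrix.mul_assoc _ _ (cst X.Azero).val, h₂]
  simp only [Matrix.mul_assoc]

/-- The functor `(A⁽⁰⁾, M⁽⁰⁾, A⁽∞⁾, M⁽∞⁾) ↦ A`, `(F, S⁽⁰⁾, S⁽∞⁾) ↦ F`. -/
noncomputable def toFuchsEqn (q : ℂˣ) : SolQuad q ⥤ FuchsEqn q where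
  obj X := ⟨X.eqn, X.isFuchsian_eqn⟩
  map f := ObjectProperty.homMk ⟨F f, F_mem_homs f⟩
  map_id _ := rfl
  map_comp _ _ := rfl

lemma triple_conn (X : SolQuad q) :
    shiftGL q (X.M₁⁻¹ * X.M₀) * cst X.Azero = cst X.Ainfty * (X.M₁⁻¹ * X.M₀) := by
  have h : shiftGL q X.M₁ * cst X.Ainfty * X.M₁⁻¹ = shiftGL q X.M₀ * cst X.Azero * X.M₀⁻¹ :=
    X.connected
  rw [shiftGL, map_mul, map_inv]
  calc (shiftGL q X.M₁)⁻¹ * shiftGL q X.M₀ * cst X.Azero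
      = (shiftGL q X.M₁)⁻¹ * (shiftGL q X.M₀ * cst X.Azero * X.M₀⁻¹) * X.M₀ := by group
    _ = cst X.Ainfty * (X.M₁⁻¹ * X.M₀) := by rw [← h]; group

/-- The connection triple `(A⁽⁰⁾, (M⁽∞⁾)⁻¹ M⁽⁰⁾, A⁽∞⁾)` attached to a quadruple. -/
noncomputable def triple (X : SolQuad q) : ConnTriple q where
  dim := X.dim
  Azero := X.Azero
  M := X.M₁⁻¹ * X.M₀
  Ainfty := X.Ainfty
  conn := X.triple_conn

lemma S_mem_homs {X Y : SolQuad q} (f : X ⟶ Y) :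
    (Szero f, Sinfty f) ∈ ConnTriple.homs X.triple Y.triple := by
  refine ⟨f.2.1, f.2.2.1, ?_⟩
  change up merInfty.val f.1.2.2 * (X.M₁⁻¹ * X.M₀).val =
    (Y.M₁⁻¹ * Y.M₀).val * up merZero.val f.1.2.1
  have h₀ : up ratToMer f.1.1 * X.M₀.val = Y.M₀.val * up merZero.val f.1.2.1 := f.2.2.2.1
  have h₁ : up ratToMer f.1.1 * X.M₁.val = Y.M₁.val * up merInfty.val f.1.2.2 := f.2.2.2.2
  have h₂ : up merInfty.val f.1.2.2 = (Y.M₁⁻¹).val * (up ratToMer f.1.1 * X.M₁.val) := by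
    rw [h₁, ← Matrix.mul_assoc, ← Units.val_mul, inv_mul_cancel, Units.val_one, Matrix.one_mul]
  rw [Units.val_mul, Units.val_mul, Matrix.mul_assoc (Y.M₁⁻¹).val, ← h₀, h₂]
  simp only [Matrix.mul_assoc]
  rw [← Matrix.mul_assoc X.M₁.val, ← Units.val_mul, mul_inv_cancel, Units.val_one, Matrix.one_mul]

/-- The functor `(A⁽⁰⁾, M⁽⁰⁾, A⁽∞⁾, M⁽∞⁾) ↦ (A⁽⁰⁾, M, A⁽∞⁾)`, `M = (M⁽∞⁾)⁻¹ M⁽⁰⁾`,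
`(F, S⁽⁰⁾, S⁽∞⁾) ↦ (S⁽⁰⁾, S⁽∞⁾)`. -/
noncomputable def toConnTriple (q : ℂˣ) : SolQuad q ⥤ ConnTriple q where
  obj X := X.triple
  map f := ⟨(Szero f, Sinfty f), S_mem_homs f⟩
  map_id _ := rfl
  map_comp _ _ := rfl

end SolQuad

end QDiff

namespace QDiff

/-! ### Power series with coefficients in a Banach space -/

section PowerSeries

/-! Full faithfulness is linear algebra apart from one analytic fact. A morphism of quadruples
satisfies `F M = N S` at `0` and at `∞`, so `F` determines `S⁽⁰⁾` and `S⁽∞⁾`, and either of these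
determines `F`. Given a rational `F`, the matrices `S = N⁻¹ F M` intertwine the constant matrices
(`shift_conj_intertwines`). Given a pair `(S⁽⁰⁾, S⁽∞⁾)`, the relation `S⁽∞⁾ M = N S⁽⁰⁾` says that
`N⁽⁰⁾ S⁽⁰⁾ (M⁽⁰⁾)⁻¹ = N⁽∞⁾ S⁽∞⁾ (M⁽∞⁾)⁻¹`; this common value is meromorphic on the whole sphere,
hence rational (`exists_ratToMer_eq`). The substance lies in essential surjectivity.

For fuchsian equations, a meromorphic gauge transformation to a constant matrix is needed at `0` and
at `∞`. After the given gauge, the matrix `B` has an invertible value at `0`. Shearing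
transformations divide eigenvalues of `B(0)` by `q` until all of them lie in an annulus `r ≤ |μ| < r
|q|` (`exists_shear`, `exists_local_solution_of_spectrum`). No quotient of two eigenvalues is then a
positive power of `q`, so `G(qz) B(0) = B(z) G(z)` determines the power series of `G` recursively
through invertible Sylvester operators, and a majorant gives convergence
(`exists_local_solution_of_nonresonant`). As `|q| > 1`, the functional equation spreads the germ
over `ℂ` as a meromorphic matrix (`exists_extension`). The point `∞` reduces to `0` by `w = 1/z` and
inversion of the system (`exists_solution_infty`).

For connection triples, every `M ∈ GL_n(M(ℂ*))` must be a product `(M⁽∞⁾)⁻¹ M⁽⁰⁾`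
(`exists_birkhoff_factorization`); the functional equation of `M` then becomes connectedness of the
quadruple. On an annulus free of singularities, `M` and `M⁻¹` have Laurent series. Truncating that
of `M⁻¹` to a Laurent polynomial `P` makes `P M = 1 + x` with `x` small in the Wiener algebra
`ℓ¹(ℤ)`. A contraction yields `u`, supported on negative indices, such that `(1 + u)(1 + x)` has no
negative indices (`exists_neg_factor`). Hence `V(1/z) P(z) M(z) = U(z)` with `U` and `V` holomorphic
near `0`. The matrix `V(1/z) P(z)` near `∞`, continued inwards by `U M⁻¹`, is `M⁽∞⁾`; the matrix `U`
near `0`, continued outwards by `V(1/z) P(z) M(z)`, is `M⁽⁰⁾`. As poles are allowed, no partial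
indices appear.

The tensor structures are compatible because Kronecker products commute with products, inverses and
`σ_q`; the structure maps are identity matrices. -/

lemma summable_of_le_pow {E : Type*} [NormedAddCommGroup E] {c : ℕ → E} {R s : ℝ} (hR : 0 ≤ R) (hs : 0 ≤ s) (h : R * s < 1)
    {D : ℝ} (hc : ∀ k, ‖c k‖ ≤ D * R ^ k) : Summable fun k => ‖c k‖ * s ^ k := by
  refine Summable.of_nonneg_of_le (fun k => by positivity) (fun k => ?_)
    ((summable_geometric_of_lt_one (mul_nonneg hR hs) h).mul_left D)
  rw [mul_pow, ← mul_assoc]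
  exact mul_le_mul_of_nonneg_right (hc k) (by positivity)

variable {E : Type*} [NormedAddCommGroup E] [NormedSpace ℂ E]

lemma analyticAt_tsum_pow_smul [CompleteSpace E] {c : ℕ → E} {s : ℝ} (hs : Summable fun k => ‖c k‖ * s ^ k) {z : ℂ}
    (hz : ‖z‖ < s) : AnalyticAt ℂ (fun z : ℂ => ∑' k, z ^ k • c k) z := by
  have hd : DifferentiableOn ℂ (fun z : ℂ => ∑' k, z ^ k • c k) (Metric.ball 0 s) := by
    refine Complex.differentiableOn_tsum_of_summable_norm hs (fun k => by fun_prop)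
      Metric.isOpen_ball fun k w hw => ?_
    rw [norm_smul, norm_pow, mul_comm]
    have hw' : ‖w‖ ≤ s := (mem_ball_zero_iff.1 hw).le
    gcongr
  exact hd.analyticAt (Metric.isOpen_ball.mem_nhds (mem_ball_zero_iff.2 hz))

/-- The power series expansion of an analytic function, with a geometric bound. -/
lemma exists_coeff_of_analyticAt {f : ℂ → E} (hf : AnalyticAt ℂ f 0) :
    ∃ (c : ℕ → E) (D R : ℝ), 0 < D ∧ 0 < R ∧ (∀ k, ‖c k‖ ≤ D * R ^ k) ∧
      ∀ᶠ z in 𝓝 (0 : ℂ), HasSum (fun k => z ^ k • c k) (f z) := by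
  obtain ⟨p, hp⟩ := hf
  obtain ⟨r, hr0, hr⟩ := ENNReal.lt_iff_exists_nnreal_btwn.1 hp.radius_pos
  obtain ⟨D, hD, hD'⟩ := p.norm_mul_pow_le_of_lt_radius hr
  have hr0' : (0 : ℝ) < r := by exact_mod_cast hr0
  refine ⟨p.coeff, D, (r : ℝ)⁻¹, hD, inv_pos.2 hr0', fun k => ?_, ?_⟩
  · rw [inv_pow, ← div_eq_mul_inv, le_div_iff₀ (by positivity)]
    refine le_trans ?_ (hD' k)
    rw [FormalMultilinearSeries.norm_apply_eq_norm_coef]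
  · simpa using hasFPowerSeriesAt_iff.1 hp

end PowerSeries

/-! ### Non-resonant systems -/

section NonResonant

variable {A : Type*} [NormedRing A] [NormedAlgebra ℂ A]

/-- The operator `X ↦ q^k X C - C X`. -/
noncomputable def sylvester (q : ℂ) (C : A) (k : ℕ) : A →ₗ[ℂ] A :=
  q ^ k • LinearMap.mulRight ℂ C - LinearMap.mulLeft ℂ C

lemma sylvester_apply (q : ℂ) (C : A) (k : ℕ) (X : A) :
    sylvester q C k X = q ^ k • (X * C) - C * X := rfl

/-- Right multiplication by `C` is bounded below by `1/‖C⁻¹‖`, so the term `q^k X C` outweighs `C X`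
once `|q|^k ≥ ‖C⁻¹‖ (1 + ‖C‖)`. -/
lemma norm_le_norm_sylvester_of_large {q : ℂ} (hq : 1 < ‖q‖) (C : Aˣ) :
    ∀ᶠ k in atTop, ∀ X : A, ‖X‖ ≤ ‖sylvester q C.val k X‖ := by
  have h := (tendsto_pow_atTop_atTop_of_one_lt hq).eventually_ge_atTop
    (‖(C⁻¹).val‖ * (1 + ‖C.val‖))
  filter_upwards [h] with k hk X
  have h₁ : ‖X‖ ≤ ‖X * C.val‖ * ‖(C⁻¹).val‖ := by
    conv_lhs => rw [← Units.mul_inv_cancel_right X C]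
    exact norm_mul_le _ _
  have h₂ : ‖q‖ ^ k * ‖X * C.val‖ ≤ ‖sylvester q C.val k X‖ + ‖C.val‖ * ‖X‖ := by
    rw [sylvester_apply, ← norm_pow, ← norm_smul]
    calc _ = ‖(q ^ k • (X * C.val) - C.val * X) + C.val * X‖ := by rw [sub_add_cancel]
      _ ≤ _ := (norm_add_le _ _).trans (by gcongr; exact norm_mul_le _ _)
  have h₃ : ‖(C⁻¹).val‖ * (1 + ‖C.val‖) * ‖X * C.val‖ ≤ ‖q‖ ^ k * ‖X * C.val‖ := by gcongr
  nlinarith [norm_nonneg C.val, norm_nonneg X, norm_nonneg (X * C.val)]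

/-- The formal solution of a non-resonant system converges. -/
lemma exists_bound_formal_solution {q : ℂ} {b m : ℕ → A} {D R K : ℝ} (hD : 0 < D) (hR : 0 < R)
    (hb : ∀ k, ‖b k‖ ≤ D * R ^ k) (hK : 0 < K)
    (hK' : ∀ k, 0 < k → ∀ X : A, ‖X‖ ≤ K * ‖sylvester q (b 0) k X‖)
    (hm : ∀ k, 0 < k →
      sylvester q (b 0) k (m k) = ∑ i ∈ Finset.range k, b (k - i) * m i) :
    ∀ k, ‖m k‖ ≤ ‖m 0‖ * (R * (1 + K * D)) ^ k := by
  -- With `t - 1 = K D`, the recursive bound is a geometric sum that telescopes to `t^k - 1`, so the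
  -- induction closes with the same constant.
  set t := 1 + K * D with ht
  have hKD : 0 < K * D := mul_pos hK hD
  intro k
  induction k using Nat.strong_induction_on with
  | _ k ih =>
    rcases Nat.eq_zero_or_pos k with rfl | hk
    · simp
    have h₁ : ‖sylvester q (b 0) k (m k)‖ ≤
        ∑ i ∈ Finset.range k, D * R ^ (k - i) * (‖m 0‖ * (R * t) ^ i) := by
      rw [hm k hk]
      refine (norm_sum_le _ _).trans (Finset.sum_le_sum fun i hi => (norm_mul_le _ _).trans ?_)
      exact mul_le_mul (hb _) (ih i (Finset.mem_range.1 hi)) (norm_nonneg _) (by positivity)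
    have h₂ : ∑ i ∈ Finset.range k, D * R ^ (k - i) * (‖m 0‖ * (R * t) ^ i) =
        D * ‖m 0‖ * R ^ k * ∑ i ∈ Finset.range k, t ^ i := by
      rw [Finset.mul_sum]
      refine Finset.sum_congr rfl fun i hi => ?_
      rw [← Nat.sub_add_cancel (Finset.mem_range.1 hi).le, pow_add, Nat.add_sub_cancel, mul_pow]
      ring
    have h₃ : (K * D) * ∑ i ∈ Finset.range k, t ^ i = t ^ k - 1 := by
      rw [← geom_sum_mul, ht]
      ring
    calc ‖m k‖ ≤ K * (D * ‖m 0‖ * R ^ k * ∑ i ∈ Finset.range k, t ^ i) :=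
          (hK' k hk _).trans (mul_le_mul_of_nonneg_left (h₁.trans_eq h₂) hK.le)
      _ = ‖m 0‖ * R ^ k * ((K * D) * ∑ i ∈ Finset.range k, t ^ i) := by ring
      _ = ‖m 0‖ * R ^ k * (t ^ k - 1) := by rw [h₃]
      _ ≤ ‖m 0‖ * R ^ k * t ^ k := by gcongr; linarith
      _ = ‖m 0‖ * (R * t) ^ k := by rw [mul_pow]; ring

variable [FiniteDimensional ℂ A]

/-- Uniformity in `k`: all large `k` share the constant `1`, and each of the remaining finitely many
`k` has its own constant, by injectivity in finite dimension. -/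
lemma exists_norm_le_sylvester {q : ℂ} (hq : 1 < ‖q‖) (C : Aˣ)
    (hC : ∀ k, 0 < k → Function.Injective (sylvester q C.val k)) :
    ∃ K : ℝ, 0 < K ∧ ∀ k, 0 < k → ∀ X : A, ‖X‖ ≤ K * ‖sylvester q C.val k X‖ := by
  obtain ⟨N, hN⟩ := eventually_atTop.1 (norm_le_norm_sylvester_of_large hq C)
  have h : ∀ k, 0 < k → ∃ K : ℝ, 0 < K ∧ ∀ X : A, ‖X‖ ≤ K * ‖sylvester q C.val k X‖ := by
    intro k hk
    obtain ⟨K, hK, hK'⟩ := (sylvester q C.val k).exists_antilipschitzWith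
      (LinearMap.ker_eq_bot.2 (hC k hk))
    exact ⟨K, hK, fun X => by simpa using hK'.le_mul_norm_sub X 0⟩
  choose! K hK hK' using h
  refine ⟨1 + ∑ k ∈ Finset.range N, |K k|, by positivity, fun k hk X => ?_⟩
  have h0 : 0 ≤ ∑ k ∈ Finset.range N, |K k| := Finset.sum_nonneg fun _ _ => abs_nonneg _
  rcases le_or_gt N k with hkN | hkN
  · refine (hN k hkN X).trans (le_mul_of_one_le_left (norm_nonneg _) (by linarith))
  · refine (hK' k hk X).trans (mul_le_mul_of_nonneg_right ?_ (norm_nonneg _))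
    have := Finset.single_le_sum (f := fun k => |K k|) (fun _ _ => abs_nonneg _)
      (Finset.mem_range.2 hkN)
    linarith [le_abs_self (K k)]

/-- The formal solution of a non-resonant system. -/
lemma exists_formal_solution {q : ℂ} {b : ℕ → A}
    (hb : ∀ k, 0 < k → Function.Injective (sylvester q (b 0) k)) :
    ∃ m : ℕ → A, m 0 = 1 ∧ ∀ k, 0 < k →
      sylvester q (b 0) k (m k) = ∑ i ∈ Finset.range k, b (k - i) * m i := by
  -- An injective endomorphism of a finite-dimensional space is surjective, so each coefficient
  -- equation can be solved; the value at `k = 0` is irrelevant.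
  have hs : ∀ k, ∃ g : A → A, 0 < k → ∀ Y, sylvester q (b 0) k (g Y) = Y := fun k => by
    by_cases hk : 0 < k
    · exact ⟨_, fun _ => Function.surjInv_eq (LinearMap.injective_iff_surjective.1 (hb k hk))⟩
    · exact ⟨id, fun h => absurd h hk⟩
  choose g hg using hs
  let step : ∀ k : ℕ, (∀ i, i < k → A) → A := fun k f =>
    if k = 0 then 1 else g k (∑ i : Fin k, b (k - i) * f i i.2)
  let m : ℕ → A := Nat.lt_wfRel.wf.fix step
  have hm : ∀ k, m k = step k fun i _ => m i := fun k => WellFounded.fix_eq _ _ _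
  refine ⟨m, by rw [hm]; exact if_pos rfl, fun k hk => ?_⟩
  rw [hm]
  simp only [step, hk.ne', if_false]
  rw [hg k hk, Finset.sum_range]

/-- The local solution of a non-resonant system at `0`. -/
theorem exists_local_solution_of_nonresonant {q : ℂ} (hq : 1 < ‖q‖) {B : ℂ → A}
    (hB : AnalyticAt ℂ B 0) (hB0 : IsUnit (B 0))
    (hC : ∀ k, 0 < k → Function.Injective (sylvester q (B 0) k)) :
    ∃ G : ℂ → A, AnalyticAt ℂ G 0 ∧ G 0 = 1 ∧ ∀ᶠ z in 𝓝 0, G (q * z) * B 0 = B z * G z := by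
  have : CompleteSpace A := FiniteDimensional.complete ℂ A
  obtain ⟨b, D, R, hD, hR, hb, hbB⟩ := exists_coeff_of_analyticAt hB
  have hb0 : b 0 = B 0 := by
    have h := hbB.self_of_nhds
    refine (hasSum_single 0 fun k hk => ?_).unique h |>.symm ▸ by simp
    simp [hk]
  obtain ⟨m, hm0, hm⟩ := exists_formal_solution (q := q) (b := b) (by rwa [hb0])
  obtain ⟨K, hK, hK'⟩ := exists_norm_le_sylvester hq hB0.unit hC
  have hmb := exists_bound_formal_solution hD hR hb hK (by rw [hb0]; exact hK') hm
  -- Since `R ≤ T`, both coefficient families are `O(T^k)`, so the two series converge absolutely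
  -- for `|z| < 1/(2T)`.
  set T := R * (1 + K * D) with hT
  have hRT : R ≤ T := le_mul_of_one_le_right hR.le (by nlinarith)
  have hT0 : 0 < T := hR.trans_le hRT
  have hsum : ∀ {c : ℕ → A} {D' : ℝ}, (∀ k, ‖c k‖ ≤ D' * T ^ k) →
      Summable fun k => ‖c k‖ * (2 * T)⁻¹ ^ k := fun hc =>
    summable_of_le_pow hT0.le (by positivity) (by rw [mul_inv]; field_simp; norm_num) hc
  have hsm := hsum hmb
  have hsb := hsum (c := b) fun k => (hb k).trans (by gcongr)
  have hpos : 0 < (2 * T)⁻¹ := by positivity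
  have hz₁ : ∀ᶠ z : ℂ in 𝓝 0, ‖z‖ < (2 * T)⁻¹ := by
    filter_upwards [Metric.ball_mem_nhds 0 hpos] with z hz using mem_ball_zero_iff.1 hz
  have hz₂ : ∀ᶠ z : ℂ in 𝓝 0, ‖q * z‖ < (2 * T)⁻¹ := by
    have : Tendsto (fun z : ℂ => q * z) (𝓝 0) (𝓝 0) := by
      simpa using (continuous_const_mul q).tendsto 0
    exact this.eventually hz₁
  have hns : ∀ {c : ℕ → A}, (Summable fun k => ‖c k‖ * (2 * T)⁻¹ ^ k) → ∀ z : ℂ,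
      ‖z‖ < (2 * T)⁻¹ → Summable fun k => ‖z ^ k • c k‖ := fun {c} hc z hz => by
    refine Summable.of_nonneg_of_le (fun _ => norm_nonneg _) (fun k => ?_) hc
    rw [norm_smul, norm_pow, mul_comm]
    gcongr
  refine ⟨fun z => ∑' k, z ^ k • m k, analyticAt_tsum_pow_smul hsm (by simpa using hpos), ?_, ?_⟩
  · refine (tsum_eq_single 0 fun k hk => by simp [hk]).trans (by simp [hm0])
  · filter_upwards [hbB, hz₁, hz₂] with z hBz h₁ h₂
    rw [← hBz.tsum_eq, tsum_mul_tsum_eq_tsum_sum_antidiagonal_of_summable_norm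
      (hns hsb z h₁) (hns hsm z h₁), ← (hns hsm _ h₂).of_norm.tsum_mul_right]
    refine tsum_congr fun k => ?_
    -- Comparison of the coefficients of `z^k`: the term `b₀ m_k` of the Cauchy product is split
    -- off, and what remains is the right-hand side of the Sylvester equation for `m_k`.
    rw [Finset.Nat.sum_antidiagonal_eq_sum_range_succ (fun i j => (z ^ i • b i) * (z ^ j • m j)),
      ← Finset.sum_range_reflect, Finset.sum_range_succ]
    simp only [Nat.succ_eq_add_one, Nat.add_sub_cancel]
    have h₃ : ∀ i ∈ Finset.range k, (z ^ (k - i) • b (k - i)) * (z ^ (k - (k - i)) • m (k - (k - i)))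
        = z ^ k • (b (k - i) * m i) := fun i hi => by
      have hi' := (Finset.mem_range.1 hi).le
      rw [Nat.sub_sub_self hi', smul_mul_smul_comm, ← pow_add, Nat.sub_add_cancel hi']
    rw [Finset.sum_congr rfl h₃, ← Finset.smul_sum]
    simp only [Nat.sub_self, Nat.sub_zero, pow_zero, one_smul, mul_pow, mul_comm (q ^ k), mul_smul,
      smul_mul_assoc, mul_smul_comm, ← smul_add]
    congr 1
    rcases Nat.eq_zero_or_pos k with rfl | hk
    · simp [hb0, hm0]
    · rw [← hm k hk, sylvester_apply, hb0, sub_add_cancel]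

end NonResonant

/-! ### Eigenvalues, shearing and non-resonance of matrices -/

section Matrix

open Matrix

variable {n : ℕ}

lemma mem_spectrum_iff_exists_mulVec {M : Matrix (Fin n) (Fin n) ℂ} {μ : ℂ} :
    μ ∈ spectrum ℂ M ↔ ∃ x ≠ 0, M *ᵥ x = μ • x := by
  rw [spectrum.mem_iff, Matrix.isUnit_iff_isUnit_det, isUnit_iff_ne_zero, not_not,
    ← Matrix.exists_mulVec_eq_zero_iff]
  refine exists_congr fun x => and_congr_right fun _ => ?_
  rw [Matrix.sub_mulVec, sub_eq_zero, eq_comm, Algebra.algebraMap_eq_smul_one, Matrix.smul_mulVec,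
    Matrix.one_mulVec]

lemma exists_vecMul_of_mem_spectrum {M : Matrix (Fin n) (Fin n) ℂ} {μ : ℂ}
    (h : μ ∈ spectrum ℂ M) : ∃ w ≠ 0, w ᵥ* M = μ • w := by
  rw [spectrum.mem_iff, Matrix.isUnit_iff_isUnit_det, isUnit_iff_ne_zero, not_not,
    ← Matrix.exists_vecMul_eq_zero_iff] at h
  obtain ⟨w, hw, h⟩ := h
  refine ⟨w, hw, ?_⟩
  rw [Matrix.vecMul_sub, sub_eq_zero, Algebra.algebraMap_eq_smul_one, Matrix.vecMul_smul,
    Matrix.vecMul_one] at h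
  exact h.symm

/-- The eigenprojection on a left eigenvector: a rank one idempotent `P` such that `P M = λ P`. -/
lemma exists_left_eigenprojection {M : Matrix (Fin n) (Fin n) ℂ} {l : ℂ}
    (h : l ∈ spectrum ℂ M) : ∃ P : Matrix (Fin n) (Fin n) ℂ, P * P = P ∧ P * M = l • P ∧
      ∀ z : ℂ, ((1 - P) + z • P).det = z := by
  obtain ⟨w, hw, hwM⟩ := exists_vecMul_of_mem_spectrum h
  obtain ⟨i, hi⟩ := Function.ne_iff.1 hw
  have hi' : w i ≠ 0 := hi
  have hwv : w ⬝ᵥ Pi.single i (w i)⁻¹ = 1 := by simp [hi']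
  -- With `v = e_i / w_i`, so that `w · v = 1`, take `P = v w`; then `1 - P + zP = 1 + (z - 1) v w`,
  -- whose determinant is `z` by the matrix determinant lemma.
  refine ⟨vecMulVec (Pi.single i (w i)⁻¹) w, ?_, ?_, fun z => ?_⟩
  · rw [vecMulVec_mul_vecMulVec, hwv, one_smul]
  · rw [vecMulVec_mul, hwM, vecMulVec_smul]
  · have h1 : (1 - vecMulVec (Pi.single i (w i)⁻¹) w) + z • vecMulVec (Pi.single i (w i)⁻¹) w =
        1 + replicateCol Unit (Pi.single i (w i)⁻¹) * replicateRow Unit ((z - 1) • w) := by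
      rw [← vecMulVec_eq, vecMulVec_smul, sub_smul, one_smul]
      abel
    rw [h1, Matrix.det_one_add_replicateCol_mul_replicateRow, smul_dotProduct, hwv]
    simp

/-- The value at `0` of the system obtained by a shearing transformation. -/
lemma spectrum_shear {P M D : Matrix (Fin n) (Fin n) ℂ} {l t : ℂ} (hP : P * P = P)
    (hPM : P * M = l • P) {μ : ℂ}
    (h : μ ∈ spectrum ℂ ((1 - P) * M * (1 - P) + t • (P * M * P) + t • (P * D * (1 - P)))) :
    μ ∈ spectrum ℂ M ∨ μ = t * l := by
  obtain ⟨x, hx, h⟩ := mem_spectrum_iff_exists_mulVec.1 h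
  have hQ : (1 - P) * (1 - P) = 1 - P := by simp [sub_mul, mul_sub, hP]
  have hQP : (1 - P) * P = 0 := by simp [sub_mul, hP]
  have hPQ : P * (1 - P) = 0 := by simp [mul_sub, hP]
  set y := (1 - P) *ᵥ x with hy
  -- If `(1 - P) x = 0`, then `x` lies in the image of `P`, where the new matrix acts through `t l`.
  -- Otherwise apply `1 - P` to the eigenvector equation: as `P M (1 - P) = 0`, it becomes `M y = μ
  -- y`.
  by_cases hy0 : y = 0
  · right
    have hPx : P *ᵥ x = x := by
      rw [hy, sub_mulVec, one_mulVec, sub_eq_zero] at hy0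
      exact hy0.symm
    have h2 : P * M * P = l • P := by rw [hPM, smul_mul_assoc, hP]
    have h3 : ∀ Z : Matrix (Fin n) (Fin n) ℂ, (Z * (1 - P)) *ᵥ x = 0 := fun Z => by
      rw [← mulVec_mulVec, ← hy, hy0, mulVec_zero]
    rw [add_mulVec, add_mulVec, smul_mulVec, smul_mulVec, h3, h3, h2, smul_mulVec, hPx, smul_zero,
      zero_add, add_zero, smul_smul] at h
    exact (smul_left_injective ℂ hx h).symm
  · left
    refine mem_spectrum_iff_exists_mulVec.2 ⟨y, hy0, ?_⟩
    have h1 := congrArg ((1 - P) *ᵥ ·) h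
    simp only [mulVec_mulVec, mulVec_smul, ← hy] at h1
    have h2 : (1 - P) * ((1 - P) * M * (1 - P) + t • (P * M * P) + t • (P * D * (1 - P))) =
        M * (1 - P) := by
      simp only [mul_add, mul_smul_comm, ← mul_assoc, hQ, hQP, zero_mul, smul_zero, add_zero]
      rw [sub_mul, one_mul, hPM, sub_mul, smul_mul_assoc, hPQ, smul_zero, sub_zero]
    rw [h2, ← mulVec_mulVec, ← hy] at h1
    exact h1

/-- A matrix whose eigenvalues lie in an annulus `r ≤ |λ| < r |q|` is non-resonant. -/
lemma sylvester_injective {q : ℂ} (hq : 1 < ‖q‖) {C : Matrix (Fin n) (Fin n) ℂ} {r : ℝ}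
    (hr : 0 < r) (h₁ : ∀ μ ∈ spectrum ℂ C, r ≤ ‖μ‖) (h₂ : ∀ μ ∈ spectrum ℂ C, ‖μ‖ < r * ‖q‖)
    {k : ℕ} (hk : 0 < k) {X : Matrix (Fin n) (Fin n) ℂ} (hX : q ^ k • (X * C) - C * X = 0) :
    X = 0 := by
  have hq0 : q ^ k ≠ 0 := pow_ne_zero _ (norm_pos_iff.1 (by linarith))
  have hX' : C * X = X * (q ^ k • C) := by rw [mul_smul_comm, ← sub_eq_zero.1 hX]
  -- From `C X = X (q^k C)` follows `p(C) X = X p(q^k C)` for every polynomial `p`. For the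
  -- characteristic polynomial of `C` the left side vanishes by Cayley–Hamilton, so it suffices that
  -- the factor on the right be invertible.
  have hp : ∀ p : Polynomial ℂ, Polynomial.aeval C p * X = X * Polynomial.aeval (q ^ k • C) p := by
    intro p
    induction p using Polynomial.induction_on' with
    | add p₁ p₂ h h' => rw [map_add, map_add, add_mul, mul_add, h, h']
    | monomial m a =>
      rw [Polynomial.aeval_monomial, Polynomial.aeval_monomial, ← Algebra.smul_def,
        ← Algebra.smul_def, smul_mul_assoc, mul_smul_comm]
      congr 1
      induction m with
      | zero => simp
      | succ m ih => rw [pow_succ, pow_succ, mul_assoc, hX', ← mul_assoc, ih, mul_assoc]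
  have hu : IsUnit (Polynomial.aeval (q ^ k • C) C.charpoly) := by
    -- For `n = 0` the spectrum is empty and the spectral mapping argument below is not available.
    rcases Nat.eq_zero_or_pos n with rfl | hn
    · exact isUnit_of_subsingleton _
    have : Nonempty (Fin n) := ⟨⟨0, hn⟩⟩
    by_contra hu
    have h0 : (0 : ℂ) ∈ spectrum ℂ (Polynomial.aeval (q ^ k • C) C.charpoly) :=
      spectrum.zero_mem_iff ℂ |>.2 hu
    rw [spectrum.map_polynomial_aeval_of_nonempty _ _
      (spectrum.nonempty_of_isAlgClosed_of_finiteDimensional ℂ _)] at h0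
    obtain ⟨μ, hμ, hμ0⟩ := h0
    have hμ1 := h₂ μ (Matrix.mem_spectrum_iff_isRoot_charpoly.2 hμ0)
    obtain ⟨x, hx, hxμ⟩ := mem_spectrum_iff_exists_mulVec.1 hμ
    -- A common eigenvalue `μ` of `C` and `q^k C` would put both `μ` and `q^(-k) μ` in the spectrum
    -- of `C`; their moduli differ by a factor of at least `|q|`, too much for the annulus.
    have hμ2 := h₁ ((q ^ k)⁻¹ * μ) (mem_spectrum_iff_exists_mulVec.2 ⟨x, hx, by
      rw [mul_smul, ← hxμ, smul_mulVec, smul_smul, inv_mul_cancel₀ hq0, one_smul]⟩)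
    rw [norm_mul, norm_inv, norm_pow, le_inv_mul_iff₀ (by positivity)] at hμ2
    have : ‖q‖ ≤ ‖q‖ ^ k := le_self_pow₀ hq.le hk.ne'
    nlinarith
  have := hp C.charpoly
  rw [Matrix.aeval_self_charpoly, zero_mul] at this
  exact (hu.mul_left_eq_zero.1 this.symm)

end Matrix

/-! ### Reduction to the non-resonant case by shearing -/

section LocalSolution

attribute [local instance] Matrix.linftyOpNormedRing Matrix.linftyOpNormedAlgebra

variable {n : ℕ}

lemma analyticAt_matrix_iff {f : ℂ → Matrix (Fin n) (Fin n) ℂ} {x : ℂ} :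
    AnalyticAt ℂ f x ↔ ∀ i j, AnalyticAt ℂ (fun z => f z i j) x := by
  refine ⟨fun h i j => ?_, fun h => ?_⟩
  · exact ((Matrix.entryLinearMap ℂ ℂ i j).toContinuousLinearMap.analyticAt (f x)).comp h
  · have h1 : f = fun z => ∑ i, ∑ j, f z i j • Matrix.single i j (1 : ℂ) := by
      funext z
      conv_lhs => rw [Matrix.matrix_eq_sum_single (f z)]
      simp
    rw [h1]
    exact Finset.analyticAt_fun_sum _ fun i _ => Finset.analyticAt_fun_sum _ fun j _ =>
      (h i j).smul analyticAt_const

lemma analyticAt_det {f : ℂ → Matrix (Fin n) (Fin n) ℂ} {x : ℂ} (hf : AnalyticAt ℂ f x) :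
    AnalyticAt ℂ (fun z => (f z).det) x := by
  simp only [Matrix.det_apply]
  exact Finset.analyticAt_fun_sum _ fun s _ =>
    (Finset.analyticAt_fun_prod _ fun i _ => analyticAt_matrix_iff.1 hf _ _).const_smul

/-- The determinant is the product of the `n` eigenvalues. This lower bound limits the number of
shearing steps. -/
lemma le_norm_det_of_spectrum {M : Matrix (Fin n) (Fin n) ℂ} {r : ℝ} (hr : 0 < r)
    (h : ∀ μ ∈ spectrum ℂ M, r ≤ ‖μ‖) : r ^ n ≤ ‖M.det‖ := by
  have key : ∀ s : Multiset ℂ, (∀ μ ∈ s, r ≤ ‖μ‖) → r ^ s.card ≤ ‖s.prod‖ := by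
    intro s
    induction s using Multiset.induction_on with
    | empty => simp
    | cons a s ih =>
      intro hs
      rw [Multiset.card_cons, Multiset.prod_cons, norm_mul, pow_succ']
      exact mul_le_mul (hs a (Multiset.mem_cons_self a s))
        (ih fun μ hμ => hs μ (Multiset.mem_cons_of_mem hμ)) (by positivity) (norm_nonneg _)
  have hcard : M.charpoly.roots.card = n := by
    rw [← (IsAlgClosed.splits M.charpoly).natDegree_eq_card_roots, Matrix.charpoly_natDegree_eq_dim,
      Fintype.card_fin]
  rw [Matrix.det_eq_prod_roots_charpoly]
  conv_lhs => rw [← hcard]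
  exact key _ fun μ hμ => h μ (Matrix.mem_spectrum_iff_isRoot_charpoly.2
    (Polynomial.isRoot_of_mem_roots hμ))

/-- The shearing transformation that divides one eigenvalue of the system at `0` by `q`. -/
lemma exists_shear {q : ℂ} (hq : q ≠ 0) {B : ℂ → Matrix (Fin n) (Fin n) ℂ}
    (hB : AnalyticAt ℂ B 0) {l : ℂ} (hl : l ∈ spectrum ℂ (B 0)) :
    ∃ S B' : ℂ → Matrix (Fin n) (Fin n) ℂ, AnalyticAt ℂ S 0 ∧ AnalyticAt ℂ B' 0 ∧
      (∀ z, (S z).det = z) ∧ (∀ z, S (q * z) * B' z = B z * S z) ∧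
      ∀ μ ∈ spectrum ℂ (B' 0), μ ∈ spectrum ℂ (B 0) ∨ μ = q⁻¹ * l := by
  obtain ⟨P, hP, hPB, hdet⟩ := exists_left_eigenprojection hl
  have hD : AnalyticAt ℂ (dslope B 0) 0 := by
    obtain ⟨p, hp⟩ := hB
    exact hp.has_fpower_series_dslope_fslope.analyticAt
  have hQ : (1 - P) * (1 - P) = 1 - P := by simp [sub_mul, mul_sub, hP]
  have hQP : (1 - P) * P = 0 := by simp [sub_mul, hP]
  have hPQ : P * (1 - P) = 0 := by simp [mul_sub, hP]
  -- The second function is `S(qz)⁻¹ B(z) S(z)` for `S(z) = 1 - P + zP`, expanded into blocks. Its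
  -- only polar term `(qz)⁻¹ P B(z) (1 - P)` is regular because `P B(0) (1 - P) = 0`, which is why
  -- the difference quotient `dslope` appears.
  refine ⟨fun z => (1 - P) + z • P, fun z => (1 - P) * B z * (1 - P) + z • ((1 - P) * B z * P) +
    q⁻¹ • (P * B z * P) + q⁻¹ • (P * dslope B 0 z * (1 - P)),
    analyticAt_const.add (analyticAt_id.smul analyticAt_const), ?_, hdet, fun z => ?_,
    fun μ hμ => ?_⟩
  · have hc : ∀ (Y Z : Matrix (Fin n) (Fin n) ℂ) {f : ℂ → Matrix (Fin n) (Fin n) ℂ},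
        AnalyticAt ℂ f 0 → AnalyticAt ℂ (fun z => Y * f z * Z) 0 := fun Y Z f hf =>
      (analyticAt_const.mul hf).mul analyticAt_const
    have hs : ∀ {f : ℂ → Matrix (Fin n) (Fin n) ℂ} {c : ℂ → ℂ}, AnalyticAt ℂ c 0 →
        AnalyticAt ℂ f 0 → AnalyticAt ℂ (fun z => c z • f z) 0 := fun hc hf => hc.smul hf
    exact (((hc _ _ hB).add (hs analyticAt_id (hc _ _ hB))).add
      (hs analyticAt_const (hc _ _ hB))).add (hs analyticAt_const (hc _ _ hD))
  · have h1 : z • (P * dslope B 0 z * (1 - P)) = P * B z * (1 - P) := by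
      have h2 := sub_smul_dslope B 0 z
      rw [sub_zero] at h2
      rw [← smul_mul_assoc, ← mul_smul_comm, h2, mul_sub P, hPB, sub_mul, smul_mul_assoc, hPQ,
        smul_zero, sub_zero]
    have h3 : (1 - P + (q * z) • P) * ((1 - P) * B z * (1 - P) + z • ((1 - P) * B z * P) +
        q⁻¹ • (P * B z * P) + q⁻¹ • (P * dslope B 0 z * (1 - P))) =
        (1 - P) * B z * (1 - P) + z • ((1 - P) * B z * P) + z • (P * B z * P) +
          z • (P * dslope B 0 z * (1 - P)) := by
      simp only [mul_add, add_mul, mul_smul_comm, smul_mul_assoc, ← mul_assoc, hQ, hQP, hPQ, hP,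
        smul_zero, add_zero, zero_add, smul_smul]
      rw [inv_mul_cancel₀ hq, one_mul]
    rw [h3, h1]
    simp only [mul_add, sub_mul, mul_sub, mul_smul_comm, one_mul, mul_one, smul_sub]
    abel
  · refine spectrum_shear (t := q⁻¹) (D := dslope B 0 0) hP hPB ?_
    simpa using hμ

/-- Induction on the number `N` of shearings allowed by the size of `det B(0)`. If some eigenvalue
has modulus at least `r |q|`, shearing divides it by `q`: the lower bound `r` persists and the
determinant loses a factor `q`. For `N = 0` the hypotheses contradict `le_norm_det_of_spectrum`. -/
theorem exists_local_solution_of_spectrum {q : ℂ} (hq : 1 < ‖q‖) {r : ℝ} (hr : 0 < r) (N : ℕ) :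
    ∀ B : ℂ → Matrix (Fin n) (Fin n) ℂ, AnalyticAt ℂ B 0 → (∀ μ ∈ spectrum ℂ (B 0), r ≤ ‖μ‖) →
      ‖(B 0).det‖ < r ^ n * ‖q‖ ^ N →
      ∃ (C : GL (Fin n) ℂ) (G : ℂ → Matrix (Fin n) (Fin n) ℂ), AnalyticAt ℂ G 0 ∧
        (∀ᶠ z in 𝓝[≠] 0, (G z).det ≠ 0) ∧ ∀ᶠ z in 𝓝 0, G (q * z) * C.val = B z * G z := by
  have hq0 : q ≠ 0 := norm_pos_iff.1 (by linarith)
  induction N with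
  | zero =>
    intro B _ hs hd
    rw [pow_zero, mul_one] at hd
    exact absurd (le_norm_det_of_spectrum hr hs) (not_le.2 hd)
  | succ N ih =>
    intro B hB hs hd
    by_cases h : ∀ μ ∈ spectrum ℂ (B 0), ‖μ‖ < r * ‖q‖
    · have hu : IsUnit (B 0) := by
        rw [Matrix.isUnit_iff_isUnit_det, isUnit_iff_ne_zero, ← norm_pos_iff]
        exact (pow_pos hr n).trans_le (le_norm_det_of_spectrum hr hs)
      obtain ⟨G, hG, hG0, hGB⟩ := exists_local_solution_of_nonresonant hq hB hu fun k hk =>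
        (injective_iff_map_eq_zero _).2 fun X hX => sylvester_injective hq hr hs h hk hX
      refine ⟨hu.unit, G, hG, nhdsWithin_le_nhds ?_, hGB⟩
      refine (analyticAt_det hG).continuousAt.eventually_ne ?_
      simp [hG0]
    · push Not at h
      obtain ⟨l, hl, hlr⟩ := h
      obtain ⟨S, B', hS, hB', hSdet, hSB, hspec⟩ := exists_shear hq0 hB hl
      have hlr' : r ≤ ‖q⁻¹ * l‖ := by
        rw [norm_mul, norm_inv, le_inv_mul_iff₀ (by linarith), mul_comm]
        exact hlr
      -- Determinants in `S(qz) B' = B S` give the relation for `z ≠ 0`; the identity principle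
      -- carries it to `z = 0`.
      have hdet : q * (B' 0).det = (B 0).det := by
        have h1 : ∀ᶠ z in 𝓝[≠] (0 : ℂ), q * (B' z).det = (B z).det := by
          filter_upwards [self_mem_nhdsWithin] with z hz
          have := congrArg Matrix.det (hSB z)
          rw [Matrix.det_mul, Matrix.det_mul, hSdet, hSdet, mul_right_comm] at this
          exact mul_right_cancel₀ hz this
        have h2 := ((analyticAt_const.mul (analyticAt_det hB')).frequently_eq_iff_eventually_eq
          (analyticAt_det hB)).1 h1.frequently
        exact h2.self_of_nhds
      obtain ⟨C, G, hG, hGdet, hGB⟩ := ih B' hB'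
        (fun μ hμ => (hspec μ hμ).elim (hs μ) fun h => h ▸ hlr') (by
          rw [← hdet, norm_mul, pow_succ] at hd
          nlinarith [norm_nonneg (B' 0).det])
      -- `S` intertwines `B'` with `B`, so it maps solutions of the sheared system to solutions of
      -- the original one; `det S(z) = z` keeps the product invertible off `0`.
      refine ⟨C, fun z => S z * G z, hS.mul hG, ?_, ?_⟩
      · filter_upwards [hGdet, self_mem_nhdsWithin] with z hz hz0
        rw [Matrix.det_mul, hSdet]
        exact mul_ne_zero hz0 hz
      · filter_upwards [hGB] with z hz
        rw [mul_assoc, hz, ← mul_assoc, hSB, mul_assoc]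

/-- A `q`-difference system that is regular at `0` has a fundamental matrix near `0`. -/
theorem exists_local_solution {q : ℂ} (hq : 1 < ‖q‖) {B : ℂ → Matrix (Fin n) (Fin n) ℂ}
    (hB : AnalyticAt ℂ B 0) (hB0 : (B 0).det ≠ 0) :
    ∃ (C : GL (Fin n) ℂ) (G : ℂ → Matrix (Fin n) (Fin n) ℂ), AnalyticAt ℂ G 0 ∧
      (∀ᶠ z in 𝓝[≠] 0, (G z).det ≠ 0) ∧ ∀ᶠ z in 𝓝 0, G (q * z) * C.val = B z * G z := by
  obtain ⟨r, hr, hr'⟩ : ∃ r : ℝ, 0 < r ∧ ∀ μ ∈ spectrum ℂ (B 0), r ≤ ‖μ‖ := by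
    have hfin : (spectrum ℂ (B 0)).Finite := by
      refine (B 0).charpoly.roots.toFinset.finite_toSet.subset fun μ hμ => ?_
      simpa [Matrix.charpoly_monic _ |>.ne_zero] using Matrix.mem_spectrum_iff_isRoot_charpoly.1 hμ
    have h0 : ∀ μ ∈ spectrum ℂ (B 0), 0 < ‖μ‖ := fun μ hμ => norm_pos_iff.2 fun h =>
      (spectrum.zero_mem_iff ℂ).1 (h ▸ hμ)
        ((Matrix.isUnit_iff_isUnit_det _).2 (isUnit_iff_ne_zero.2 hB0))
    -- The radius `r` is the least modulus of an eigenvalue; any positive number serves when there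
    -- is none.
    rcases (spectrum ℂ (B 0)).eq_empty_or_nonempty with he | hne
    · exact ⟨1, one_pos, by simp [he]⟩
    · obtain ⟨a, ha, ha'⟩ := Set.exists_min_image _ (fun μ : ℂ => ‖μ‖) hfin hne
      exact ⟨‖a‖, h0 a ha, ha'⟩
  obtain ⟨N, hN⟩ := pow_unbounded_of_one_lt (‖(B 0).det‖ / r ^ n) hq
  exact exists_local_solution_of_spectrum hq hr N B hB hr' (by
    rwa [div_lt_iff₀ (by positivity), mul_comm] at hN)

end LocalSolution

/-! ### Continuation of local solutions to the whole plane -/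

section GlobalSolution

variable {n : ℕ}

lemma meromorphicAt_matrix_mul {m p : ℕ} {f : ℂ → Matrix (Fin m) (Fin n) ℂ}
    {g : ℂ → Matrix (Fin n) (Fin p) ℂ} {x : ℂ} (hf : ∀ i j, MeromorphicAt (fun z => f z i j) x)
    (hg : ∀ i j, MeromorphicAt (fun z => g z i j) x) (i : Fin m) (j : Fin p) :
    MeromorphicAt (fun z => (f z * g z) i j) x := by
  simp only [Matrix.mul_apply]
  exact MeromorphicAt.fun_sum fun k _ => (hf i k).mul (hg k j)

/-- A meromorphic function that has a limit at a point becomes analytic there. -/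
lemma analyticAt_update_of_tendsto {f : ℂ → ℂ} {x c : ℂ} (hf : MeromorphicAt f x)
    (hc : Tendsto f (𝓝[≠] x) (𝓝 c)) : AnalyticAt ℂ (Function.update f x c) x := by
  have he : ∀ y ≠ x, Function.update f x c =ᶠ[𝓝 y] f := fun y hy => by
    filter_upwards [isOpen_ne.mem_nhds hy] with z hz
    exact Function.update_of_ne hz _ _
  refine Complex.analyticAt_of_differentiable_on_punctured_nhds_of_continuousAt ?_
    (continuousAt_update_same.2 hc)
  filter_upwards [hf.eventually_analyticAt, self_mem_nhdsWithin] with y hy hyx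
  exact (hy.congr (he y hyx).symm).differentiableAt

-- An entrywise form of the local theorem, so that later statements do not depend on a choice of
-- matrix norm.
attribute [local instance] Matrix.linftyOpNormedRing Matrix.linftyOpNormedAlgebra in
lemma exists_local_solution_entries {q : ℂ} (hq : 1 < ‖q‖) {B : ℂ → Matrix (Fin n) (Fin n) ℂ}
    (hB : ∀ i j, AnalyticAt ℂ (fun z => B z i j) 0) (hB0 : (B 0).det ≠ 0) :
    ∃ (C : GL (Fin n) ℂ) (G : ℂ → Matrix (Fin n) (Fin n) ℂ),
      (∀ i j, AnalyticAt ℂ (fun z => G z i j) 0) ∧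
      (∀ᶠ z in 𝓝[≠] 0, (G z).det ≠ 0) ∧ ∀ᶠ z in 𝓝 0, G (q * z) * C.val = B z * G z := by
  obtain ⟨C, G, hG, h⟩ := exists_local_solution hq (analyticAt_matrix_iff.2 hB) hB0
  exact ⟨C, G, analyticAt_matrix_iff.1 hG, h⟩

/-- The functional equation extends a local solution to a global meromorphic solution. -/
lemma exists_extension {q : ℂ} (hq : 1 < ‖q‖) {B G : ℂ → Matrix (Fin n) (Fin n) ℂ}
    {C : GL (Fin n) ℂ} (hB : ∀ i j x, MeromorphicAt (fun z => B z i j) x)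
    (hG : ∀ i j, AnalyticAt ℂ (fun z => G z i j) 0)
    (h : ∀ᶠ z in 𝓝 0, G (q * z) * C.val = B z * G z) :
    ∃ H : ℂ → Matrix (Fin n) (Fin n) ℂ, (∀ i j x, MeromorphicAt (fun z => H z i j) x) ∧
      (∀ᶠ z in 𝓝 0, H z = G z) ∧ ∀ z, H (q * z) * C.val = B z * H z := by
  have hq0 : q ≠ 0 := norm_pos_iff.1 (by linarith)
  have hqn : 0 < ‖q‖ := norm_pos_iff.2 hq0
  have hG' : ∀ᶠ z in 𝓝 (0 : ℂ), ∀ i j, AnalyticAt ℂ (fun z => G z i j) z :=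
    eventually_all.2 fun i => eventually_all.2 fun j => (hG i j).eventually_analyticAt
  obtain ⟨r, hr, hr'⟩ := Metric.eventually_nhds_iff_ball.1 (h.and hG')
  simp only [mem_ball_zero_iff] at hr'
  -- Iterates of `f(z) ↦ B(z/q) f(z/q) C⁻¹`, which fixes solutions. The `N`-th iterate is meaningful
  -- on `|z| < r |q|^N`, and these discs exhaust `ℂ`.
  obtain ⟨g, hg0, hg⟩ : ∃ g : ℕ → ℂ → Matrix (Fin n) (Fin n) ℂ, g 0 = G ∧
      ∀ N z, g (N + 1) z = B (q⁻¹ * z) * g N (q⁻¹ * z) * (C⁻¹).val :=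
    ⟨fun N => Nat.rec G (fun _ f z => B (q⁻¹ * z) * f (q⁻¹ * z) * (C⁻¹).val) N, rfl,
      fun _ _ => rfl⟩
  have hnorm : ∀ {N : ℕ} {z : ℂ}, ‖z‖ < r * ‖q‖ ^ (N + 1) → ‖q⁻¹ * z‖ < r * ‖q‖ ^ N := by
    intro N z hz
    rw [norm_mul, norm_inv, inv_mul_lt_iff₀ hqn]
    rwa [pow_succ, ← mul_assoc, mul_comm] at hz
  have hCC : C.val * (C⁻¹).val = 1 := C.mul_inv
  have hCC' : (C⁻¹).val * C.val = 1 := C.inv_mul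
  have hstep : ∀ N z, ‖z‖ < r * ‖q‖ ^ N → g (N + 1) z = g N z := by
    intro N
    induction N with
    | zero =>
      intro z hz
      rw [pow_zero, mul_one] at hz
      have h1 : ‖q⁻¹ * z‖ < r := by
        rw [norm_mul, norm_inv, inv_mul_lt_iff₀ hqn]
        nlinarith
      have h2 := (hr' _ h1).1
      rw [mul_inv_cancel_left₀ hq0] at h2
      rw [hg, hg0, ← h2, Matrix.mul_assoc, hCC, Matrix.mul_one]
    | succ N ih =>
      intro z hz
      rw [hg (N + 1), ih _ (hnorm hz), hg N]
  have hmono : ∀ {N M : ℕ} {z : ℂ}, N ≤ M → ‖z‖ < r * ‖q‖ ^ N → g M z = g N z := by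
    intro N M z hNM hz
    induction M, hNM using Nat.le_induction with
    | base => rfl
    | succ M hM ih =>
      rw [hstep M z (hz.trans_le (by gcongr; exact hq.le)), ih]
  have hex : ∀ z : ℂ, ∃ N : ℕ, ‖z‖ < r * ‖q‖ ^ N := fun z => by
    obtain ⟨N, hN⟩ := pow_unbounded_of_one_lt (‖z‖ / r) hq
    exact ⟨N, by rwa [div_lt_iff₀ hr, mul_comm] at hN⟩
  -- The index `ν z` is arbitrary and may jump with `z`; near each point the value still agrees with
  -- one fixed iterate, since the iterates are compatible on their discs.
  choose ν hν using hex
  have hH : ∀ {N : ℕ} {z : ℂ}, ‖z‖ < r * ‖q‖ ^ N → g (ν z) z = g N z := fun {N z} hz => by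
    rcases le_total (ν z) N with hle | hle
    · exact (hmono hle (hν z)).symm
    · exact hmono hle hz
  have hmer : ∀ N x, ‖x‖ < r * ‖q‖ ^ N → ∀ i j, MeromorphicAt (fun z => g N z i j) x := by
    intro N
    induction N with
    | zero =>
      intro x hx i j
      rw [pow_zero, mul_one] at hx
      rw [hg0]
      exact ((hr' x hx).2 i j).meromorphicAt
    | succ N ih =>
      intro x hx i j
      have hc : ∀ f : ℂ → ℂ, MeromorphicAt f (q⁻¹ * x) →
          MeromorphicAt (fun z => f (q⁻¹ * z)) x := fun f hf =>
        hf.comp_analyticAt (g := fun z => q⁻¹ * z) (by fun_prop)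
      have h1 := meromorphicAt_matrix_mul (x := x) (fun i j => hc _ (hB i j _))
        fun i j => hc _ (ih _ (hnorm hx) i j)
      have h2 := meromorphicAt_matrix_mul (g := fun _ => (C⁻¹).val) h1
        (fun i j => MeromorphicAt.const _ _) i j
      simpa only [hg] using h2
  have hopen : ∀ (N : ℕ) {x : ℂ}, ‖x‖ < r * ‖q‖ ^ N → ∀ᶠ z in 𝓝 x, g (ν z) z = g N z :=
    fun N x hx => by
      filter_upwards [(isOpen_lt continuous_norm continuous_const).mem_nhds hx] with z hz
      exact hH hz
  refine ⟨fun z => g (ν z) z, fun i j x => ?_, hg0 ▸ hopen 0 (by simpa using hr), fun z => ?_⟩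
  · refine (hmer _ x (hν x) i j).congr (nhdsWithin_le_nhds ?_)
    filter_upwards [hopen _ (hν x)] with z hz
    rw [hz]
  · change g (ν (q * z)) (q * z) * C.val = B z * g (ν z) z
    have h1 : ‖q * z‖ < r * ‖q‖ ^ (ν z + 1) := by
      rw [norm_mul, pow_succ, ← mul_assoc, mul_comm]
      exact mul_lt_mul_of_pos_right (hν z) hqn
    rw [hH h1, hg (ν z), inv_mul_cancel_left₀ hq0, Matrix.mul_assoc, hCC', Matrix.mul_one]

/-- A `q`-difference system with meromorphic coefficients that is regular at `0` has a meromorphic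
fundamental matrix. -/
theorem exists_meromorphic_solution {q : ℂ} (hq : 1 < ‖q‖) {B : ℂ → Matrix (Fin n) (Fin n) ℂ}
    (hB : ∀ i j x, MeromorphicAt (fun z => B z i j) x) {B₀ : Matrix (Fin n) (Fin n) ℂ}
    (hB₀ : B₀.det ≠ 0) (hlim : ∀ i j, Tendsto (fun z => B z i j) (𝓝[≠] 0) (𝓝 (B₀ i j))) :
    ∃ (C : GL (Fin n) ℂ) (H : ℂ → Matrix (Fin n) (Fin n) ℂ),
      (∀ i j x, MeromorphicAt (fun z => H z i j) x) ∧ (∀ᶠ z in 𝓝[≠] 0, (H z).det ≠ 0) ∧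
      ∀ z ≠ 0, H (q * z) * C.val = B z * H z := by
  have he : ∀ i j, (fun z => Function.update B 0 B₀ z i j) =
      Function.update (fun z => B z i j) 0 (B₀ i j) := fun i j => by
    funext z
    rcases eq_or_ne z 0 with rfl | hz
    · simp
    · simp [hz]
  have hmer : ∀ i j x, MeromorphicAt (fun z => Function.update B 0 B₀ z i j) x := fun i j x => by
    refine (hB i j x).congr ?_
    rcases eq_or_ne x 0 with rfl | hx
    · filter_upwards [self_mem_nhdsWithin] with z hz
      rw [Function.update_of_ne hz]
    · filter_upwards [nhdsWithin_le_nhds (isOpen_ne.mem_nhds hx)] with z hz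
      rw [Function.update_of_ne hz]
  -- The value of `B` at `0` is replaced by its limit, which removes the singularity there; this is
  -- why the final equation is claimed only for `z ≠ 0`.
  obtain ⟨C, G, hG, hGdet, hGB⟩ := exists_local_solution_entries hq
    (B := Function.update B 0 B₀)
    (fun i j => by rw [he]; exact analyticAt_update_of_tendsto (hB i j 0) (hlim i j)) (by simpa)
  obtain ⟨H, hH, hHG, hHB⟩ := exists_extension hq hmer hG hGB
  refine ⟨C, H, hH, ?_, fun z hz => ?_⟩
  · filter_upwards [hGdet, nhdsWithin_le_nhds hHG] with z h1 h2
    rwa [h2]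
  · rw [hHB, Function.update_of_ne hz]

end GlobalSolution

/-! ### Inverses of meromorphic functions -/

section Field

lemma mk_ne_zero {f : merFun} {x : ℂ} (hx : x ≠ 0) (h : ∀ᶠ z in 𝓝[≠] x, f.1 z ≠ 0) :
    MerStar.mk f ≠ 0 := fun h0 => by
  have h1 := MerStar.mk_eq_mk.1 (h0.trans (map_zero MerStar.mk).symm) x hx
  obtain ⟨z, hz, hz'⟩ := (h1.and h).exists
  exact hz' hz

/-- The identity principle: a nonzero meromorphic function on `ℂ*` does not vanish identically near
any point. -/
lemma eventually_ne_zero_of_mk_ne_zero {f : merFun} (hf : MerStar.mk f ≠ 0) {x : ℂ} (hx : x ≠ 0) :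
    ∀ᶠ z in 𝓝[≠] x, f.1 z ≠ 0 := by
  have hf' : ¬ ∀ y : ℂ, y ≠ 0 → ∀ᶠ z in 𝓝[≠] y, f.1 z = 0 := fun h =>
    hf ((MerStar.mk_eq_mk.2 h).trans (map_zero MerStar.mk))
  push Not at hf'
  obtain ⟨y, hy, hy'⟩ := hf'
  have hconn : IsConnected ({0}ᶜ : Set ℂ) :=
    isConnected_compl_singleton_of_one_lt_rank (by simp [Complex.rank_real_complex]) 0
  have hxo := (f.2.exists_meromorphicOrderAt_ne_top_iff_forall hconn).1
    ⟨⟨y, hy⟩, fun h => hy' ((meromorphicOrderAt_eq_top_iff.1 h).mono fun z hz hz' => hz' hz)⟩ ⟨x, hx⟩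
  exact (meromorphicOrderAt_ne_top_iff_eventually_ne_zero (f.2 x hx)).1 hxo

/-- The pointwise inverse. -/
noncomputable def merInv (f : merFun) : merFun := ⟨f.1⁻¹, f.2.inv⟩

lemma mk_mul_mk_inv {f : merFun} (hf : MerStar.mk f ≠ 0) :
    MerStar.mk f * MerStar.mk (merInv f) = 1 := by
  rw [← map_mul, ← map_one MerStar.mk]
  refine MerStar.mk_eq_mk.2 fun x hx => ?_
  filter_upwards [eventually_ne_zero_of_mk_ne_zero hf hx] with z hz
  exact mul_inv_cancel₀ hz

lemma isUnit_merZero {φ : merZero} (hφ : φ.1 ≠ 0) : IsUnit φ := by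
  obtain ⟨_, f, hf, rfl⟩ := φ
  exact IsUnit.of_mul_eq_one ⟨_, merInv f, MeromorphicAt.inv hf, rfl⟩ (Subtype.ext (mk_mul_mk_inv hφ))

lemma isUnit_merInfty {φ : merInfty} (hφ : φ.1 ≠ 0) : IsUnit φ := by
  obtain ⟨_, f, hf, rfl⟩ := φ
  exact IsUnit.of_mul_eq_one ⟨_, merInv f, MeromorphicAt.inv hf, rfl⟩ (Subtype.ext (mk_mul_mk_inv hφ))

/-- Invertibility is tested over `M(ℂ*)`, but the inverse keeps its entries in `S`, because nonzero
elements of `S` are invertible in `S`. -/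
lemma exists_gl_of_det_ne_zero {S : Subalgebra ℂ MerStar} (hS : ∀ φ : S, φ.1 ≠ 0 → IsUnit φ)
    {n : ℕ} {N : Matrix (Fin n) (Fin n) S} (hN : (up S.val N).det ≠ 0) :
    ∃ G : GL (Fin n) S, G.val = N := by
  have h1 : (up S.val N).det = N.det.1 := (S.val.toRingHom.map_det N).symm
  exact ⟨((Matrix.isUnit_iff_isUnit_det N).2 (hS _ (h1 ▸ hN))).unit, rfl⟩

end Field

/-! ### Matrices of meromorphic functions -/

section MatrixFunctions

variable {m n p : ℕ}

/-- The value at a point of a matrix of meromorphic functions. -/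
noncomputable def evalMat (z : ℂ) (M : Matrix (Fin m) (Fin n) merFun) : Matrix (Fin m) (Fin n) ℂ :=
  M.map fun f => f.1 z

/-- Evaluation at a point. -/
noncomputable def evalHom (z : ℂ) : merFun →+* ℂ := (Pi.evalRingHom (fun _ => ℂ) z).comp
  (SubringClass.subtype merFun)

lemma evalMat_mul (z : ℂ) (M : Matrix (Fin m) (Fin n) merFun) (N : Matrix (Fin n) (Fin p) merFun) :
    evalMat z (M * N) = evalMat z M * evalMat z N :=
  Matrix.map_mul (f := evalHom z)

lemma evalMat_one (z : ℂ) : evalMat z (1 : Matrix (Fin n) (Fin n) merFun) = 1 :=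
  Matrix.map_one (evalHom z) (map_zero _) (map_one _)

lemma det_evalMat (z : ℂ) (M : Matrix (Fin n) (Fin n) merFun) :
    (evalMat z M).det = M.det.1 z := ((evalHom z).map_det M).symm

/-- The matrix over `M(ℂ*)` represented by a matrix of functions. -/
noncomputable def mkMat (M : Matrix (Fin m) (Fin n) merFun) : Matrix (Fin m) (Fin n) MerStar :=
  M.map MerStar.mk

lemma mkMat_mul (M : Matrix (Fin m) (Fin n) merFun) (N : Matrix (Fin n) (Fin p) merFun) :
    mkMat (M * N) = mkMat M * mkMat N := Matrix.map_mul

lemma mkMat_one : mkMat (1 : Matrix (Fin n) (Fin n) merFun) = 1 :=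
  Matrix.map_one _ (map_zero _) (map_one _)

lemma det_mkMat (M : Matrix (Fin n) (Fin n) merFun) : (mkMat M).det = MerStar.mk M.det :=
  (MerStar.mk.toRingHom.map_det M).symm

lemma mkMat_surjective : Function.Surjective (mkMat : Matrix (Fin m) (Fin n) merFun → _) :=
  fun M => ⟨Matrix.of fun i j => Function.surjInv (Ideal.Quotient.mk_surjective (I := negligible))
    (M i j), by
      ext i j
      exact Function.surjInv_eq (Ideal.Quotient.mk_surjective (I := negligible)) (M i j)⟩

lemma mkMat_eq_mkMat {M N : Matrix (Fin m) (Fin n) merFun} :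
    mkMat M = mkMat N ↔ ∀ x : ℂ, x ≠ 0 → ∀ᶠ z in 𝓝[≠] x, evalMat z M = evalMat z N := by
  simp only [← Matrix.ext_iff, eventually_all]
  refine ⟨fun h x hx i j => MerStar.mk_eq_mk.1 (h i j) x hx, fun h i j => ?_⟩
  exact MerStar.mk_eq_mk.2 fun x hx => h x hx i j

lemma det_mkMat_ne_zero {M : Matrix (Fin n) (Fin n) merFun} {x : ℂ} (hx : x ≠ 0)
    (h : ∀ᶠ z in 𝓝[≠] x, (evalMat z M).det ≠ 0) : (mkMat M).det ≠ 0 := by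
  rw [det_mkMat]
  refine mk_ne_zero hx ?_
  simpa only [det_evalMat] using h

/-- A representative of `G⁻¹` is a pointwise inverse of `M` outside a closed discrete subset of
`ℂ*`. -/
lemma eventually_det_ne_zero {M : Matrix (Fin n) (Fin n) merFun} {G : GL (Fin n) MerStar}
    (h : mkMat M = G.val) {x : ℂ} (hx : x ≠ 0) : ∀ᶠ z in 𝓝[≠] x, (evalMat z M).det ≠ 0 := by
  obtain ⟨N, hN⟩ := mkMat_surjective (G⁻¹).val
  have h1 : mkMat (M * N) = mkMat 1 := by rw [mkMat_mul, h, hN, mkMat_one]; exact G.mul_inv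
  filter_upwards [mkMat_eq_mkMat.1 h1 x hx] with z hz
  rw [evalMat_mul, evalMat_one] at hz
  exact Matrix.det_ne_zero_of_right_inverse hz

/-- The matrix of meromorphic functions given by a matrix-valued function. -/
noncomputable def ofFun (H : ℂ → Matrix (Fin m) (Fin n) ℂ)
    (hH : ∀ i j, ∀ x ≠ 0, MeromorphicAt (fun z => H z i j) x) : Matrix (Fin m) (Fin n) merFun :=
  Matrix.of fun i j => ⟨fun z => H z i j, fun x hx => hH i j x hx⟩

lemma evalMat_ofFun {H : ℂ → Matrix (Fin m) (Fin n) ℂ}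
    (hH : ∀ i j, ∀ x ≠ 0, MeromorphicAt (fun z => H z i j) x) (z : ℂ) :
    evalMat z (ofFun H hH) = H z := rfl

lemma exists_gl_merZero {H : ℂ → Matrix (Fin n) (Fin n) ℂ}
    (hH : ∀ i j, ∀ x ≠ 0, MeromorphicAt (fun z => H z i j) x)
    (h0 : ∀ i j, MeromorphicAt (fun z => H z i j) 0) (hdet : (mkMat (ofFun H hH)).det ≠ 0) :
    ∃ G : GL (Fin n) merZero, (upGL merZero.val G).val = mkMat (ofFun H hH) := by
  obtain ⟨G, hG⟩ := exists_gl_of_det_ne_zero (S := merZero) (fun _ => isUnit_merZero)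
    (N := Matrix.of fun i j => ⟨_, ofFun H hH i j, h0 i j, rfl⟩) hdet
  exact ⟨G, congrArg (up merZero.val) hG⟩

lemma exists_gl_merInfty {H : ℂ → Matrix (Fin n) (Fin n) ℂ}
    (hH : ∀ i j, ∀ x ≠ 0, MeromorphicAt (fun z => H z i j) x)
    (h0 : ∀ i j, MeromorphicAt (fun w => H w⁻¹ i j) 0) (hdet : (mkMat (ofFun H hH)).det ≠ 0) :
    ∃ G : GL (Fin n) merInfty, (upGL merInfty.val G).val = mkMat (ofFun H hH) := by
  obtain ⟨G, hG⟩ := exists_gl_of_det_ne_zero (S := merInfty) (fun _ => isUnit_merInfty)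
    (N := Matrix.of fun i j => ⟨_, ofFun H hH i j, h0 i j, rfl⟩) hdet
  exact ⟨G, congrArg (up merInfty.val) hG⟩

/-- A functional equation, read in `M(ℂ*)`. -/
lemma shift_mkMat_mul_cst (q : ℂˣ) {H B : ℂ → Matrix (Fin n) (Fin n) ℂ}
    (hH : ∀ i j, ∀ x ≠ 0, MeromorphicAt (fun z => H z i j) x)
    (hB : ∀ i j, ∀ x ≠ 0, MeromorphicAt (fun z => B z i j) x) (C : GL (Fin n) ℂ)
    (h : ∀ x : ℂ, x ≠ 0 → ∀ᶠ z in 𝓝[≠] x, H (q * z) * C.val = B z * H z) :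
    shift q (mkMat (ofFun H hH)) * (cst C).val = mkMat (ofFun B hB) * mkMat (ofFun H hH) := by
  have h1 : (cst C).val = mkMat (ofFun (fun _ => C.val) fun i j x _ => MeromorphicAt.const _ _) := by
    ext i j
    exact (MerStar.mk.commutes (C.val i j)).symm
  have h2 : shift q (mkMat (ofFun H hH)) = mkMat ((ofFun H hH).map (dilate q)) := rfl
  rw [h1, h2, ← mkMat_mul, ← mkMat_mul]
  refine mkMat_eq_mkMat.2 fun x hx => ?_
  filter_upwards [h x hx] with z hz
  rw [evalMat_mul, evalMat_mul]
  exact hz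

end MatrixFunctions

/-! ### Fundamental matrices of fuchsian equations -/

section Solutions

variable {n : ℕ}

/-- The value of a rational matrix at a point. -/
noncomputable def ratEval (B : Matrix (Fin n) (Fin n) (RatFunc ℂ)) (z : ℂ) :
    Matrix (Fin n) (Fin n) ℂ := B.map fun r => r.eval (RingHom.id ℂ) z

lemma meromorphicAt_ratFunc_eval (r : RatFunc ℂ) (x : ℂ) :
    MeromorphicAt (fun z => r.eval (RingHom.id ℂ) z) x := by
  simp only [RatFunc.eval, Polynomial.eval₂_id]
  exact (r.num.differentiable.analyticAt x).meromorphicAt.div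
    (r.denom.differentiable.analyticAt x).meromorphicAt

lemma meromorphicAt_ratFunc_eval_inv (r : RatFunc ℂ) (x : ℂ) :
    MeromorphicAt (fun w => r.eval (RingHom.id ℂ) w⁻¹) x := by
  have h : ∀ p : Polynomial ℂ, MeromorphicAt (fun w : ℂ => p.eval w⁻¹) x := fun p => by
    simp only [Polynomial.eval_eq_sum_range]
    exact MeromorphicAt.fun_sum fun i _ => (MeromorphicAt.const _ _).mul
      ((MeromorphicAt.id x).inv.pow _)
  simp only [RatFunc.eval, Polynomial.eval₂_id]
  exact (h _).div (h _)

lemma up_ratToMer (B : Matrix (Fin n) (Fin n) (RatFunc ℂ)) :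
    up ratToMer B =
      mkMat (ofFun (ratEval B) fun i j x _ => meromorphicAt_ratFunc_eval (B i j) x) := rfl

/-- Gauge transformations compose: `F` takes `A` to `B`, and `M` takes `B` to the constant matrix
`C`. -/
lemma eq_shift_mul_cst_mul_inv (q : ℂˣ) {A B F M : GL (Fin n) MerStar} {C : GL (Fin n) ℂ}
    (h : B = (shiftGL q F)⁻¹ * A * F) (hM : shift q M.val * (cst C).val = B.val * M.val) :
    A = shiftGL q (F * M) * cst C * (F * M)⁻¹ := by
  have h1 : shiftGL q M * cst C = B * M := Units.ext hM
  rw [shiftGL, map_mul, mul_assoc _ _ (cst C), h1, h]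
  group

theorem exists_solution_zero {q : ℂˣ} (hq : 1 < ‖(q : ℂ)‖) {X : Eqn q} (hX : X.IsFuchsianAtZero) :
    ∃ (A : GL (Fin X.dim) ℂ) (M : GL (Fin X.dim) merZero),
      upGL ratToMer X.mat =
        shiftGL q (upGL merZero.val M) * cst A * (upGL merZero.val M)⁻¹ := by
  obtain ⟨B, F, ⟨B₀, hB₀⟩, hBF⟩ := hX
  obtain ⟨C, H, hH, hdet, hHB⟩ := exists_meromorphic_solution hq (B := ratEval B.val)
    (fun i j x => meromorphicAt_ratFunc_eval (B.val i j) x)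
    (B₀ := B₀.val) ((Matrix.isUnit_iff_isUnit_det _).1 B₀.isUnit).ne_zero hB₀
  -- Nonvanishing of `det H` is known on a punctured neighbourhood of `0`, and `0` is not a point of
  -- `ℂ*`. A nearby `x ≠ 0`, with nonvanishing on a full neighbourhood, takes its place.
  obtain ⟨x, hx, hx0⟩ := ((eventually_eventually_nhdsWithin.2 hdet).and self_mem_nhdsWithin).exists
  have hx0' : x ≠ 0 := hx0
  rw [isOpen_compl_singleton.nhdsWithin_eq hx0] at hx
  obtain ⟨M, hM⟩ := exists_gl_merZero (fun i j x _ => hH i j x) (fun i j => hH i j 0)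
    (det_mkMat_ne_zero hx0' (nhdsWithin_le_nhds hx))
  refine ⟨C, F * M, ?_⟩
  rw [map_mul]
  refine eq_shift_mul_cst_mul_inv q hBF ?_
  rw [hM]
  refine shift_mkMat_mul_cst q _ (fun i j x _ => meromorphicAt_ratFunc_eval (B.val i j) x) C
    fun x hx => ?_
  filter_upwards [nhdsWithin_le_nhds (isOpen_ne.mem_nhds hx)] with z hz using hHB z hz

/-- Cramer's rule; at points where the determinant vanishes, the conventional value of the inverse
is harmless for meromorphy. -/
lemma meromorphicAt_matrix_inv {f : ℂ → Matrix (Fin n) (Fin n) ℂ} {x : ℂ}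
    (hf : ∀ i j, MeromorphicAt (fun z => f z i j) x) (i j : Fin n) :
    MeromorphicAt (fun z => (f z)⁻¹ i j) x := by
  have hdet : ∀ g : ℂ → Matrix (Fin n) (Fin n) ℂ, (∀ i j, MeromorphicAt (fun z => g z i j) x) →
      MeromorphicAt (fun z => (g z).det) x := fun g hg => by
    simp only [Matrix.det_apply, Units.smul_def, zsmul_eq_mul]
    exact MeromorphicAt.fun_sum fun s _ => (MeromorphicAt.const _ _).mul
      (MeromorphicAt.fun_prod fun k _ => hg _ _)
  simp only [Matrix.inv_def, Matrix.smul_apply, Matrix.adjugate_apply, Ring.inverse_eq_inv',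
    smul_eq_mul]
  refine (hdet f hf).inv.mul (hdet _ fun k l => ?_)
  simp only [Matrix.updateRow_apply]
  split_ifs
  · exact MeromorphicAt.const _ _
  · exact hf k l

/-- For `M(z) = H(1/z)` and `w = 1/(qz)`, the equation `M(qz) C⁻¹ = B(z) M(z)` reads `H(qw) C =
B(1/(qw))⁻¹ H(w)`. Inverting the system thus keeps the multiplier `q`, of modulus greater than `1`,
and the result at `0` applies. -/
theorem exists_solution_infty {q : ℂˣ} (hq : 1 < ‖(q : ℂ)‖) {X : Eqn q}
    (hX : X.IsFuchsianAtInfty) :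
    ∃ (A : GL (Fin X.dim) ℂ) (M : GL (Fin X.dim) merInfty),
      upGL ratToMer X.mat =
        shiftGL q (upGL merInfty.val M) * cst A * (upGL merInfty.val M)⁻¹ := by
  obtain ⟨B, F, ⟨B₀, hB₀⟩, hBF⟩ := hX
  have hB₀' : B₀.val.det ≠ 0 := ((Matrix.isUnit_iff_isUnit_det _).1 B₀.isUnit).ne_zero
  have hlim : Tendsto (fun w : ℂ => (ratEval B.val (q * w)⁻¹)⁻¹) (𝓝[≠] 0) (𝓝 B₀.val⁻¹) := by
    have h1 : Tendsto (fun w : ℂ => ((q : ℂ) * w)⁻¹) (𝓝[≠] 0) (Bornology.cobounded ℂ) := by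
      refine tendsto_inv₀_nhdsNE_zero.comp ?_
      refine tendsto_nhdsWithin_of_tendsto_nhds_of_eventually_within _ ?_ ?_
      · have := (continuous_const_mul (q : ℂ)).tendsto 0
        rw [mul_zero] at this
        exact this.mono_left nhdsWithin_le_nhds
      · filter_upwards [self_mem_nhdsWithin] with w hw
        exact mul_ne_zero q.ne_zero hw
    have h2 : Tendsto (ratEval B.val) (Bornology.cobounded ℂ) (𝓝 B₀.val) :=
      tendsto_pi_nhds.2 fun i => tendsto_pi_nhds.2 fun j => hB₀ i j
    have h3 : ContinuousAt (fun M : Matrix (Fin X.dim) (Fin X.dim) ℂ => M⁻¹) B₀.val := by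
      simp only [Matrix.inv_def, Ring.inverse_eq_inv']
      exact ContinuousAt.smul (ContinuousAt.inv₀ (by fun_prop) hB₀') (by fun_prop)
    exact h3.tendsto.comp (h2.comp h1)
  have hmer : ∀ i j x, MeromorphicAt (fun w : ℂ => (ratEval B.val (q * w)⁻¹)⁻¹ i j) x :=
    fun i j x => meromorphicAt_matrix_inv (fun i j =>
      (meromorphicAt_ratFunc_eval_inv (B.val i j) (q * x)).comp_analyticAt
        (g := fun w => (q : ℂ) * w) (by fun_prop)) i j
  obtain ⟨C, H, hH, hdet, hHB⟩ := exists_meromorphic_solution hq hmer (B₀ := B₀.val⁻¹)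
    (Matrix.isUnit_nonsing_inv_det _ hB₀'.isUnit).ne_zero
    fun i j => (tendsto_pi_nhds.1 (tendsto_pi_nhds.1 hlim i) j)
  obtain ⟨x, hx, hx0⟩ := ((eventually_eventually_nhdsWithin.2 hdet).and self_mem_nhdsWithin).exists
  have hx0' : x ≠ 0 := hx0
  rw [isOpen_compl_singleton.nhdsWithin_eq hx0] at hx
  have hH' : ∀ i j, ∀ x ≠ 0, MeromorphicAt (fun z => H z⁻¹ i j) x := fun i j x hx =>
    (hH i j x⁻¹).comp_analyticAt (g := fun z => z⁻¹) (analyticAt_inv hx)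
  obtain ⟨M, hM⟩ := exists_gl_merInfty hH' (fun i j => by simpa using hH i j 0)
    (det_mkMat_ne_zero (inv_ne_zero hx0') (nhdsWithin_le_nhds (by
      have h1 : Tendsto (fun z : ℂ => z⁻¹) (𝓝 x⁻¹) (𝓝 x) := by
        simpa using tendsto_inv₀ (inv_ne_zero hx0')
      exact h1.eventually hx)))
  refine ⟨C⁻¹, F * M, ?_⟩
  rw [map_mul]
  refine eq_shift_mul_cst_mul_inv q hBF ?_
  rw [hM]
  refine shift_mkMat_mul_cst q _ (fun i j x _ => meromorphicAt_ratFunc_eval (B.val i j) x) C⁻¹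
    fun x hx => ?_
  -- Points where `B(z)` is singular must be discarded: there the inverse used in the system for `H`
  -- is only a default value.
  filter_upwards [nhdsWithin_le_nhds (isOpen_ne.mem_nhds hx),
    eventually_det_ne_zero (up_ratToMer B.val).symm (G := upGL ratToMer B) hx] with z hz hzB
  change (ratEval B.val z).det ≠ 0 at hzB
  change H (q * z)⁻¹ * (C⁻¹).val = ratEval B.val z * H z⁻¹
  have hqz : (q : ℂ) * z ≠ 0 := mul_ne_zero q.ne_zero hz
  have h1 := hHB (q * z)⁻¹ (inv_ne_zero hqz)
  have h2 : (q : ℂ) * (q * z)⁻¹ = z⁻¹ := by rw [mul_inv, mul_inv_cancel_left₀ q.ne_zero]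
  rw [h2, inv_inv] at h1
  have h3 : ratEval B.val z * H z⁻¹ * C.val = H (q * z)⁻¹ := by
    rw [Matrix.mul_assoc, h1, Matrix.mul_nonsing_inv_cancel_left _ _ hzB.isUnit]
  rw [← h3, Matrix.mul_assoc, ← Units.val_mul, mul_inv_cancel, Units.val_one, Matrix.mul_one]

end Solutions

/-! ### Laurent expansions -/

section Laurent

lemma coe_toCircle_two_pi (θ : ℝ) :
    ((AddCircle.toCircle (θ : AddCircle (2 * Real.pi)) : Circle) : ℂ) =
      Complex.exp (θ * Complex.I) := by
  rw [AddCircle.toCircle_apply_mk, div_self Real.two_pi_pos.ne', one_mul, Circle.coe_exp]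

/-- In the parametrization `z = r e^{iθ}` one has `dz = i z dθ`, so `z^(-k-1) dz` becomes `i r^(-k)
e^{-ikθ} dθ`. -/
lemma circleIntegral_eq_fourierCoeff [Fact (0 < 2 * Real.pi)] (f : ℂ → ℂ) {r : ℝ} (hr : 0 < r)
    (k : ℤ) : (∮ z in C(0, r), z ^ (-k - 1) * f z) = 2 * Real.pi * Complex.I * (r : ℂ) ^ (-k) *
      fourierCoeff (fun x : AddCircle (2 * Real.pi) => f (r * (AddCircle.toCircle x : ℂ))) k := by
  have hr0 : (r : ℂ) ≠ 0 := by exact_mod_cast hr.ne'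
  have hpi : (Real.pi : ℂ) ≠ 0 := by exact_mod_cast Real.pi_ne_zero
  rw [fourierCoeff_eq_intervalIntegral _ k 0, circleIntegral, zero_add]
  have h1 : ∀ θ : ℝ, deriv (circleMap 0 r) θ • ((circleMap 0 r θ) ^ (-k - 1) * f (circleMap 0 r θ)) =
      (Complex.I * (r : ℂ) ^ (-k)) * (fourier (-k) (θ : AddCircle (2 * Real.pi)) •
        f (r * (AddCircle.toCircle (θ : AddCircle (2 * Real.pi)) : ℂ))) := fun θ => by
    have h2 : circleMap 0 r θ = r * (AddCircle.toCircle (θ : AddCircle (2 * Real.pi)) : ℂ) := by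
      rw [coe_toCircle_two_pi, circleMap, zero_add]
    have h3 : circleMap 0 r θ ≠ 0 := circleMap_ne_center hr.ne'
    rw [deriv_circleMap, smul_eq_mul, smul_eq_mul, ← h2, zpow_sub_one₀ h3, fourier_apply,
      AddCircle.toCircle_zsmul, Circle.coe_zpow]
    have h4 : (circleMap 0 r θ) ^ (-k) =
        (r : ℂ) ^ (-k) * (AddCircle.toCircle (θ : AddCircle (2 * Real.pi)) : ℂ) ^ (-k) := by
      rw [h2, mul_zpow]
    rw [h4]
    field_simp
  simp only [h1, intervalIntegral.integral_const_mul]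
  rw [Complex.real_smul]
  push_cast
  field_simp

/-- The Laurent expansion of a function that is holomorphic in an annulus. -/
theorem exists_laurent {f : ℂ → ℂ} {a b : ℝ} (ha : 0 ≤ a)
    (hf : ∀ z, a < ‖z‖ → ‖z‖ < b → DifferentiableAt ℂ f z) :
    ∃ c : ℤ → ℂ, ∀ z, a < ‖z‖ → ‖z‖ < b →
      (Summable fun k => ‖z ^ k * c k‖) ∧ HasSum (fun k => z ^ k * c k) (f z) := by
  by_cases hab : b ≤ a
  · exact ⟨0, fun z h1 h2 => absurd (h1.trans h2) (not_lt.2 hab)⟩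
  push Not at hab
  have : Fact (0 < 2 * Real.pi) := ⟨Real.two_pi_pos⟩
  let J : ℝ → ℤ → ℂ := fun r k => ∮ z in C(0, r), z ^ (-k - 1) * f z
  let g : ℝ → AddCircle (2 * Real.pi) → ℂ := fun r x => f (r * (AddCircle.toCircle x : ℂ))
  have hdiff : ∀ k : ℤ, ∀ z, a < ‖z‖ → ‖z‖ < b → DifferentiableAt ℂ (fun z => z ^ (-k - 1) * f z) z :=
    fun k z h1 h2 => (differentiableAt_zpow.2 (Or.inl (norm_pos_iff.1 (ha.trans_lt h1)))).mul
      (hf z h1 h2)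
  -- Cauchy's theorem on the closed annulus between the circles: the coefficient integrals do not
  -- depend on the radius.
  have hJle : ∀ k r R, a < r → r ≤ R → R < b → J R k = J r k := fun k r R h1 h2 h3 => by
    refine Complex.circleIntegral_eq_of_differentiable_on_annulus_off_countable (ha.trans_lt h1) h2
      Set.countable_empty (fun z hz => ?_) (fun z hz => ?_)
    · simp only [Set.mem_sdiff, Metric.mem_closedBall, dist_zero_right, Metric.mem_ball,
        not_lt] at hz
      exact (hdiff k z (h1.trans_le hz.2) (hz.1.trans_lt h3)).continuousAt.continuousWithinAt
    · simp only [Set.mem_sdiff, Metric.mem_closedBall, dist_zero_right, Metric.mem_ball,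
        not_le, Set.mem_empty_iff_false, not_false_eq_true, and_true] at hz
      exact hdiff k z (h1.trans hz.2) (hz.1.trans h3)
  have hJ : ∀ k r R, a < r → r < b → a < R → R < b → J R k = J r k := fun k r R h1 h2 h3 h4 => by
    rcases le_total r R with h | h
    · exact hJle k r R h1 h h4
    · exact (hJle k R r h3 h h2).symm
  have hbound : ∀ r, a < r → r < b → ∃ D : ℝ, ∀ k, ‖J r k‖ ≤ D * r ^ (-k) := fun r h1 h2 => by
    have hr : 0 < r := ha.trans_lt h1
    obtain ⟨D, hD⟩ := (isCompact_sphere (0 : ℂ) r).exists_bound_of_continuousOn (f := f)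
      fun z hz => by
        have hz' : ‖z‖ = r := mem_sphere_zero_iff_norm.1 hz
        exact (hf z (hz' ▸ h1) (hz' ▸ h2)).continuousAt.continuousWithinAt
    refine ⟨2 * Real.pi * D, fun k => (circleIntegral.norm_integral_le_of_norm_le_const
      (C := r ^ (-k - 1) * D) hr.le fun z hz => ?_).trans_eq ?_⟩
    · rw [norm_mul, norm_zpow, mem_sphere_zero_iff_norm.1 hz]
      exact mul_le_mul_of_nonneg_left (hD z hz) (by positivity)
    · rw [zpow_sub_one₀ hr.ne']
      field_simp
  obtain ⟨r₀, h₀, h₀'⟩ := exists_between hab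
  refine ⟨fun k => (2 * Real.pi * Complex.I)⁻¹ * J r₀ k, fun z hz hz' => ?_⟩
  set r := ‖z‖ with hrz
  have hr : 0 < r := ha.trans_lt hz
  have hr0 : (r : ℂ) ≠ 0 := by exact_mod_cast hr.ne'
  have hpi : (Real.pi : ℂ) ≠ 0 := by exact_mod_cast Real.pi_ne_zero
  have hI := Complex.I_ne_zero
  -- Radii `r₁ < |z| < r₂` give geometric bounds: the circle `r₂` for the indices `k ≥ 0`, the
  -- circle `r₁` for the indices `k ≤ 0`.
  have hsum : Summable fun k => ‖z ^ k * ((2 * Real.pi * Complex.I)⁻¹ * J r₀ k)‖ := by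
    obtain ⟨r₁, h₁, h₁'⟩ := exists_between hz
    obtain ⟨r₂, h₂, h₂'⟩ := exists_between hz'
    obtain ⟨D₁, hD₁⟩ := hbound r₁ h₁ (h₁'.trans hz')
    obtain ⟨D₂, hD₂⟩ := hbound r₂ (hz.trans h₂) h₂'
    have hr₁ : 0 < r₁ := ha.trans_lt h₁
    have hr₂ : 0 < r₂ := hr.trans h₂
    have e : ∀ k, ‖z ^ k * ((2 * Real.pi * Complex.I)⁻¹ * J r₀ k)‖ =
        ‖(2 * Real.pi * Complex.I : ℂ)⁻¹‖ * (r ^ k * ‖J r₀ k‖) := fun k => by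
      rw [norm_mul, norm_mul, norm_zpow]
      ring
    simp only [e]
    refine Summable.mul_left _ (Summable.of_nat_of_neg ?_ ?_)
    · refine Summable.of_nonneg_of_le (fun n => by positivity) (fun n => ?_)
        ((summable_geometric_of_lt_one (by positivity) ((div_lt_one hr₂).2 h₂)).mul_left D₂)
      rw [← hJ n r₀ r₂ h₀ h₀' (hz.trans h₂) h₂']
      refine (mul_le_mul_of_nonneg_left (hD₂ n) (by positivity)).trans_eq ?_
      rw [zpow_neg, zpow_natCast, zpow_natCast, div_pow]
      field_simp
    · refine Summable.of_nonneg_of_le (fun n => by positivity) (fun n => ?_)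
        ((summable_geometric_of_lt_one (by positivity) ((div_lt_one hr).2 h₁')).mul_left D₁)
      rw [← hJ (-n) r₀ r₁ h₀ h₀' h₁ (h₁'.trans hz')]
      refine (mul_le_mul_of_nonneg_left (hD₁ (-n)) (by positivity)).trans_eq ?_
      rw [neg_neg, zpow_neg, zpow_natCast, zpow_natCast, div_pow]
      field_simp
  refine ⟨hsum, ?_⟩
  have hgc : Continuous (g r) := by
    refine continuous_iff_continuousAt.2 fun x => ?_
    have hx : ‖(r : ℂ) * (AddCircle.toCircle x : ℂ)‖ = r := by
      rw [norm_mul, Circle.norm_coe, mul_one, Complex.norm_real, Real.norm_of_nonneg hr.le]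
    refine ContinuousAt.comp (g := f)
      (f := fun x : AddCircle (2 * Real.pi) => (r : ℂ) * (AddCircle.toCircle x : ℂ))
      (hf _ (hx.symm ▸ hz) (hx.symm ▸ hz')).continuousAt ?_
    exact (continuous_const.mul
      (continuous_subtype_val.comp AddCircle.continuous_toCircle)).continuousAt
  have hcoeff : ∀ k, fourierCoeff (g r) k = (2 * Real.pi * Complex.I)⁻¹ * (r : ℂ) ^ k * J r₀ k :=
    fun k => by
      rw [← hJ k r₀ r h₀ h₀' hz hz']
      change _ = _ * _ * ∮ z in C(0, r), z ^ (-k - 1) * f z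
      rw [circleIntegral_eq_fourierCoeff f hr k, zpow_neg]
      have : (r : ℂ) ^ k ≠ 0 := zpow_ne_zero _ hr0
      field_simp
      rfl
  have hfs : Summable (fourierCoeff (g r)) := by
    refine Summable.of_norm (hsum.congr fun k => ?_)
    rw [hcoeff, norm_mul, norm_mul, norm_mul, norm_mul, norm_zpow, norm_zpow, Complex.norm_real,
      Real.norm_of_nonneg hr.le]
    ring
  have hz1 : z = r * (AddCircle.toCircle (Complex.arg z : AddCircle (2 * Real.pi)) : ℂ) := by
    rw [coe_toCircle_two_pi, hrz, Complex.norm_mul_exp_arg_mul_I]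
  -- A continuous function on the circle with summable Fourier coefficients is the sum of its
  -- Fourier series at every point; on the circle through `z` this series is the Laurent series.
  have hps := has_pointwise_sum_fourier_series_of_summable (f := ⟨g r, hgc⟩) hfs
    (Complex.arg z : AddCircle (2 * Real.pi))
  have hval : (⟨g r, hgc⟩ : C(AddCircle (2 * Real.pi), ℂ)) (Complex.arg z : AddCircle (2 * Real.pi))
      = f z := by
    change f (r * (AddCircle.toCircle (Complex.arg z : AddCircle (2 * Real.pi)) : ℂ)) = f z
    rw [← hz1]
  rw [hval] at hps
  have hterm : ∀ k : ℤ, z ^ k * ((2 * Real.pi * Complex.I)⁻¹ * J r₀ k) = fourierCoeff (g r) k •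
      fourier k (Complex.arg z : AddCircle (2 * Real.pi)) := fun k => by
    rw [hcoeff, fourier_apply, AddCircle.toCircle_zsmul, Circle.coe_zpow, smul_eq_mul]
    conv_lhs => rw [hz1, mul_zpow]
    ring
  simp only [hterm]
  exact hps

end Laurent

/-! ### Convolution of absolutely summable families -/

section Convolution

variable {A : Type*} [NormedRing A]

/-- The bijection `(k, j) ↦ (j, k - j)`. -/
def convEquiv : ℤ × ℤ ≃ ℤ × ℤ where
  toFun p := (p.2, p.1 - p.2)
  invFun p := (p.1 + p.2, p.1)
  left_inv p := by simp
  right_inv p := by simp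

/-- The convolution product. -/
noncomputable def conv (x y : ℤ → A) (k : ℤ) : A := ∑' j, x j * y (k - j)

variable {x y : ℤ → A}

lemma summable_norm_mul_norm (hx : Summable fun k => ‖x k‖) (hy : Summable fun k => ‖y k‖) :
    Summable fun p : ℤ × ℤ => ‖x p.2‖ * ‖y (p.1 - p.2)‖ :=
  convEquiv.summable_iff (f := fun p : ℤ × ℤ => ‖x p.1‖ * ‖y p.2‖) |>.2
    (hx.mul_of_nonneg hy (fun _ => norm_nonneg _) fun _ => norm_nonneg _)

lemma summable_norm_conv_term (hx : Summable fun k => ‖x k‖) (hy : Summable fun k => ‖y k‖)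
    (k : ℤ) : Summable fun j => ‖x j * y (k - j)‖ :=
  Summable.of_nonneg_of_le (fun _ => norm_nonneg _) (fun _ => norm_mul_le _ _)
    ((summable_norm_mul_norm hx hy).prod_factor k)

lemma norm_conv_le (hx : Summable fun k => ‖x k‖) (hy : Summable fun k => ‖y k‖) (k : ℤ) :
    ‖conv x y k‖ ≤ ∑' j, ‖x j‖ * ‖y (k - j)‖ :=
  (norm_tsum_le_tsum_norm (summable_norm_conv_term hx hy k)).trans
    ((summable_norm_conv_term hx hy k).tsum_le_tsum (fun _ => norm_mul_le _ _)
      ((summable_norm_mul_norm hx hy).prod_factor k))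

lemma summable_norm_conv (hx : Summable fun k => ‖x k‖) (hy : Summable fun k => ‖y k‖) :
    Summable fun k => ‖conv x y k‖ :=
  Summable.of_nonneg_of_le (fun _ => norm_nonneg _) (norm_conv_le hx hy)
    (summable_norm_mul_norm hx hy).prod

/-- Submultiplicativity of the norm of the Wiener algebra `ℓ¹(ℤ, A)`, by exchanging the order of
summation. -/
lemma tsum_norm_conv_le (hx : Summable fun k => ‖x k‖) (hy : Summable fun k => ‖y k‖) :
    ∑' k, ‖conv x y k‖ ≤ (∑' k, ‖x k‖) * ∑' k, ‖y k‖ := by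
  refine ((summable_norm_conv hx hy).tsum_le_tsum (norm_conv_le hx hy)
    (summable_norm_mul_norm hx hy).prod).trans_eq ?_
  rw [hx.tsum_mul_tsum hy (hx.mul_of_nonneg hy (fun _ => norm_nonneg _) fun _ => norm_nonneg _),
    ← (summable_norm_mul_norm hx hy).tsum_prod]
  exact convEquiv.tsum_eq (fun p : ℤ × ℤ => ‖x p.1‖ * ‖y p.2‖)

/-- Evaluation of Laurent series at `1` is multiplicative; `conv_zpow_smul` transfers this to any `z
≠ 0`. -/
lemma tsum_conv [CompleteSpace A] (hx : Summable fun k => ‖x k‖) (hy : Summable fun k => ‖y k‖) :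
    ∑' k, conv x y k = (∑' k, x k) * ∑' k, y k := by
  have h : Summable fun p : ℤ × ℤ => x p.2 * y (p.1 - p.2) :=
    Summable.of_norm (Summable.of_nonneg_of_le (fun _ => norm_nonneg _) (fun _ => norm_mul_le _ _)
      (summable_norm_mul_norm hx hy))
  rw [tsum_mul_tsum_of_summable_norm hx hy]
  refine (h.tsum_prod).symm.trans ?_
  exact convEquiv.tsum_eq (fun p : ℤ × ℤ => x p.1 * y p.2)

lemma conv_sub_left [CompleteSpace A] {x' : ℤ → A} (hx : Summable fun k => ‖x k‖)
    (hx' : Summable fun k => ‖x' k‖) (hy : Summable fun k => ‖y k‖) (k : ℤ) :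
    conv (fun j => x j - x' j) y k = conv x y k - conv x' y k := by
  rw [conv, conv, conv, ← (summable_norm_conv_term hx hy k).of_norm.tsum_sub
    (summable_norm_conv_term hx' hy k).of_norm]
  exact tsum_congr fun j => sub_mul _ _ _

/-- Weighting by `z^k` respects convolution because exponents add. -/
lemma conv_zpow_smul [NormedAlgebra ℂ A] {z : ℂ} (hz : z ≠ 0) (k : ℤ) :
    conv (fun j => z ^ j • x j) (fun j => z ^ j • y j) k = z ^ k • conv x y k := by
  rw [conv, conv, ← tsum_const_smul'' (z ^ k)]
  refine tsum_congr fun j => ?_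
  rw [smul_mul_smul_comm, ← zpow_add₀ hz, add_sub_cancel]

end Convolution

/-! ### Factorization of a family close to the identity -/

section Factorization

variable {A : Type*} [NormedRing A]

/-- Absolutely summable families are placed in `ℓ¹(ℤ, A)`, whose completeness supplies the fixed
point in `exists_neg_factor`. -/
lemma lp_one_norm (v : lp (fun _ : ℤ => A) 1) : ‖v‖ = ∑' k, ‖v k‖ := by
  simpa using lp.norm_eq_tsum_rpow (p := 1) (by simp) v

lemma lp_one_summable (v : lp (fun _ : ℤ => A) 1) : Summable fun k => ‖v k‖ := by
  simpa using (memℓp_gen_iff (p := 1) (by simp)).1 (lp.memℓp v)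

lemma memℓp_one {v : ℤ → A} (hv : Summable fun k => ‖v k‖) : Memℓp v 1 :=
  memℓp_gen (by simpa using hv)

/-- The restriction to negative indices. -/
def negPart (x : ℤ → A) (k : ℤ) : A := if k < 0 then x k else 0

lemma norm_negPart_le (x : ℤ → A) (k : ℤ) : ‖negPart x k‖ ≤ ‖x k‖ := by
  unfold negPart
  split_ifs <;> simp

lemma summable_norm_negPart {x : ℤ → A} (hx : Summable fun k => ‖x k‖) :
    Summable fun k => ‖negPart x k‖ :=
  Summable.of_nonneg_of_le (fun _ => norm_nonneg _) (norm_negPart_le x) hx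

/-- If `x` is small, there is a family `u` with negative indices such that `(1 + u) (1 + x)` has
no negative indices. -/
lemma exists_neg_factor [CompleteSpace A] {x : ℤ → A} (hx : Summable fun k => ‖x k‖) (hx' : ∑' k, ‖x k‖ < 1 / 2) :
    ∃ u : ℤ → A, (∀ k, 0 ≤ k → u k = 0) ∧ (Summable fun k => ‖u k‖) ∧ ∑' k, ‖u k‖ < 1 ∧
      ∀ k < 0, u k + x k + conv u x k = 0 := by
  set ε := ∑' k, ‖x k‖ with hε
  have hε0 : 0 ≤ ε := tsum_nonneg fun _ => norm_nonneg _
  have hs : ∀ v : lp (fun _ : ℤ => A) 1, Summable fun k => ‖negPart (fun k => - x k - conv v x k) k‖ :=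
    fun v => summable_norm_negPart (Summable.of_nonneg_of_le (fun _ => norm_nonneg _)
      (fun k => norm_sub_le _ _) (by
        simpa only [norm_neg] using hx.add (summable_norm_conv (lp_one_summable v) hx)))
  -- The wanted `u` is a fixed point of `v ↦ -(x + v ∗ x)` truncated to negative indices, a map with
  -- Lipschitz constant `∑ ‖x k‖`.
  let T : lp (fun _ : ℤ => A) 1 → lp (fun _ : ℤ => A) 1 := fun v => ⟨_, memℓp_one (hs v)⟩
  have hT : ∀ v k, T v k = negPart (fun k => - x k - conv v x k) k := fun _ _ => rfl
  have hlip : LipschitzWith ε.toNNReal T := by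
    refine LipschitzWith.of_dist_le_mul fun v w => ?_
    rw [Real.coe_toNNReal _ hε0, dist_eq_norm, dist_eq_norm, lp_one_norm, lp_one_norm, mul_comm]
    have hvw := lp_one_summable (v - w)
    refine le_trans (Summable.tsum_le_tsum (fun k => ?_) (lp_one_summable _)
      (summable_norm_conv hvw hx)) (tsum_norm_conv_le hvw hx)
    have h1 : conv (v - w : lp (fun _ : ℤ => A) 1) x k = conv v x k - conv w x k :=
      conv_sub_left (lp_one_summable v) (lp_one_summable w) hx k
    rw [h1, lp.coeFn_sub, Pi.sub_apply, hT, hT, negPart, negPart]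
    split_ifs
    · rw [← norm_neg]
      exact le_of_eq (congrArg _ (by abel))
    · simp
  have hc : ContractingWith ε.toNNReal T :=
    ⟨NNReal.coe_lt_coe.1 (by rw [Real.coe_toNNReal _ hε0, NNReal.coe_one]; linarith), hlip⟩
  set u := hc.fixedPoint with hu
  have hTu : T u = u := hc.fixedPoint_isFixedPt
  have huk : ∀ k, u k = negPart (fun k => - x k - conv u x k) k := fun k => by
    rw [← hT, hTu]
  have hus := lp_one_summable u
  refine ⟨u, fun k hk => by rw [huk, negPart, if_neg (not_lt.2 hk)], hus, ?_, fun k hk => ?_⟩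
  -- The fixed point equation gives `‖u‖ ≤ ε + ε ‖u‖`; with `ε < 1/2` this forces `‖u‖ < 1`, so that
  -- `1 + u` will be invertible.
  · have h1 : ∑' k, ‖u k‖ ≤ ε + (∑' k, ‖u k‖) * ε := by
      refine le_trans (hus.tsum_le_tsum (fun k => ?_) (hx.add (summable_norm_conv hus hx))) ?_
      · rw [huk k]
        refine (norm_negPart_le _ _).trans ((norm_sub_le _ _).trans_eq ?_)
        rw [norm_neg]
      · rw [hx.tsum_add (summable_norm_conv hus hx)]
        gcongr
        exact tsum_norm_conv_le hus hx
    have h2 : 0 ≤ ∑' k, ‖u k‖ := tsum_nonneg fun _ => norm_nonneg _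
    nlinarith
  · have h := huk k
    rw [negPart, if_pos hk] at h
    rw [h]
    abel

end Factorization

section Factorization

variable {A : Type*} [NormedRing A] [NormedAlgebra ℂ A] [CompleteSpace A]

/-- Factorization of `1 + ∑ z^k x_k` on an annulus, for small `x`. -/
theorem exists_factor_near_one {x : ℤ → A} (hx : Summable fun k => ‖x k‖)
    (hx' : ∑' k, ‖x k‖ < 1 / 2) {s : ℝ} (hs : 1 < s)
    (hxs : Summable fun k => ‖(s : ℂ) ^ k • x k‖) :
    ∃ V U : ℂ → A, (∀ w, ‖w‖ < 1 → AnalyticAt ℂ V w) ∧ (∀ z, ‖z‖ < s → AnalyticAt ℂ U z) ∧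
      (∀ w, ‖w‖ ≤ 1 → IsUnit (V w)) ∧
      ∀ z : ℂ, 1 ≤ ‖z‖ → ‖z‖ ≤ s → (Summable fun k => ‖z ^ k • x k‖) ∧
        V z⁻¹ * (1 + ∑' k : ℤ, z ^ k • x k) = U z := by
  obtain ⟨u, hu0, hus, hu1, hu⟩ := exists_neg_factor hx hx'
  -- absolute convergence
  have hxz : ∀ z : ℂ, 1 ≤ ‖z‖ → ‖z‖ ≤ s → Summable fun k => ‖z ^ k • x k‖ := fun z h1 h2 => by
    refine Summable.of_nonneg_of_le (fun _ => norm_nonneg _) (fun k => ?_) (hx.add hxs)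
    rw [norm_smul, norm_smul, norm_zpow, norm_zpow, Complex.norm_real,
      Real.norm_of_nonneg (by linarith)]
    rcases le_total 0 k with hk | hk
    · have : ‖z‖ ^ k ≤ s ^ k := zpow_le_zpow_left₀ hk (norm_nonneg z) h2
      nlinarith [norm_nonneg (x k)]
    · have h3 : ‖z‖ ^ k ≤ 1 := zpow_le_one_of_nonpos₀ h1 hk
      have h4 : 0 ≤ s ^ k := zpow_nonneg (by linarith) k
      nlinarith [norm_nonneg (x k), mul_nonneg h4 (norm_nonneg (x k))]
  have hule : ∀ z : ℂ, 1 ≤ ‖z‖ → ∀ k, ‖z ^ k • u k‖ ≤ ‖u k‖ := fun z h1 k => by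
    rcases le_or_gt 0 k with hk | hk
    · simp [hu0 k hk]
    · rw [norm_smul, norm_zpow]
      exact mul_le_of_le_one_left (norm_nonneg _) (zpow_le_one_of_nonpos₀ h1 hk.le)
  have huz : ∀ z : ℂ, 1 ≤ ‖z‖ → Summable fun k => ‖z ^ k • u k‖ := fun z h1 =>
    Summable.of_nonneg_of_le (fun _ => norm_nonneg _) (hule z h1) hus
  -- the coefficients of the product
  let e : ℤ → A := fun k => if k = 0 then 1 else 0
  -- The Laurent coefficients of `(1 + u)(1 + x)`; by the choice of `u`, those of negative index
  -- vanish.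
  let d : ℤ → A := fun k => e k + u k + x k + conv u x k
  have hd0 : ∀ k < 0, d k = 0 := fun k hk => by
    have h1 : e k = 0 := if_neg hk.ne
    simp only [d, h1, zero_add]
    exact hu k hk
  have he : ∀ z : ℂ, HasSum (fun k : ℤ => z ^ k • e k) 1 := fun z => by
    convert hasSum_single (f := fun k : ℤ => z ^ k • e k) 0 fun k hk => by simp [e, hk]
    simp [e]
  have hen : ∀ z : ℂ, Summable fun k : ℤ => ‖z ^ k • e k‖ := fun z =>
    (hasSum_single (f := fun k : ℤ => ‖z ^ k • e k‖) 0 fun k hk => by simp [e, hk]).summable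
  have hcz : ∀ z : ℂ, 1 ≤ ‖z‖ → ‖z‖ ≤ s → Summable fun k => ‖z ^ k • conv u x k‖ :=
    fun z h1 h2 => by
      have hz0 : z ≠ 0 := norm_pos_iff.1 (by linarith)
      simpa only [conv_zpow_smul hz0] using summable_norm_conv (huz z h1) (hxz z h1 h2)
  have hdz : ∀ z : ℂ, 1 ≤ ‖z‖ → ‖z‖ ≤ s → Summable fun k => ‖z ^ k • d k‖ := fun z h1 h2 => by
    refine Summable.of_nonneg_of_le (fun _ => norm_nonneg _) (fun k => ?_)
      ((((hen z).add (huz z h1)).add (hxz z h1 h2)).add (hcz z h1 h2))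
    simp only [d, smul_add]
    exact norm_add₄_le
  have hprod : ∀ z : ℂ, 1 ≤ ‖z‖ → ‖z‖ ≤ s →
      (1 + ∑' k : ℤ, z ^ k • u k) * (1 + ∑' k : ℤ, z ^ k • x k) = ∑' k : ℤ, z ^ k • d k := by
    intro z h1 h2
    have hz0 : z ≠ 0 := norm_pos_iff.1 (by linarith)
    have h3 := tsum_conv (huz z h1) (hxz z h1 h2)
    simp only [conv_zpow_smul hz0] at h3
    simp only [d, smul_add]
    rw [((((hen z).of_norm.add (huz z h1).of_norm).add (hxz z h1 h2).of_norm).tsum_add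
      (hcz z h1 h2).of_norm), (((hen z).of_norm.add (huz z h1).of_norm).tsum_add
      (hxz z h1 h2).of_norm), ((hen z).of_norm.tsum_add (huz z h1).of_norm), h3, (he z).tsum_eq]
    noncomm_ring
  -- the two factors as power series
  have hneg : ∀ z : ℂ, ∑' k : ℤ, z ^ k • u k = ∑' n : ℕ, z⁻¹ ^ n • u (-n) := fun z => by
    refine ((Function.Injective.tsum_eq (g := fun n : ℕ => -(n : ℤ)) (fun a b h => by simpa using h)
      (f := fun k : ℤ => z ^ k • u k) fun k hk => ?_).symm).trans ?_
    · rw [Function.mem_support] at hk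
      have hk' : ¬ 0 ≤ k := fun h => hk (by simp [hu0 k h])
      exact ⟨k.natAbs, by simp only; omega⟩
    · simp
  have hpos : ∀ z : ℂ, ∑' k : ℤ, z ^ k • d k = ∑' n : ℕ, z ^ n • d n := fun z => by
    refine ((Function.Injective.tsum_eq (g := fun n : ℕ => (n : ℤ)) (fun a b h => by simpa using h)
      (f := fun k : ℤ => z ^ k • d k) fun k hk => ?_).symm).trans ?_
    · rw [Function.mem_support] at hk
      have hk' : ¬ k < 0 := fun h => hk (by simp [hd0 k h])
      exact ⟨k.natAbs, by simp only; omega⟩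
    · simp
  have hu1' : Summable fun n : ℕ => ‖u (-n)‖ * (1 : ℝ) ^ n := by
    simp only [one_pow, mul_one]
    exact hus.comp_injective (i := fun n : ℕ => -(n : ℤ)) fun a b h => by simpa using h
  have hs0 : (0 : ℝ) ≤ s := by linarith
  have hds : Summable fun n : ℕ => ‖d n‖ * s ^ n := by
    have hsn : ‖(s : ℂ)‖ = s := by rw [Complex.norm_real, Real.norm_of_nonneg hs0]
    refine ((hdz s (by rw [hsn]; exact hs.le) hsn.le).comp_injective
      (i := fun n : ℕ => (n : ℤ)) fun a b h => by simpa using h).congr fun n => ?_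
    simp only [Function.comp_apply, norm_smul, zpow_natCast, norm_pow, hsn]
    ring
  refine ⟨fun w => 1 + ∑' n : ℕ, w ^ n • u (-n), fun z => ∑' n : ℕ, z ^ n • d n,
    fun w hw => analyticAt_const.add (analyticAt_tsum_pow_smul hu1' hw),
    fun z hz => analyticAt_tsum_pow_smul hds hz, fun w hw => ?_,
    fun z h1 h2 => ⟨hxz z h1 h2, ?_⟩⟩
  -- Neumann series: on the closed unit disc the sum is bounded by `∑ ‖u k‖ < 1`.
  · have h1 : ‖-∑' n : ℕ, w ^ n • u (-n)‖ < 1 := by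
      rw [norm_neg]
      have h2 : ∀ n : ℕ, ‖w ^ n • u (-n)‖ ≤ ‖u (-n)‖ := fun n => by
        rw [norm_smul, norm_pow]
        exact mul_le_of_le_one_left (norm_nonneg _) (pow_le_one₀ (norm_nonneg _) hw)
      simp only [one_pow, mul_one] at hu1'
      refine (tsum_of_norm_bounded hu1'.hasSum h2).trans_lt (lt_of_le_of_lt ?_ hu1)
      have hinj : Function.Injective fun n : ℕ => -(n : ℤ) := fun a b h => by simpa using h
      exact Summable.tsum_le_tsum_of_inj _ hinj (fun _ _ => norm_nonneg _) (fun _ => le_rfl)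
        hu1' hus
    have h2 := isUnit_one_sub_of_norm_lt_one h1
    rwa [sub_neg_eq_add] at h2
  · change (1 + ∑' n : ℕ, z⁻¹ ^ n • u (-n)) * _ = _
    rw [← hneg, hprod z h1 h2, hpos]

/-- Factorization of an invertible function on an annulus, given by Laurent series. -/
theorem exists_factor_of_laurent {M M' : ℂ → A} {a s b : ℝ} (ha1 : a < 1) (hs : 1 < s)
    (hsb : s < b) {c d : ℤ → A}
    (hd : ∀ z, a < ‖z‖ → ‖z‖ < b → (Summable fun k => ‖z ^ k • d k‖) ∧ ∑' k, z ^ k • d k = M z)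
    (hc : ∀ z, a < ‖z‖ → ‖z‖ < b → (Summable fun k => ‖z ^ k • c k‖) ∧ ∑' k, z ^ k • c k = M' z)
    (hMM' : ∀ z, a < ‖z‖ → ‖z‖ < b → M' z * M z = 1) :
    ∃ (V U : ℂ → A) (S : Finset ℤ),
      (∀ w, ‖w‖ < 1 → AnalyticAt ℂ V w) ∧ (∀ z, ‖z‖ < s → AnalyticAt ℂ U z) ∧ IsUnit (U 1) ∧
      ∀ z : ℂ, 1 ≤ ‖z‖ → ‖z‖ ≤ s → V z⁻¹ * (∑ k ∈ S, z ^ k • c k) * M z = U z := by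
  have hone : ∀ {y : ℤ → A}, (Summable fun k => ‖(1 : ℂ) ^ k • y k‖) →
      Summable fun k => ‖y k‖ := fun h => by simpa using h
  have hd1 := hone (hd 1 (by simpa) (by simp; linarith)).1
  have hc1 := hone (hc 1 (by simpa) (by simp; linarith)).1
  set D := ∑' k, ‖d k‖ with hD
  have hD0 : 0 ≤ D := tsum_nonneg fun _ => norm_nonneg _
  -- The truncation `P` of `M'` to `S` satisfies `P M = 1 + t M`, where `t` is minus the discarded
  -- tail. The bound `1/(2(D + 1))` on the tail makes the norm of `t ∗ d` less than `1/2`.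
  obtain ⟨S, hS⟩ : ∃ S : Finset ℤ, ∑' k, ‖if k ∈ S then 0 else - c k‖ < (2 * (D + 1))⁻¹ := by
    have h1 := (tendsto_order.1 (tendsto_tsum_compl_atTop_zero fun k => ‖c k‖)).2
      (2 * (D + 1))⁻¹ (by positivity)
    obtain ⟨S, hS⟩ := h1.exists
    refine ⟨S, lt_of_eq_of_lt ?_ hS⟩
    rw [← tsum_subtype_eq_of_support_subset (s := {k | k ∉ S}) (fun k hk => ?_)]
    · refine tsum_congr fun k => ?_
      rw [if_neg k.2, norm_neg]
    · intro hk'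
      simp [hk'] at hk
  let t : ℤ → A := fun k => if k ∈ S then 0 else - c k
  have htle : ∀ (z : ℂ) k, ‖z ^ k • t k‖ ≤ ‖z ^ k • c k‖ := fun z k => by
    simp only [t]
    split_ifs <;> simp
  have htz : ∀ z, a < ‖z‖ → ‖z‖ < b → Summable fun k => ‖z ^ k • t k‖ := fun z h1 h2 =>
    Summable.of_nonneg_of_le (fun _ => norm_nonneg _) (htle z) (hc z h1 h2).1
  have ht1 := hone (htz 1 (by simpa) (by simp; linarith))
  let x := conv t d
  have hx : Summable fun k => ‖x k‖ := summable_norm_conv ht1 hd1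
  have hxz : ∀ z : ℂ, 1 ≤ ‖z‖ → ‖z‖ ≤ s → (Summable fun k => ‖z ^ k • x k‖) ∧
      1 + ∑' k, z ^ k • x k = (∑ k ∈ S, z ^ k • c k) * M z := fun z h1 h2 => by
    have hz0 : z ≠ 0 := norm_pos_iff.1 (by linarith)
    have hza : a < ‖z‖ := by linarith
    have hzb : ‖z‖ < b := by linarith
    have h3 := summable_norm_conv (htz z hza hzb) (hd z hza hzb).1
    have h4 := tsum_conv (htz z hza hzb) (hd z hza hzb).1
    simp only [conv_zpow_smul hz0] at h3 h4
    refine ⟨h3, ?_⟩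
    have h5 : ∑' k, z ^ k • t k = (∑ k ∈ S, z ^ k • c k) - M' z := by
      have h6 : ∑' k : ℤ, (if k ∈ S then z ^ k • c k else 0) = ∑ k ∈ S, z ^ k • c k := by
        rw [tsum_eq_sum (s := S) fun k hk => if_neg hk]
        exact Finset.sum_congr rfl fun k hk => if_pos hk
      rw [← h6, ← (hc z hza hzb).2, ← Summable.tsum_sub
        (summable_of_ne_finset_zero (s := S) fun k hk => if_neg hk) (hc z hza hzb).1.of_norm]
      refine tsum_congr fun k => ?_
      simp only [t]
      split_ifs <;> simp
    change 1 + ∑' k, z ^ k • conv t d k = _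
    rw [h4, h5, (hd z hza hzb).2, sub_mul, hMM' z hza hzb]
    abel
  have hx' : ∑' k, ‖x k‖ < 1 / 2 := by
    refine (tsum_norm_conv_le ht1 hd1).trans_lt ?_
    rw [← hD]
    have h1 : (∑' k, ‖t k‖) * D ≤ (2 * (D + 1))⁻¹ * D := mul_le_mul_of_nonneg_right hS.le hD0
    refine h1.trans_lt ?_
    rw [inv_mul_lt_iff₀ (by positivity)]
    linarith
  have hsn : ‖(s : ℂ)‖ = s := by rw [Complex.norm_real, Real.norm_of_nonneg (by linarith)]
  obtain ⟨V, U, hV, hU, hVu, hVU⟩ := exists_factor_near_one hx hx' hs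
    (hxz s (by rw [hsn]; exact hs.le) hsn.le).1
  refine ⟨V, U, S, hV, hU, ?_, fun z h1 h2 => ?_⟩
  -- `U(1) = V(1) (1 + ∑ x_k)` is a product of two units, both by Neumann series.
  · rw [← (hVU 1 (by simp) (by simpa using hs.le)).2]
    refine (hVu _ (by simp)).mul ?_
    have h1 : ‖-∑' k : ℤ, (1 : ℂ) ^ k • x k‖ < 1 := by
      rw [norm_neg]
      simp only [one_zpow, one_smul]
      exact (norm_tsum_le_tsum_norm hx).trans_lt (by linarith)
    have h2 := isUnit_one_sub_of_norm_lt_one h1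
    rwa [sub_neg_eq_add] at h2
  · rw [mul_assoc, ← (hxz z h1 h2).2, (hVU z h1 h2).2]

end Factorization

/-! ### Birkhoff factorization on an annulus -/

section Annulus

attribute [local instance] Matrix.linftyOpNormedRing Matrix.linftyOpNormedAlgebra

variable {n : ℕ}

/-- The Laurent expansion of a matrix that is holomorphic in an annulus. -/
lemma exists_laurent_matrix {F : ℂ → Matrix (Fin n) (Fin n) ℂ} {a b : ℝ} (ha : 0 ≤ a)
    (hF : ∀ i j z, a < ‖z‖ → ‖z‖ < b → DifferentiableAt ℂ (fun z => F z i j) z) :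
    ∃ c : ℤ → Matrix (Fin n) (Fin n) ℂ, ∀ z, a < ‖z‖ → ‖z‖ < b →
      (Summable fun k => ‖z ^ k • c k‖) ∧ ∑' k, z ^ k • c k = F z := by
  have h := fun i j => exists_laurent ha (hF i j)
  choose c hc using h
  refine ⟨fun k => Matrix.of fun i j => c i j k, fun z h1 h2 => ?_⟩
  have hs : HasSum (fun k : ℤ => z ^ k • (Matrix.of fun i j => c i j k)) (F z) :=
    Pi.hasSum.2 fun i => Pi.hasSum.2 fun j => (hc i j z h1 h2).2
  exact ⟨summable_norm_iff.2 hs.summable, hs.tsum_eq⟩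

theorem exists_factor_annulus {M M' : ℂ → Matrix (Fin n) (Fin n) ℂ} {a s b : ℝ} (ha : 0 ≤ a)
    (ha1 : a < 1) (hs : 1 < s) (hsb : s < b)
    (hM : ∀ i j z, a < ‖z‖ → ‖z‖ < b → DifferentiableAt ℂ (fun z => M z i j) z)
    (hM' : ∀ i j z, a < ‖z‖ → ‖z‖ < b → DifferentiableAt ℂ (fun z => M' z i j) z)
    (hMM' : ∀ z, a < ‖z‖ → ‖z‖ < b → M z * M' z = 1) :
    ∃ (V U : ℂ → Matrix (Fin n) (Fin n) ℂ) (S : Finset ℤ) (c : ℤ → Matrix (Fin n) (Fin n) ℂ),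
      (∀ i j w, ‖w‖ < 1 → AnalyticAt ℂ (fun z => V z i j) w) ∧
      (∀ i j z, ‖z‖ < s → AnalyticAt ℂ (fun z => U z i j) z) ∧ IsUnit (U 1) ∧
      ∀ z : ℂ, 1 ≤ ‖z‖ → ‖z‖ ≤ s → V z⁻¹ * (∑ k ∈ S, z ^ k • c k) * M z = U z := by
  obtain ⟨d, hd⟩ := exists_laurent_matrix ha hM
  obtain ⟨c, hc⟩ := exists_laurent_matrix ha hM'
  obtain ⟨V, U, S, hV, hU, h⟩ := exists_factor_of_laurent ha1 hs hsb hd hc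
    fun z h1 h2 => mul_eq_one_comm.1 (hMM' z h1 h2)
  exact ⟨V, U, S, c, fun i j w hw => analyticAt_matrix_iff.1 (hV w hw) i j,
    fun i j z hz => analyticAt_matrix_iff.1 (hU z hz) i j, h⟩

end Annulus

/-! ### Birkhoff factorization over `ℂ*` -/

section Birkhoff

variable {n : ℕ}

/-- A property that holds outside a closed discrete subset of `ℂ*` holds in some annulus. -/
lemma exists_annulus {P : ℂ → Prop} (h : ∀ x : ℂ, x ≠ 0 → ∀ᶠ z in 𝓝[≠] x, P z) :
    ∃ a ρ b : ℝ, 0 < a ∧ a < ρ ∧ ρ < b ∧ ∀ z : ℂ, a < ‖z‖ → ‖z‖ < b → P z := by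
  have hK : IsCompact (Metric.closedBall (0 : ℂ) 2 \ Metric.ball 0 1) :=
    (isCompact_closedBall 0 2).diff Metric.isOpen_ball
  have h' : ∀ x ∈ Metric.closedBall (0 : ℂ) 2 \ Metric.ball 0 1, {z | z ≠ x → P z} ∈ 𝓝 x := by
    intro x hx
    have hx0 : x ≠ 0 := by
      rintro rfl
      simp at hx
    exact eventually_nhdsWithin_iff.1 (h x hx0)
  obtain ⟨T, -, hT⟩ := hK.elim_nhds_subcover _ h'
  -- By compactness only finitely many points of `1 ≤ |z| ≤ 2` need be avoided. A radius `ρ`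
  -- different from their moduli has a whole interval of such radii around it.
  let R : Finset ℝ := T.image fun x => ‖x‖
  have hinf : (Set.Ioo (1 : ℝ) 2 \ R).Nonempty :=
    ((Set.Ioo_infinite (by norm_num)).sdiff R.finite_toSet).nonempty
  obtain ⟨ρ, ⟨hρ1, hρ2⟩, hρR⟩ := hinf
  have hopen : (Set.Ioo (1 : ℝ) 2 \ R) ∈ 𝓝 ρ :=
    (isOpen_Ioo.sdiff R.finite_toSet.isClosed).mem_nhds ⟨⟨hρ1, hρ2⟩, hρR⟩
  obtain ⟨ε, hε, hεR⟩ := Metric.mem_nhds_iff.1 hopen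
  refine ⟨max 1 (ρ - ε), ρ, ρ + ε, by positivity, max_lt hρ1 (by linarith), by linarith,
    fun z h1 h2 => ?_⟩
  have hz : ‖z‖ ∈ Set.Ioo (1 : ℝ) 2 \ R := hεR (by
    rw [Metric.mem_ball, Real.dist_eq, abs_lt]
    constructor <;> linarith [(max_lt_iff.1 h1).2])
  have hzK : z ∈ Metric.closedBall (0 : ℂ) 2 \ Metric.ball 0 1 := by
    simp only [Set.mem_sdiff, Metric.mem_closedBall, dist_zero_right, Metric.mem_ball, not_lt]
    exact ⟨hz.1.2.le, hz.1.1.le⟩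
  obtain ⟨x, hxT, hzx⟩ := Set.mem_iUnion₂.1 (hT hzK)
  refine hzx fun hzx' => hz.2 ?_
  rw [hzx']
  exact Finset.mem_coe.2 (Finset.mem_image_of_mem _ hxT)

lemma meromorphicAt_mul_apply {F G : ℂ → Matrix (Fin n) (Fin n) ℂ} {x : ℂ}
    (hF : ∀ i j, MeromorphicAt (fun z => F z i j) x)
    (hG : ∀ i j, MeromorphicAt (fun z => G z i j) x) (i j : Fin n) :
    MeromorphicAt (fun z => (F z * G z) i j) x := by
  simp only [Matrix.mul_apply]
  exact MeromorphicAt.fun_sum fun k _ => (hF i k).mul (hG k j)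

lemma meromorphicAt_laurentPolynomial (S : Finset ℤ) (c : ℤ → Matrix (Fin n) (Fin n) ℂ) {f : ℂ → ℂ}
    {x : ℂ} (hf : MeromorphicAt f x) (i j : Fin n) :
    MeromorphicAt (fun z => (∑ k ∈ S, f z ^ k • c k) i j) x := by
  simp only [Matrix.sum_apply, Matrix.smul_apply, smul_eq_mul]
  exact MeromorphicAt.fun_sum fun k _ => (hf.zpow k).mul (MeromorphicAt.const _ _)

/-- Birkhoff factorization of a matrix that is regular in an annulus containing the unit circle. -/
theorem exists_birkhoff_of_annulus {m m' : Matrix (Fin n) (Fin n) merFun} {G : GL (Fin n) MerStar}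
    (hm : mkMat m = G.val) (hm' : mkMat m' = (G⁻¹).val) {a b : ℝ} (ha : 0 ≤ a) (ha1 : a < 1)
    (hb : 1 < b)
    (han : ∀ i j z, a < ‖z‖ → ‖z‖ < b → DifferentiableAt ℂ (fun z => evalMat z m i j) z)
    (han' : ∀ i j z, a < ‖z‖ → ‖z‖ < b → DifferentiableAt ℂ (fun z => evalMat z m' i j) z)
    (hone : ∀ z, a < ‖z‖ → ‖z‖ < b → evalMat z m * evalMat z m' = 1) :
    ∃ (M₀ : GL (Fin n) merZero) (M₁ : GL (Fin n) merInfty),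
      G = (upGL merInfty.val M₁)⁻¹ * upGL merZero.val M₀ := by
  obtain ⟨s, hs, hsb⟩ := exists_between hb
  obtain ⟨t, ht, hts⟩ := exists_between hs
  obtain ⟨V, U, S, c, hV, hU, hU1, hVU⟩ := exists_factor_annulus ha ha1 hs hsb han han' hone
  -- The relation `W M = U` on `1 ≤ |z| ≤ s` glues `U` to `W M`, and `U M⁻¹` to `W`. The cut at `t`,
  -- strictly between `1` and `s`, leaves overlaps on both sides. At infinity `W` is meromorphic
  -- because `V` is holomorphic at `0`.
  let W : ℂ → Matrix (Fin n) (Fin n) ℂ := fun z => V z⁻¹ * ∑ k ∈ S, z ^ k • c k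
  let H₀ : ℂ → Matrix (Fin n) (Fin n) ℂ := fun z => if ‖z‖ ≤ t then U z else W z * evalMat z m
  let H₁ : ℂ → Matrix (Fin n) (Fin n) ℂ := fun z => if ‖z‖ ≤ t then U z * evalMat z m' else W z
  have hH₀U : ∀ z, ‖z‖ < s → H₀ z = U z := fun z hz => by
    rcases le_or_gt ‖z‖ t with h | h
    · exact if_pos h
    · exact (if_neg h.not_ge).trans (hVU z (by linarith) hz.le)
  have hH₀W : ∀ z, t < ‖z‖ → H₀ z = W z * evalMat z m := fun z hz => if_neg hz.not_ge
  have hH₁U : ∀ z, ‖z‖ < t → H₁ z = U z * evalMat z m' := fun z hz => if_pos hz.le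
  have hH₁W : ∀ z, 1 < ‖z‖ → H₁ z = W z := fun z hz => by
    rcases le_or_gt ‖z‖ t with h | h
    · refine (if_pos h).trans ?_
      rw [← hVU z hz.le (by linarith), Matrix.mul_assoc, hone z (by linarith) (by linarith),
        Matrix.mul_one]
    · exact if_neg h.not_ge
  have hmer : ∀ (M : Matrix (Fin n) (Fin n) merFun) (x : ℂ), x ≠ 0 → ∀ i j,
      MeromorphicAt (fun z => evalMat z M i j) x := fun M x hx i j => (M i j).2 x hx
  have hWmer : ∀ x, 1 < ‖x‖ → ∀ i j, MeromorphicAt (fun z => W z i j) x := fun x hx => by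
    have hx0 : x ≠ 0 := norm_pos_iff.1 (by linarith)
    refine meromorphicAt_mul_apply (fun i j => ?_) (meromorphicAt_laurentPolynomial S c
      (MeromorphicAt.id x))
    have h1 : ‖x⁻¹‖ < 1 := by
      rw [norm_inv]
      exact inv_lt_one_of_one_lt₀ hx
    exact (hV i j x⁻¹ h1).meromorphicAt.comp_analyticAt (g := fun z => z⁻¹) (analyticAt_inv hx0)
  have hlt : ∀ {x : ℂ} {r : ℝ}, ‖x‖ < r → ∀ᶠ z in 𝓝[≠] x, ‖z‖ < r := fun h =>
    nhdsWithin_le_nhds (continuous_norm.continuousAt.eventually_lt_const h)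
  have hgt : ∀ {x : ℂ} {r : ℝ}, r < ‖x‖ → ∀ᶠ z in 𝓝[≠] x, r < ‖z‖ := fun h =>
    nhdsWithin_le_nhds (continuous_norm.continuousAt.eventually_const_lt h)
  have hH₀mer : ∀ i j x, MeromorphicAt (fun z => H₀ z i j) x := fun i j x => by
    rcases lt_or_ge ‖x‖ s with h | h
    · refine (hU i j x h).meromorphicAt.congr ?_
      filter_upwards [hlt h] with z hz
      rw [hH₀U z hz]
    · have hx : t < ‖x‖ := by linarith
      refine (meromorphicAt_mul_apply (hWmer x (by linarith))
        (hmer m x (norm_pos_iff.1 (by linarith))) i j).congr ?_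
      filter_upwards [hgt hx] with z hz
      rw [hH₀W z hz]
  have hH₁mer : ∀ i j, ∀ x ≠ 0, MeromorphicAt (fun z => H₁ z i j) x := fun i j x hx => by
    rcases lt_or_ge ‖x‖ t with h | h
    · refine (meromorphicAt_mul_apply (fun i j => (hU i j x (by linarith)).meromorphicAt)
        (hmer m' x hx) i j).congr ?_
      filter_upwards [hlt h] with z hz
      rw [hH₁U z hz]
    · have hx1 : 1 < ‖x‖ := by linarith
      refine (hWmer x hx1 i j).congr ?_
      filter_upwards [hgt hx1] with z hz
      rw [hH₁W z hz]
  have hH₁inf : ∀ i j, MeromorphicAt (fun w => H₁ w⁻¹ i j) 0 := fun i j => by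
    refine (meromorphicAt_mul_apply (fun i j => (hV i j 0 (by simp)).meromorphicAt)
      (meromorphicAt_laurentPolynomial S c (MeromorphicAt.id (0 : ℂ)).inv) i j).congr ?_
    filter_upwards [hlt (x := 0) (r := 1) (by simp), self_mem_nhdsWithin] with w hw hw0
    have h1 : 1 < ‖w⁻¹‖ := by
      rw [norm_inv]
      exact (one_lt_inv₀ (norm_pos_iff.2 hw0)).2 hw
    rw [hH₁W _ h1]
    simp [W]
  have hprod : mkMat (ofFun H₁ hH₁mer) * G.val = mkMat (ofFun H₀ fun i j x _ => hH₀mer i j x) := by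
    have h1 : mkMat (m' * m) = mkMat 1 := by
      rw [mkMat_mul, hm, hm', mkMat_one]
      exact G.inv_mul
    rw [← hm, ← mkMat_mul]
    refine mkMat_eq_mkMat.2 fun x hx => ?_
    filter_upwards [mkMat_eq_mkMat.1 h1 x hx] with z hz
    rw [evalMat_mul, evalMat_one] at hz
    rw [evalMat_mul, evalMat_ofFun, evalMat_ofFun]
    rcases le_or_gt ‖z‖ t with h | h
    · rw [hH₀U z (by linarith)]
      simp only [H₁, if_pos h]
      rw [Matrix.mul_assoc, hz, Matrix.mul_one]
    · rw [hH₀W z h, hH₁W z (by linarith)]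
  have hdet₀ : (mkMat (ofFun H₀ fun i j x _ => hH₀mer i j x)).det ≠ 0 := by
    -- It is enough to test the determinant near the point `1`, where `H₀ = U` and `U(1)` is
    -- invertible. The determinant of `H₁` is then nonzero by `H₁ M = H₀`.
    refine det_mkMat_ne_zero one_ne_zero ?_
    have h1 : ContinuousAt (fun z => (U z).det) 1 :=
      (analyticAt_det (analyticAt_matrix_iff.2 fun i j => hU i j 1 (by simpa))).continuousAt
    have h2 := h1.eventually_ne ((Matrix.isUnit_iff_isUnit_det _).1 hU1).ne_zero
    filter_upwards [nhdsWithin_le_nhds h2, hlt (x := 1) (r := s) (by simpa)] with z hz hzs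
    rwa [evalMat_ofFun, hH₀U z hzs]
  have hdet₁ : (mkMat (ofFun H₁ hH₁mer)).det ≠ 0 := fun h => hdet₀ (by
    rw [← hprod, Matrix.det_mul, h, zero_mul])
  obtain ⟨M₀, hM₀⟩ := exists_gl_merZero _ (fun i j => hH₀mer i j 0) hdet₀
  obtain ⟨M₁, hM₁⟩ := exists_gl_merInfty hH₁mer hH₁inf hdet₁
  refine ⟨M₀, M₁, eq_inv_mul_of_mul_eq (Units.ext ?_)⟩
  rw [Units.val_mul, hM₀, hM₁, hprod]

/-- Dilations serve here to rescale annuli; this undoes the rescaling. -/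
lemma shiftGL_inv_shiftGL (q : ℂˣ) (M : GL (Fin n) MerStar) : shiftGL q⁻¹ (shiftGL q M) = M := by
  refine Units.ext (Matrix.ext fun i j => ?_)
  obtain ⟨f, hf⟩ := Ideal.Quotient.mk_surjective (I := negligible) (M.val i j)
  change sigma q⁻¹ (sigma q (M.val i j)) = M.val i j
  rw [← hf]
  refine congrArg MerStar.mk (Subtype.ext (funext fun z => congrArg f.1 ?_))
  simp

/-- Birkhoff factorization of invertible matrices of meromorphic functions on `ℂ*`. -/
theorem exists_birkhoff_factorization (M : GL (Fin n) MerStar) :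
    ∃ (M₀ : GL (Fin n) merZero) (M₁ : GL (Fin n) merInfty),
      M = (upGL merInfty.val M₁)⁻¹ * upGL merZero.val M₀ := by
  obtain ⟨m, hm⟩ := mkMat_surjective M.val
  obtain ⟨m', hm'⟩ := mkMat_surjective (M⁻¹).val
  have hmm' : mkMat (m * m') = mkMat 1 := by
    rw [mkMat_mul, hm, hm', mkMat_one]
    exact M.mul_inv
  obtain ⟨a, ρ, b, ha, haρ, hρb, hP⟩ := exists_annulus
    (P := fun z => ((∀ i j, AnalyticAt ℂ (m i j).1 z) ∧ ∀ i j, AnalyticAt ℂ (m' i j).1 z) ∧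
      evalMat z m * evalMat z m' = 1) fun x hx => by
    refine ((eventually_all.2 fun i => eventually_all.2 fun j => ?_).and
      (eventually_all.2 fun i => eventually_all.2 fun j => ?_)).and ?_
    · exact ((m i j).2 x hx).eventually_analyticAt
    · exact ((m' i j).2 x hx).eventually_analyticAt
    · filter_upwards [mkMat_eq_mkMat.1 hmm' x hx] with z hz
      rwa [evalMat_mul, evalMat_one] at hz
  have hρ : 0 < ρ := ha.trans haρ
  -- Dilation by `ρ` carries the annulus `a < |z| < b` to `a/ρ < |z| < b/ρ`, which contains the unit
  -- circle.
  let r : ℂˣ := Units.mk0 (ρ : ℂ) (by exact_mod_cast hρ.ne')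
  have hr : ∀ z : ℂ, ‖(r : ℂ) * z‖ = ρ * ‖z‖ := fun z => by
    rw [norm_mul, Units.val_mk0, Complex.norm_real, Real.norm_of_nonneg hρ.le]
  have hP' : ∀ z : ℂ, a / ρ < ‖z‖ → ‖z‖ < b / ρ →
      ((∀ i j, AnalyticAt ℂ (m i j).1 (r * z)) ∧ ∀ i j, AnalyticAt ℂ (m' i j).1 (r * z)) ∧
      evalMat (r * z) m * evalMat (r * z) m' = 1 := fun z h1 h2 => by
    refine hP _ ?_ ?_
    · rw [hr]
      rwa [div_lt_iff₀' hρ] at h1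
    · rw [hr]
      rwa [lt_div_iff₀' hρ] at h2
  have hlin : ∀ z : ℂ, DifferentiableAt ℂ (fun z => (r : ℂ) * z) z := fun z => by fun_prop
  obtain ⟨M₀, M₁, h⟩ := exists_birkhoff_of_annulus (m := m.map (dilate r)) (m' := m'.map (dilate r))
    (G := shiftGL r M) (congrArg (shift r) hm)
    ((congrArg (shift r) hm').trans (congrArg Units.val (map_inv (upGL (sigma r)) M)))
    (a := a / ρ) (b := b / ρ) (by positivity) ((div_lt_one hρ).2 haρ) ((one_lt_div hρ).2 hρb)
    (fun i j z h1 h2 => DifferentiableAt.comp (g := (m i j).1) z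
      ((hP' z h1 h2).1.1 i j).differentiableAt (hlin z))
    (fun i j z h1 h2 => DifferentiableAt.comp (g := (m' i j).1) z
      ((hP' z h1 h2).1.2 i j).differentiableAt (hlin z))
    fun z h1 h2 => (hP' z h1 h2).2
  -- Dilations preserve `M(ℂ)` and `M(ℂ_∞)`, so the factors can be scaled back.
  refine ⟨Matrix.GeneralLinearGroup.map (SolQuad.sigmaZero r⁻¹).toRingHom M₀,
    Matrix.GeneralLinearGroup.map (SolQuad.sigmaInfty r⁻¹).toRingHom M₁, ?_⟩
  rw [← shiftGL_inv_shiftGL r M, h, shiftGL, map_mul, map_inv]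
  rfl

end Birkhoff

/-! ### Rational functions inside `M(ℂ)` and `M(ℂ_∞)` -/

lemma ratToMer_mem_merZero (r : RatFunc ℂ) : ratToMer r ∈ merZero :=
  ⟨_, by
    change MeromorphicAt (fun z => r.eval (RingHom.id ℂ) z) 0
    simp only [RatFunc.eval, Polynomial.eval₂_id]
    exact (r.num.differentiable.analyticAt _).meromorphicAt.div
      (r.denom.differentiable.analyticAt _).meromorphicAt, rfl⟩

lemma meromorphicAt_polynomial_eval_inv (p : Polynomial ℂ) :
    MeromorphicAt (fun w : ℂ => p.eval w⁻¹) 0 := by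
  simp only [Polynomial.eval_eq_sum_range]
  exact MeromorphicAt.fun_sum fun i _ => (MeromorphicAt.const _ _).mul
    ((MeromorphicAt.id 0).inv.pow _)

lemma ratToMer_mem_merInfty (r : RatFunc ℂ) : ratToMer r ∈ merInfty :=
  ⟨_, by
    change MeromorphicAt (fun w => r.eval (RingHom.id ℂ) w⁻¹) 0
    simp only [RatFunc.eval, Polynomial.eval₂_id]
    exact (meromorphicAt_polynomial_eval_inv _).div (meromorphicAt_polynomial_eval_inv _), rfl⟩

/-- The inclusion of `ℂ(z)` in `M(ℂ)`. -/
noncomputable def ratToZero : RatFunc ℂ →ₐ[ℂ] merZero :=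
  ratToMer.codRestrict merZero ratToMer_mem_merZero

/-- The inclusion of `ℂ(z)` in `M(ℂ_∞)`. -/
noncomputable def ratToInfty : RatFunc ℂ →ₐ[ℂ] merInfty :=
  ratToMer.codRestrict merInfty ratToMer_mem_merInfty

lemma up_val_injective (S : Subalgebra ℂ MerStar) {m n : ℕ} :
    Function.Injective (up S.val : Matrix (Fin m) (Fin n) S → _) :=
  Matrix.map_injective Subtype.val_injective

lemma up_ratToMer_injective {m n : ℕ} :
    Function.Injective (up ratToMer : Matrix (Fin m) (Fin n) (RatFunc ℂ) → _) :=
  Matrix.map_injective ratToMer_injective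

/-- Each entry is meromorphic at `0` and at `∞`, hence on the whole sphere, hence rational. -/
lemma exists_ratFunc_matrix {m n : ℕ} {S : Matrix (Fin m) (Fin n) merZero}
    {T : Matrix (Fin m) (Fin n) merInfty} (h : up merZero.val S = up merInfty.val T) :
    ∃ R : Matrix (Fin m) (Fin n) (RatFunc ℂ), up ratToMer R = up merZero.val S := by
  have h' : ∀ i j, ∃ r, ratToMer r = up merZero.val S i j := fun i j =>
    exists_ratToMer_eq (S i j).2 (by rw [h]; exact (T i j).2)
  choose r hr using h'
  exact ⟨Matrix.of r, by ext i j; exact hr i j⟩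

/-! ### Cancellation of invertible matrices -/

section Units

variable {L : Type} [CommRing L] {m n : ℕ}

lemma val_mul_inv_mul (A : GL (Fin m) L) (B : Matrix (Fin m) (Fin n) L) :
    A.val * ((A⁻¹).val * B) = B := by
  rw [← Matrix.mul_assoc, ← Units.val_mul, mul_inv_cancel, Units.val_one, Matrix.one_mul]

lemma inv_mul_val_mul (A : GL (Fin m) L) (B : Matrix (Fin m) (Fin n) L) :
    (A⁻¹).val * (A.val * B) = B := by
  rw [← Matrix.mul_assoc, ← Units.val_mul, inv_mul_cancel, Units.val_one, Matrix.one_mul]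

lemma mul_inv_val (A : GL (Fin m) L) : (A⁻¹).val * A.val = 1 := by
  rw [← Units.val_mul, inv_mul_cancel, Units.val_one]

lemma val_mul_inv (A : GL (Fin m) L) : A.val * (A⁻¹).val = 1 := by
  rw [← Units.val_mul, mul_inv_cancel, Units.val_one]

lemma val_mul_left_cancel (A : GL (Fin m) L) {B C : Matrix (Fin m) (Fin n) L}
    (h : A.val * B = A.val * C) : B = C := by
  rw [← inv_mul_val_mul A B, h, inv_mul_val_mul]

lemma val_mul_right_cancel (A : GL (Fin n) L) {B C : Matrix (Fin m) (Fin n) L}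
    (h : B * A.val = C * A.val) : B = C := by
  rw [← Matrix.mul_one B, ← Matrix.mul_one C, ← val_mul_inv A, ← Matrix.mul_assoc, h,
    Matrix.mul_assoc]

end Units

/-- A morphism of equations transported to solutions intertwines the constant matrices. -/
lemma shift_conj_intertwines (q : ℂˣ) {n p : ℕ} {A : GL (Fin n) MerStar} {B : GL (Fin p) MerStar}
    {M a : GL (Fin n) MerStar} {N b : GL (Fin p) MerStar}
    (hA : A = shiftGL q M * a * M⁻¹) (hB : B = shiftGL q N * b * N⁻¹)
    {F S : Matrix (Fin p) (Fin n) MerStar} (hF : shift q F * A.val = B.val * F)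
    (hS : F * M.val = N.val * S) : shift q S * a.val = b.val * S := by
  have h₁ : shift q F * (shiftGL q M).val = (shiftGL q N).val * shift q S := by
    have := congrArg (shift q) hS
    rwa [shift, up_mul, shift, up_mul] at this
  apply val_mul_left_cancel (shiftGL q N)
  rw [← Matrix.mul_assoc, ← h₁]
  have h₂ : (N⁻¹).val * F = S * (M⁻¹).val := by
    apply val_mul_right_cancel M
    rw [Matrix.mul_assoc, hS, inv_mul_val_mul, Matrix.mul_assoc, mul_inv_val, Matrix.mul_one]
  rw [hA, hB] at hF
  apply val_mul_right_cancel M⁻¹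
  simp only [Units.val_mul, Matrix.mul_assoc] at hF ⊢
  rw [hF, h₂]

/-! ### The functors are fully faithful and essentially surjective -/

namespace SolQuad

variable {q : ℂˣ}

/-- `F` determines the other components: `S = N⁻¹ F M` at `0` and at `∞`. -/
instance : (toFuchsEqn q).Faithful where
  map_injective {X Y f g} h := by
    have h₁ : f.1.1 = g.1.1 := congrArg (fun k : (toFuchsEqn q).obj X ⟶ (toFuchsEqn q).obj Y => Eqn.toMat k.hom) h
    refine Subtype.ext (Prod.ext h₁ (Prod.ext ?_ ?_))
    · refine up_val_injective _ (val_mul_left_cancel Y.M₀ ?_)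
      exact f.2.2.2.1.symm.trans ((congrArg (fun k => up ratToMer k * X.M₀.val) h₁).trans
        g.2.2.2.1)
    · refine up_val_injective _ (val_mul_left_cancel Y.M₁ ?_)
      exact f.2.2.2.2.symm.trans ((congrArg (fun k => up ratToMer k * X.M₁.val) h₁).trans
        g.2.2.2.2)

/-- As `K` contains `ℂ(z)`, the solution `N⁻¹ F M` of `F M = N S` has its coefficients in `K`; this
is used for `K = M(ℂ)` and `K = M(ℂ_∞)`. -/
lemma up_eq_of_factor {K : Type} [CommRing K] [Algebra ℂ K] (ι : K →ₐ[ℂ] MerStar)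
    (j : RatFunc ℂ →ₐ[ℂ] K) (hj : ∀ r, ι (j r) = ratToMer r) {n p : ℕ} (M : GL (Fin n) K)
    (N : GL (Fin p) K) (F : Matrix (Fin p) (Fin n) (RatFunc ℂ)) :
    Square ratToMer ι (upGL ι M) (upGL ι N) F ((N⁻¹).val * F.map j * M.val) := by
  have h : up ι (F.map j) = up ratToMer F := by ext i k; exact hj _
  change up ratToMer F * up ι M.val = up ι N.val * up ι ((N⁻¹).val * F.map j * M.val)
  rw [← h, ← up_mul, ← up_mul, Matrix.mul_assoc, val_mul_inv_mul]

instance : (toFuchsEqn q).Full where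
  map_surjective {X Y} g := by
    let F : Matrix (Fin Y.dim) (Fin X.dim) (RatFunc ℂ) := Eqn.toMat g.hom
    have hF : shift q (up ratToMer F) * (upGL ratToMer X.mat).val =
      (upGL ratToMer Y.mat).val * up ratToMer F := g.hom.2
    have h₀ := up_eq_of_factor merZero.val ratToZero (fun _ => rfl) X.Mzero Y.Mzero F
    have h₁ := up_eq_of_factor merInfty.val ratToInfty (fun _ => rfl) X.Minfty Y.Minfty F
    exact ⟨⟨(F, _, _),
      shift_conj_intertwines q X.mat_eq_zero Y.mat_eq_zero hF h₀,
      shift_conj_intertwines q X.mat_eq_infty Y.mat_eq_infty hF h₁, h₀, h₁⟩, rfl⟩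

instance : (toConnTriple q).Faithful where
  map_injective {X Y f g} h := by
    have h₁ : f.1.2.1 = g.1.2.1 := congrArg ConnTriple.Szero h
    have h₂ : f.1.2.2 = g.1.2.2 := congrArg ConnTriple.Sinfty h
    refine Subtype.ext (Prod.ext ?_ (Prod.ext h₁ h₂))
    refine up_ratToMer_injective (val_mul_right_cancel X.M₀ ?_)
    exact f.2.2.2.1.trans ((congrArg (fun k => Y.M₀.val * up merZero.val k) h₁).trans
      g.2.2.2.1.symm)

/-- The missing component must be `N⁽⁰⁾ S⁽⁰⁾ (M⁽⁰⁾)⁻¹`. Compatibility with the connection matrices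
equates it with the analogous product at `∞`, which makes it rational. -/
instance : (toConnTriple q).Full where
  map_surjective {X Y} g := by
    let S : Matrix (Fin Y.dim) (Fin X.dim) merZero := g.1.1
    let T : Matrix (Fin Y.dim) (Fin X.dim) merInfty := g.1.2
    have hST : Square merInfty.val merZero.val X.triple.M Y.triple.M T S := g.2.2.2
    change up merInfty.val T * (X.M₁⁻¹ * X.M₀).val = (Y.M₁⁻¹ * Y.M₀).val * up merZero.val S at hST
    have h : up merZero.val (Y.Mzero.val * S * (X.Mzero⁻¹).val) =
        up merInfty.val (Y.Minfty.val * T * (X.Minfty⁻¹).val) := by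
      simp only [up_mul]
      change Y.M₀.val * up merZero.val S * (X.M₀⁻¹).val =
        Y.M₁.val * up merInfty.val T * (X.M₁⁻¹).val
      rw [Units.val_mul, Units.val_mul] at hST
      have h' := congrArg (fun Z => Y.M₁.val * Z * (X.M₀⁻¹).val) hST
      simp only [Matrix.mul_assoc, val_mul_inv, val_mul_inv_mul, Matrix.mul_one] at h' ⊢
      exact h'.symm
    obtain ⟨F, hF⟩ := exists_ratFunc_matrix h
    have h₀ : Square ratToMer merZero.val X.M₀ Y.M₀ F S := by
      change up ratToMer F * up merZero.val X.Mzero.val =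
        up merZero.val Y.Mzero.val * up merZero.val S
      rw [hF, ← up_mul, ← up_mul, Matrix.mul_assoc, mul_inv_val, Matrix.mul_one]
    have h₁ : Square ratToMer merInfty.val X.M₁ Y.M₁ F T := by
      change up ratToMer F * up merInfty.val X.Minfty.val =
        up merInfty.val Y.Minfty.val * up merInfty.val T
      rw [hF, h, ← up_mul, ← up_mul, Matrix.mul_assoc, mul_inv_val, Matrix.mul_one]
    exact ⟨⟨(F, S, T), g.2.1, g.2.2.1, h₀, h₁⟩, rfl⟩

/-- Solutions at `0` and `∞` of the same equation are connected by construction. The resulting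
quadruple is sent to the given equation itself, since a rational matrix is determined by its image
over `M(ℂ*)`. -/
lemma toFuchsEqn_essSurj (hq : 1 < ‖(q : ℂ)‖) : (toFuchsEqn q).EssSurj where
  mem_essImage X := by
    obtain ⟨A, M, hAM⟩ := exists_solution_zero hq X.property.1
    obtain ⟨B, N, hBN⟩ := exists_solution_infty hq X.property.2
    let Y : SolQuad q := ⟨X.obj.dim, A, M, B, N, hBN.symm.trans hAM⟩
    have hY : (toFuchsEqn q).obj Y = X :=
      ObjectProperty.FullSubcategory.ext (congrArg (Eqn.mk X.obj.dim)
        (upGL_ratToMer_injective (Y.mat_eq_zero.trans hAM.symm)))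
    exact ⟨Y, ⟨eqToIso hY⟩⟩

/-- After the factorization `M = M₁⁻¹ M₀`, the relation `(σ_q M) A = B M` rearranges to
connectedness, and the quadruple is sent exactly to the given triple. -/
lemma toConnTriple_essSurj : (toConnTriple q).EssSurj where
  mem_essImage X := by
    obtain ⟨n, A, M, B, hM⟩ := X
    obtain ⟨M₀, M₁, rfl⟩ := exists_birkhoff_factorization M
    refine ⟨⟨n, A, M₀, B, M₁, ?_⟩, ⟨Iso.refl _⟩⟩
    rw [shiftGL, map_mul, map_inv] at hM
    rw [eq_mul_inv_iff_mul_eq, mul_assoc, mul_assoc, ← hM]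
    group

/-! ### Compatibility with tensor products and units -/

/-- The rational matrix of a quadruple is obtained by choice, so it is identified through its
characterization over `M(ℂ*)`, where Kronecker products commute with products, inverses and `σ_q`.
-/
lemma mat_tensor (X Y : SolQuad q) : (X.tensor Y).mat = kronGL X.mat Y.mat := by
  refine upGL_ratToMer_injective ((X.tensor Y).mat_eq_zero.trans ?_)
  change shiftGL q (upGL merZero.val (kronGL X.Mzero Y.Mzero)) * cst (kronGL X.Azero Y.Azero) *
    (upGL merZero.val (kronGL X.Mzero Y.Mzero))⁻¹ = upGL ratToMer (kronGL X.mat Y.mat)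
  simp only [upGL_kron, mat_eq_zero, kronGL_mul, kronGL_inv]

lemma mat_unit : (unit q).mat = (1 : GL (Fin 1) (RatFunc ℂ)) := by
  refine upGL_ratToMer_injective ((unit q).mat_eq_zero.trans ?_)
  change shiftGL q (upGL merZero.val (1 : GL (Fin 1) merZero)) * cst (1 : GL (Fin 1) ℂ) *
    (upGL merZero.val (1 : GL (Fin 1) merZero))⁻¹ = upGL ratToMer (1 : GL (Fin 1) (RatFunc ℂ))
  simp only [map_one, inv_one, mul_one]

/-- Equality of the matrices of two equations makes the identity matrix a morphism. -/
lemma one_mem_homs {n : ℕ} {A B : GL (Fin n) (RatFunc ℂ)} (h : A = B) :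
    (1 : Matrix (Fin n) (Fin n) (RatFunc ℂ)) ∈ Eqn.homs (q := q) ⟨n, A⟩ ⟨n, B⟩ := by
  subst h
  exact Square.one

/-- The connection matrices are kept as separate variables because those of a tensor product are
equal but not definitionally so. -/
lemma one_pair_mem_homs (X : ConnTriple q) {M : GL (Fin X.dim) MerStar}
    (hM : shiftGL q M * cst X.Azero = cst X.Ainfty * M) (h : X.M = M) :
    ((1, 1) : Matrix (Fin X.dim) (Fin X.dim) merZero × Matrix (Fin X.dim) (Fin X.dim) merInfty) ∈
      ConnTriple.homs X ⟨X.dim, X.Azero, M, X.Ainfty, hM⟩ := by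
  subst h
  exact ⟨Square.one, Square.one, Square.one⟩

end SolQuad
end QDiff

namespace QDiff
namespace SolQuad

variable {q : ℂˣ}

/-! ### Coherence for structure maps given by identity matrices -/

section Coherence

variable {L : Type} [CommRing L]

lemma one_mul_eq_mul_one {m n : ℕ} (F : Matrix (Fin m) (Fin n) L) :
    (1 : Matrix (Fin m) (Fin m) L) * F = F * (1 : Matrix (Fin n) (Fin n) L) := by
  rw [Matrix.one_mul, Matrix.mul_one]

/-- With identity matrices as structure maps, associativity and unit diagrams say only that the
permutation matrix of the constraint equals itself times identities. -/
lemma mul_one_mul_kron_one {m a b : ℕ} (F : Matrix (Fin m) (Fin (a * b)) L) :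
    F = (F * (1 : Matrix (Fin (a * b)) (Fin (a * b)) L)) *
      kron (1 : Matrix (Fin a) (Fin a) L) (1 : Matrix (Fin b) (Fin b) L) := by
  rw [kron_one, Matrix.mul_one, Matrix.mul_one]

lemma one_mul_kron_one_mul {m a b : ℕ} (F : Matrix (Fin (a * b)) (Fin m) L) :
    F = ((1 : Matrix (Fin (a * b)) (Fin (a * b)) L) *
      kron (1 : Matrix (Fin a) (Fin a) L) (1 : Matrix (Fin b) (Fin b) L)) * F := by
  rw [kron_one, Matrix.one_mul, Matrix.one_mul]

end Coherence

/-- Two equations with the same matrix are isomorphic through the identity matrix. -/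
noncomputable def eqnIso {n : ℕ} {A B : GL (Fin n) (RatFunc ℂ)} (h : A = B) :
    (⟨n, A⟩ : Eqn q) ≅ ⟨n, B⟩ where
  hom := ⟨(1 : Matrix (Fin n) (Fin n) (RatFunc ℂ)), one_mem_homs h⟩
  inv := ⟨(1 : Matrix (Fin n) (Fin n) (RatFunc ℂ)), one_mem_homs h.symm⟩
  hom_inv_id := Subtype.ext (Matrix.one_mul (1 : Matrix (Fin n) (Fin n) (RatFunc ℂ)))
  inv_hom_id := Subtype.ext (Matrix.one_mul (1 : Matrix (Fin n) (Fin n) (RatFunc ℂ)))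

/-- The tensor structure on the functor to fuchsian equations, given by identity matrices. -/
noncomputable def toFuchsEqnCore (q : ℂˣ) : (toFuchsEqn q).CoreMonoidal where
  εIso := (isFuchsian q).isoMk (eqnIso mat_unit.symm)
  μIso X Y := (isFuchsian q).isoMk (eqnIso (mat_tensor X Y).symm)
  μIso_hom_natural_left _ _ := ObjectProperty.hom_ext _ (Subtype.ext
    (one_mul_eq_mul_one (L := RatFunc ℂ) _))
  μIso_hom_natural_right _ _ := ObjectProperty.hom_ext _ (Subtype.ext
    (one_mul_eq_mul_one (L := RatFunc ℂ) _))
  associativity X Y Z := ObjectProperty.hom_ext _ (Subtype.ext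
    ((mul_one_mul_kron_one (L := RatFunc ℂ) _).symm.trans
      (one_mul_kron_one_mul (L := RatFunc ℂ) (permMat _ (assocEquiv X.dim Y.dim Z.dim)))))
  left_unitality X := ObjectProperty.hom_ext _ (Subtype.ext
    (mul_one_mul_kron_one (L := RatFunc ℂ) (permMat _ (leftEquiv X.dim))))
  right_unitality X := ObjectProperty.hom_ext _ (Subtype.ext
    (mul_one_mul_kron_one (L := RatFunc ℂ) (permMat _ (rightEquiv X.dim))))

/-- The functor to fuchsian equations is a symmetric monoidal functor. -/
noncomputable instance toFuchsEqnBraided (q : ℂˣ) : (toFuchsEqn q).Braided where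
  __ := (toFuchsEqnCore q).toMonoidal
  braided X Y := ObjectProperty.hom_ext _ (Subtype.ext
    (one_mul_eq_mul_one (L := RatFunc ℂ) (permMat _ (swapEquiv X.dim Y.dim))).symm)

/-- Two triples with the same matrices are isomorphic through identity matrices. -/
noncomputable def tripleIso {n : ℕ} (A : GL (Fin n) ℂ) {M N : GL (Fin n) MerStar}
    (B : GL (Fin n) ℂ) (hM : shiftGL q M * cst A = cst B * M)
    (hN : shiftGL q N * cst A = cst B * N) (h : M = N) :
    (⟨n, A, M, B, hM⟩ : ConnTriple q) ≅ ⟨n, A, N, B, hN⟩ where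
  hom := ⟨(1, 1), one_pair_mem_homs ⟨n, A, M, B, hM⟩ hN h⟩
  inv := ⟨(1, 1), one_pair_mem_homs ⟨n, A, N, B, hN⟩ hM h.symm⟩
  hom_inv_id := Subtype.ext (Prod.ext (Matrix.one_mul (1 : Matrix (Fin n) (Fin n) merZero))
    (Matrix.one_mul (1 : Matrix (Fin n) (Fin n) merInfty)))
  inv_hom_id := Subtype.ext (Prod.ext (Matrix.one_mul (1 : Matrix (Fin n) (Fin n) merZero))
    (Matrix.one_mul (1 : Matrix (Fin n) (Fin n) merInfty)))

lemma triple_tensor_M (X Y : SolQuad q) :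
    kronGL X.triple.M Y.triple.M = (X.tensor Y).triple.M := by
  change kronGL (X.M₁⁻¹ * X.M₀) (Y.M₁⁻¹ * Y.M₀) =
    (upGL merInfty.val (kronGL X.Minfty Y.Minfty))⁻¹ * upGL merZero.val (kronGL X.Mzero Y.Mzero)
  rw [upGL_kron, upGL_kron, kronGL_mul, kronGL_inv]

lemma triple_unit_M : (1 : GL (Fin 1) MerStar) = (unit q).triple.M := by
  change 1 = (upGL merInfty.val (1 : GL (Fin 1) merInfty))⁻¹ *
    upGL merZero.val (1 : GL (Fin 1) merZero)
  rw [map_one, map_one, inv_one, mul_one]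

/-- The tensor structure on the functor to connection triples, given by identity matrices. -/
noncomputable def toConnTripleCore (q : ℂˣ) : (toConnTriple q).CoreMonoidal where
  εIso := tripleIso 1 1 (ConnTriple.unit q).conn (unit q).triple.conn triple_unit_M
  μIso X Y := tripleIso (kronGL X.Azero Y.Azero) (kronGL X.Ainfty Y.Ainfty)
    (X.triple.tensor Y.triple).conn (X.tensor Y).triple.conn (triple_tensor_M X Y)
  μIso_hom_natural_left _ _ := Subtype.ext (Prod.ext (one_mul_eq_mul_one (L := merZero) _)
    (one_mul_eq_mul_one (L := merInfty) _))
  μIso_hom_natural_right _ _ := Subtype.ext (Prod.ext (one_mul_eq_mul_one (L := merZero) _)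
    (one_mul_eq_mul_one (L := merInfty) _))
  associativity X Y Z := Subtype.ext (Prod.ext
    ((mul_one_mul_kron_one (L := merZero) _).symm.trans
      (one_mul_kron_one_mul (L := merZero) (permMat _ (assocEquiv X.dim Y.dim Z.dim))))
    ((mul_one_mul_kron_one (L := merInfty) _).symm.trans
      (one_mul_kron_one_mul (L := merInfty) (permMat _ (assocEquiv X.dim Y.dim Z.dim)))))
  left_unitality X := Subtype.ext (Prod.ext
    (mul_one_mul_kron_one (L := merZero) (permMat _ (leftEquiv X.dim)))
    (mul_one_mul_kron_one (L := merInfty) (permMat _ (leftEquiv X.dim))))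
  right_unitality X := Subtype.ext (Prod.ext
    (mul_one_mul_kron_one (L := merZero) (permMat _ (rightEquiv X.dim)))
    (mul_one_mul_kron_one (L := merInfty) (permMat _ (rightEquiv X.dim))))

/-- The functor to connection triples is a symmetric monoidal functor. -/
noncomputable instance toConnTripleBraided (q : ℂˣ) : (toConnTriple q).Braided where
  __ := (toConnTripleCore q).toMonoidal
  braided X Y := Subtype.ext (Prod.ext
    (one_mul_eq_mul_one (L := merZero) (permMat _ (swapEquiv X.dim Y.dim))).symm
    (one_mul_eq_mul_one (L := merInfty) (permMat _ (swapEquiv X.dim Y.dim))).symm)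

end SolQuad
end QDiff

/-! ### The two tensor equivalences -/

theorem mainTheorem6 (q : ℂˣ) (hq : 1 < ‖(q : ℂ)‖) :
    ((QDiff.SolQuad.toFuchsEqn q).IsEquivalence ∧
      (QDiff.SolQuad.toFuchsEqn q).Additive ∧
      (QDiff.SolQuad.toFuchsEqn q).Linear ℂ ∧
      ∃ _ : (QDiff.SolQuad.toFuchsEqn q).Braided,
        (∀ X Y : QDiff.SolQuad q,
          QDiff.Eqn.toMat (Functor.LaxMonoidal.μ (QDiff.SolQuad.toFuchsEqn q) X Y).hom =
            (1 : Matrix (Fin (X.dim * Y.dim)) (Fin (X.dim * Y.dim)) (RatFunc ℂ))) ∧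
        QDiff.Eqn.toMat (Functor.LaxMonoidal.ε (QDiff.SolQuad.toFuchsEqn q)).hom =
          (1 : Matrix (Fin 1) (Fin 1) (RatFunc ℂ))) ∧
    ((QDiff.SolQuad.toConnTriple q).IsEquivalence ∧
      (QDiff.SolQuad.toConnTriple q).Additive ∧
      (QDiff.SolQuad.toConnTriple q).Linear ℂ ∧
      ∃ _ : (QDiff.SolQuad.toConnTriple q).Braided,
        (∀ X Y : QDiff.SolQuad q,
          QDiff.ConnTriple.Szero (Functor.LaxMonoidal.μ (QDiff.SolQuad.toConnTriple q) X Y) =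
            (1 : Matrix (Fin (X.dim * Y.dim)) (Fin (X.dim * Y.dim)) QDiff.merZero) ∧
          QDiff.ConnTriple.Sinfty (Functor.LaxMonoidal.μ (QDiff.SolQuad.toConnTriple q) X Y) =
            (1 : Matrix (Fin (X.dim * Y.dim)) (Fin (X.dim * Y.dim)) QDiff.merInfty)) ∧
        QDiff.ConnTriple.Szero (Functor.LaxMonoidal.ε (QDiff.SolQuad.toConnTriple q)) =
          (1 : Matrix (Fin 1) (Fin 1) QDiff.merZero) ∧
        QDiff.ConnTriple.Sinfty (Functor.LaxMonoidal.ε (QDiff.SolQuad.toConnTriple q)) =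
          (1 : Matrix (Fin 1) (Fin 1) QDiff.merInfty)) := by
  have h₁ := QDiff.SolQuad.toFuchsEqn_essSurj hq
  have h₂ := QDiff.SolQuad.toConnTriple_essSurj (q := q)
  -- Each `{ }` gathers faithfulness, fullness and essential surjectivity. Linearity and the shape
  -- of the structure maps hold by `rfl`, since the functors project onto components and the
  -- structure maps are literally `1`.
  exact ⟨⟨{ }, { map_add := rfl }, { map_smul := fun _ _ => rfl },
      QDiff.SolQuad.toFuchsEqnBraided q, fun _ _ => rfl, rfl⟩,
    ⟨{ }, { map_add := rfl }, { map_smul := fun _ _ => rfl },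
      QDiff.SolQuad.toConnTripleBraided q, fun _ _ => ⟨rfl, rfl⟩, rfl, rfl⟩⟩
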